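/- **Calculus.** A signature consists of sets $\mathcal F_n$ of function symbols and $\mathcal P_n$ of procedure symbols for each arity $n\in\mathbb N$. Values and computations are generated (up to renaming of bound variables) by $$V ::= x \mid f(V_1,\dots,V_n) \mid \lambda x.M, \qquad M ::= \mathsf{return}\,V \mid \mathsf{let}\ x = M\ \mathsf{in}\ M' \mid p(V_1,\dots,V_n)\mid V\,W .$$ Provable equality, of terms with free variables in a given context, is the least congruence containing $\mathsf{let}\ x=\mathsf{return}\,V\ \mathsf{in}\ M\equiv M[x:=V]$; $\ \mathsf{let}\ x=M\ \mathsf{in}\ \mathsf{return}\,x\equiv M$; $\ \mathsf{let}\ x_2=(\mathsf{let}\ x_1=M_1\ \mathsf{in}\ M_2)\ \mathsf{in}\ M\equiv \mathsf{let}\ x_1=M_1\ \mathsf{in}\ \mathsf{let}\ x_2=M_2\ \mathsf{in}\ M$ with $x_1$ not free in $M$; and $(\lambda x.M)V\equiv M[x:=V]$. Let $\mathrm{Val}(n)$, $\mathrm{Cmp}(n)$ be the sets of values, computations with free variables among $x_1,\dots,x_n$, modulo provable equality. Functions $r:[m]\to[n]$ act by renaming, $g\mapsto g[r]$. Define $f\{a\dashv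 g\vdash b\}$, for $f$ of arity $a+1+b$ and $g$ of arity $k$, by substituting (in $\mathrm{Val}$) $g$ for the $(a+1)$-st variable $y$ of $f$, and (in $\mathrm{Cmp}$) as $\mathsf{let}\ y=g\ \mathsf{in}\ f$, the context of $g$ taking the place of $y$; the result has arity $a+k+b$. The identities are $\mathrm{id}=[x_1]\in\mathrm{Val}(1)$ and $\mathrm{id}=[\mathsf{return}\,x_1]\in\mathrm{Cmp}(1)$. **Models.** A *pre-PROP* is a strict symmetric premonoidal category with objects the natural numbers and tensor $+$ on objects; $k\dashv(-)$ and $(-)\vdash k$ denote whiskering. A *cartesian PROP* is a pre-PROP in which all morphisms are central, with natural commutative comonoids $\Delta_n:n\to n+n$, $!_n:n\to 0$ compatible with $+$. A *Freyd PROP* $(V,C,J)$ is a cartesian PROP $V$, a pre-PROP $C$, and an identity-on-objects functor $J:V\to C$ preserving whiskering and symmetries, with central image. It is a *weakly closed Freyd PROP with interpretations of the signature* if it carries morphisms $[\![f]\!]\in V(n,1)$ for $f\in\mathcal F_n$ and $[\![p]\!]\in C(n,1)$ for $p\in\mathcal P_n$, a morphism $\mathsf{app}\in C(2,1)$, and maps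 $\Lambda_n:C(n+1,1)\to V(n,1)$, natural in the object $n$ of $V$ (that is, $\Lambda_m(f\circ(J(v)\vdash 1))=\Lambda_n(f)\circ v$ for $v\in V(m,n)$), with $\mathsf{app}\circ(J(\Lambda_n f)\vdash 1)=f$. A *morphism* is a pair of identity-on-objects functors on $V$ and $C$ preserving whiskering and symmetries, commuting with $J$, and preserving $\Delta$, $!$, $\mathsf{app}$, $\Lambda$, $[\![f]\!]$ and $[\![p]\!]$. **Substitutions.** For $O=\mathrm{Val}$ or $\mathrm{Cmp}$, consider words, composed by concatenation (a word $XY$ is $X\circ Y$), in the letters $\{a\dashv g\vdash b\}:a+n+b\to a+1+b$ for $g\in O(n)$, and $r:n\to m$ for functions $r:[m]\to[n]$. Write $\sigma_{m,n}:[m+n]\to[n+m]$, $\Delta_n:[n+n]\to[n]$, $!_n:[0]\to[n]$ for the block swap, the codiagonal and the empty function. The following rules are imposed inside words: - $\{a\dashv \mathrm{id}\vdash b\}\cong\emptyset$; $\ \mathrm{id}_m\cong\emptyset$; $\ r\,r'\cong r'\circ r$; - $\{a\dashv g\vdash b\}\{a+c\dashv h\vdash d+b\}\cong\{a\dashv g\{c\dashv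 h\vdash d\}\vdash b\}$; - $\{a\dashv g\vdash b\}\,(r_1+r+r_2)\cong(r_1+\mathrm{id}_1+r_2)\,\{a'\dashv g[r]\vdash b'\}$ for $r_1:[a]\to[a']$, $r_2:[b]\to[b']$; - $(\mathrm{id}_a+\sigma_{1,1}+\mathrm{id}_b)\{a\dashv g\vdash 1+b\}\cong\{a+1\dashv g\vdash b\}(\mathrm{id}_a+\sigma_{1,n}+\mathrm{id}_b)$ and $(\mathrm{id}_a+\sigma_{1,1}+\mathrm{id}_b)\{a+1\dashv g\vdash b\}\cong\{a\dashv g\vdash 1+b\}(\mathrm{id}_a+\sigma_{n,1}+\mathrm{id}_b)$; - $\{a\dashv g_1\vdash m+1+b\}\{a+n_1+m\dashv g_2\vdash b\}\cong\{a+1+m\dashv g_2\vdash b\}\{a\dashv g_1\vdash m+n_2+b\}$ whenever $g_1$ or $g_2$ is pure; - $(\mathrm{id}_a+{!_1}+\mathrm{id}_b)\{a\dashv g\vdash b\}\cong(\mathrm{id}_a+{!_n}+\mathrm{id}_b)$ and $(\mathrm{id}_a+\Delta_1+\mathrm{id}_b)\{a\dashv g\vdash b\}\cong\{a\dashv g\vdash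 1+b\}\{a+n\dashv g\vdash b\}(\mathrm{id}_a+\Delta_n+\mathrm{id}_b)$ for $g\in O(n)$ pure. Here every element of $\mathrm{Val}$ is pure, and the pure elements of $\mathrm{Cmp}$ are the classes of the computations $\mathsf{return}\,V$. Let $\mathrm{CSub}(\mathrm{Val})(m,n)$ and $\mathrm{Sub}(\mathrm{Cmp})(m,n)$ be the sets of words $m\to n$ modulo the generated congruence. Whiskering acts letterwise by $k\dashv\{a\dashv g\vdash b\}\vdash l=\{k+a\dashv g\vdash b+l\}$ and $k\dashv r\vdash l=\mathrm{id}_k+r+\mathrm{id}_l$; symmetry, copy and discard are the one-letter words on the block swap $\sigma_{n,m}$ (as an arrow $m+n\to n+m$), $\Delta_n$ and $!_n$; $J^{\mathrm{Sub}}$ applies $V\mapsto\mathsf{return}\,V$ to letters $\{a\dashv V\vdash b\}$ and leaves renamings unchanged. **Corollary (PROP-level initiality).** There are unique maps $\Lambda_n:\mathrm{Sub}(\mathrm{Cmp})(n+1,1)\to\mathrm{CSub}(\mathrm{Val})(n,1)$ with $\Lambda_n(\{0\dashv[M]\vdash0\})=\{0\dashv[\lambda x_{n+1}.M]\vdash0\}$.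 With these, with $\mathsf{app}=\{0\dashv[x_1\,x_2]\vdash0\}$, $[\![f]\!]=\{0\dashv[f(x_1,\dots,x_n)]\vdash0\}$ and $[\![p]\!]=\{0\dashv[p(x_1,\dots,x_n)]\vdash0\}$, the triple $(\mathrm{CSub}(\mathrm{Val}),\mathrm{Sub}(\mathrm{Cmp}),J^{\mathrm{Sub}})$ is a weakly closed Freyd PROP with interpretations of the signature, and it is initial among these: it has exactly one morphism to every other one. -/

import Mathlib

/-! # Weakly closed Freyd PROPs, the untyped computational lambda calculus, and the
Freyd PROP of substitutions on its term model -/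

universe u v w

namespace FreydCLC

/-! ## Renamings -/

/-- A renaming `m → n` is a function between the finite sets `[m]` and `[n]`. -/
abbrev Ren (m n : ℕ) : Type := Fin m → Fin n

namespace Ren

/-- The block sum `r + r'`. -/
def add {m n m' n' : ℕ} (r : Ren m n) (r' : Ren m' n') : Ren (m + m') (n + n') :=
  Fin.addCases (fun i => Fin.castAdd n' (r i)) (fun j => Fin.natAdd n (r' j))

/-- The swap `(n+1, …, n+m, 1, …, n) : m + n → n + m`. -/
def symm (m n : ℕ) : Ren (m + n) (n + m) :=
  Fin.addCases (fun i => Fin.natAdd n i) (fun j => Fin.castAdd m j)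

/-- The renaming `() : 0 → n`. -/
def discard (n : ℕ) : Ren 0 n := fun i => i.elim0

/-- The renaming `(1, …, n, 1, …, n) : 2n → n`. -/
def copy (n : ℕ) : Ren (n + n) n := Fin.addCases id id

/-- Transport of a renaming along equalities of arities. -/
def cast {m n m' n' : ℕ} (hm : m = m') (hn : n = n') (r : Ren m n) : Ren m' n' :=
  fun i => Fin.cast hn (r (Fin.cast hm.symm i))

/-- `r + id₁`, the action of `r` under a binder (the bound variable comes last). -/
def lift {m n : ℕ} (r : Ren m n) : Ren (m + 1) (n + 1) :=
  Fin.lastCases (Fin.last n) (fun i => (r i).castSucc)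

theorem add_val {m n m' n' : ℕ} (r : Ren m n) (r' : Ren m' n') (i : Fin (m + m')) :
    (add r r' i).val =
      if h : i.val < m then (r ⟨i.val, h⟩).val
      else n + (r' ⟨i.val - m, by omega⟩).val := by
  induction i using Fin.addCases with
  | left i => simp [add]
  | right j => simp [add]

theorem add_id_id (m n : ℕ) : add (id : Ren m m) (id : Ren n n) = id := by
  funext i
  apply Fin.ext
  rw [add_val]
  split_ifs
  · rfl
  · simp only [id]; omega

theorem add_left3 (k : ℕ) {a a' b b' c c' : ℕ} (r₁ : Ren a a') (r : Ren b b') (r₂ : Ren c c') :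
    add (id : Ren k k) (add (add r₁ r) r₂) =
      cast (by omega) (by omega) (add (add (add (id : Ren k k) r₁) r) r₂) := by
  funext i
  apply Fin.ext
  simp only [cast, Fin.val_cast, add_val, id]
  split_ifs <;> first | omega | simp only [Nat.sub_sub, Nat.add_assoc]

theorem add_right3 (k : ℕ) {a a' b b' c c' : ℕ} (r₁ : Ren a a') (r : Ren b b') (r₂ : Ren c c') :
    add (add (add r₁ r) r₂) (id : Ren k k) =
      cast (by omega) (by omega) (add (add r₁ r) (add r₂ (id : Ren k k))) := by
  funext i
  apply Fin.ext
  simp only [cast, Fin.val_cast, add_val, id]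
  split_ifs <;> omega

theorem add_comp {a b c a' b' c' : ℕ} (r : Ren a b) (s : Ren b c) (r' : Ren a' b')
    (s' : Ren b' c') : add (s ∘ r) (s' ∘ r') = add s s' ∘ add r r' := by
  funext i
  induction i using Fin.addCases with
  | left i => simp [add]
  | right j => simp [add]

theorem lift_comp {a b c : ℕ} (r : Ren a b) (s : Ren b c) : lift (s ∘ r) = lift s ∘ lift r := by
  funext i
  induction i using Fin.lastCases with
  | last => simp [lift]
  | cast i => simp [lift]

end Ren

/-! ## The untyped computational lambda calculus -/

/-- A signature: for each arity, function symbols and procedure symbols. -/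
structure Signature where
  Func : ℕ → Type u
  Proc : ℕ → Type u

mutual

/-- Values, up to renaming of bound variables, whose free variables are among `x₁, …, xₙ`. -/
inductive Val (S : Signature.{u}) : ℕ → Type u
  | var {n : ℕ} (i : Fin n) : Val S n
  | func {n k : ℕ} (f : S.Func k) (V : Fin k → Val S n) : Val S n
  | lam {n : ℕ} (M : Cmp S (n + 1)) : Val S n

/-- Computations, up to renaming of bound variables, whose free variables are among
`x₁, …, xₙ`. In `letIn N M`, that is `let x = N in M`, the bound variable is the last variable
of the context of `M`. -/
inductive Cmp (S : Signature.{u}) : ℕ → Type u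
  | ret {n : ℕ} (V : Val S n) : Cmp S n
  | letIn {n : ℕ} (N : Cmp S n) (M : Cmp S (n + 1)) : Cmp S n
  | proc {n k : ℕ} (p : S.Proc k) (V : Fin k → Val S n) : Cmp S n
  | app {n : ℕ} (V W : Val S n) : Cmp S n

end

variable {S : Signature.{u}}

mutual

/-- Renaming of the free variables of a value. -/
def Val.ren : {m n : ℕ} → Val S m → Ren m n → Val S n
  | _, _, .var i, r => .var (r i)
  | _, _, .func f V, r => .func f (fun j => (V j).ren r)
  | _, _, .lam M, r => .lam (M.ren r.lift)

/-- Renaming of the free variables of a computation. -/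
def Cmp.ren : {m n : ℕ} → Cmp S m → Ren m n → Cmp S n
  | _, _, .ret V, r => .ret (V.ren r)
  | _, _, .letIn N M, r => .letIn (N.ren r) (M.ren r.lift)
  | _, _, .proc p V, r => .proc p (fun j => (V j).ren r)
  | _, _, .app V W, r => .app (V.ren r) (W.ren r)

end

/-- The extension under a binder of a simultaneous substitution of values for variables. -/
def liftSubst {m n : ℕ} (σ : Fin m → Val S n) : Fin (m + 1) → Val S (n + 1) :=
  Fin.lastCases (.var (Fin.last n)) (fun i => (σ i).ren Fin.castSucc)

mutual

/-- Simultaneous capture avoiding substitution of values for the variables of a value. -/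
def Val.subst : {m n : ℕ} → Val S m → (Fin m → Val S n) → Val S n
  | _, _, .var i, σ => σ i
  | _, _, .func f V, σ => .func f (fun j => (V j).subst σ)
  | _, _, .lam M, σ => .lam (M.subst (liftSubst σ))

/-- Simultaneous capture avoiding substitution of values for the variables of a computation. -/
def Cmp.subst : {m n : ℕ} → Cmp S m → (Fin m → Val S n) → Cmp S n
  | _, _, .ret V, σ => .ret (V.subst σ)
  | _, _, .letIn N M, σ => .letIn (N.subst σ) (M.subst (liftSubst σ))
  | _, _, .proc p V, σ => .proc p (fun j => (V j).subst σ)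
  | _, _, .app V W, σ => .app (V.subst σ) (W.subst σ)

end

/-- The substitution `x := V` of a value for the last variable of a context. -/
def single {n : ℕ} (V : Val S n) : Fin (n + 1) → Val S n :=
  Fin.lastCases V Val.var

mutual

/-- Provable equality of values in the context `x₁, …, xₙ`. -/
inductive ValEq {S : Signature.{u}} : {n : ℕ} → Val S n → Val S n → Prop
  | refl {n : ℕ} (V : Val S n) : ValEq V V
  | symm {n : ℕ} {V W : Val S n} : ValEq V W → ValEq W V
  | trans {n : ℕ} {U V W : Val S n} : ValEq U V → ValEq V W → ValEq U W
  | func {n k : ℕ} (f : S.Func k) {V W : Fin k → Val S n} :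
      (∀ j, ValEq (V j) (W j)) → ValEq (.func f V) (.func f W)
  | lam {n : ℕ} {M N : Cmp S (n + 1)} : CmpEq M N → ValEq (.lam M) (.lam N)

/-- Provable equality of computations in the context `x₁, …, xₙ`. -/
inductive CmpEq {S : Signature.{u}} : {n : ℕ} → Cmp S n → Cmp S n → Prop
  | refl {n : ℕ} (M : Cmp S n) : CmpEq M M
  | symm {n : ℕ} {M N : Cmp S n} : CmpEq M N → CmpEq N M
  | trans {n : ℕ} {L M N : Cmp S n} : CmpEq L M → CmpEq M N → CmpEq L N
  | ret {n : ℕ} {V W : Val S n} : ValEq V W → CmpEq (.ret V) (.ret W)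
  | letIn {n : ℕ} {N N' : Cmp S n} {M M' : Cmp S (n + 1)} :
      CmpEq N N' → CmpEq M M' → CmpEq (.letIn N M) (.letIn N' M')
  | proc {n k : ℕ} (p : S.Proc k) {V W : Fin k → Val S n} :
      (∀ j, ValEq (V j) (W j)) → CmpEq (.proc p V) (.proc p W)
  | app {n : ℕ} {V V' W W' : Val S n} :
      ValEq V V' → ValEq W W' → CmpEq (.app V W) (.app V' W')
  /-- `let x = return V in M ≡ M[x := V]` -/
  | lunit {n : ℕ} (V : Val S n) (M : Cmp S (n + 1)) :
      CmpEq (.letIn (.ret V) M) (M.subst (single V))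
  /-- `let x = M in return x ≡ M` -/
  | runit {n : ℕ} (M : Cmp S n) : CmpEq (.letIn M (.ret (.var (Fin.last n)))) M
  /-- `let x₂ = (let x₁ = M₁ in M₂) in M ≡ let x₁ = M₁ in let x₂ = M₂ in M`, where `x₁` is not
  free in `M` -/
  | assoc {n : ℕ} (M₁ : Cmp S n) (M₂ M : Cmp S (n + 1)) :
      CmpEq (.letIn (.letIn M₁ M₂) M)
        (.letIn M₁ (.letIn M₂ (M.ren (Ren.lift Fin.castSucc))))
  /-- `(λ x. M) V ≡ M[x := V]` -/
  | beta {n : ℕ} (M : Cmp S (n + 1)) (V : Val S n) :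
      CmpEq (.app (.lam M) V) (M.subst (single V))

end

/-! ### Provable equality is stable under substitution -/

mutual

theorem Val.ren_ren : ∀ {a b c : ℕ} (V : Val S a) (r : Ren a b) (s : Ren b c),
    (V.ren r).ren s = V.ren (s ∘ r)
  | _, _, _, .var i, r, s => by simp [Val.ren]
  | _, _, _, .func f V, r, s => by
      simp only [Val.ren]; congr 1; funext j; exact Val.ren_ren (V j) r s
  | _, _, _, .lam M, r, s => by
      simp only [Val.ren]; rw [Cmp.ren_ren M, Ren.lift_comp]

theorem Cmp.ren_ren : ∀ {a b c : ℕ} (M : Cmp S a) (r : Ren a b) (s : Ren b c),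
    (M.ren r).ren s = M.ren (s ∘ r)
  | _, _, _, .ret V, r, s => by simp only [Cmp.ren]; rw [Val.ren_ren V]
  | _, _, _, .letIn N M, r, s => by
      simp only [Cmp.ren]; rw [Cmp.ren_ren N, Cmp.ren_ren M, Ren.lift_comp]
  | _, _, _, .proc p V, r, s => by
      simp only [Cmp.ren]; congr 1; funext j; exact Val.ren_ren (V j) r s
  | _, _, _, .app V W, r, s => by simp only [Cmp.ren]; rw [Val.ren_ren V, Val.ren_ren W]

end

theorem liftSubst_comp_lift {a b c : ℕ} (r : Ren a b) (σ : Fin b → Val S c) :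
    liftSubst σ ∘ r.lift = liftSubst (σ ∘ r) := by
  funext i
  induction i using Fin.lastCases with
  | last => simp [liftSubst, Ren.lift]
  | cast i => simp [liftSubst, Ren.lift]

mutual

theorem Val.ren_subst : ∀ {a b c : ℕ} (V : Val S a) (r : Ren a b) (σ : Fin b → Val S c),
    (V.ren r).subst σ = V.subst (σ ∘ r)
  | _, _, _, .var i, r, σ => by simp [Val.ren, Val.subst]
  | _, _, _, .func f V, r, σ => by
      simp only [Val.ren, Val.subst]; congr 1; funext j; exact Val.ren_subst (V j) r σ
  | _, _, _, .lam M, r, σ => by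
      simp only [Val.ren, Val.subst]; rw [Cmp.ren_subst M, liftSubst_comp_lift]

theorem Cmp.ren_subst : ∀ {a b c : ℕ} (M : Cmp S a) (r : Ren a b) (σ : Fin b → Val S c),
    (M.ren r).subst σ = M.subst (σ ∘ r)
  | _, _, _, .ret V, r, σ => by simp only [Cmp.ren, Cmp.subst]; rw [Val.ren_subst V]
  | _, _, _, .letIn N M, r, σ => by
      simp only [Cmp.ren, Cmp.subst]
      rw [Cmp.ren_subst N, Cmp.ren_subst M, liftSubst_comp_lift]
  | _, _, _, .proc p V, r, σ => by
      simp only [Cmp.ren, Cmp.subst]; congr 1; funext j; exact Val.ren_subst (V j) r σ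
  | _, _, _, .app V W, r, σ => by
      simp only [Cmp.ren, Cmp.subst]; rw [Val.ren_subst V, Val.ren_subst W]

end

theorem liftSubst_ren {a b c : ℕ} (σ : Fin a → Val S b) (r : Ren b c) :
    (fun i => (liftSubst σ i).ren r.lift) = liftSubst (fun i => (σ i).ren r) := by
  funext i
  induction i using Fin.lastCases with
  | last => simp [liftSubst, Ren.lift, Val.ren]
  | cast i =>
      simp only [liftSubst, Fin.lastCases_castSucc, Val.ren_ren]
      congr 1
      funext j
      simp [Ren.lift]

mutual

theorem Val.subst_ren : ∀ {a b c : ℕ} (V : Val S a) (σ : Fin a → Val S b) (r : Ren b c),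
    (V.subst σ).ren r = V.subst (fun i => (σ i).ren r)
  | _, _, _, .var i, σ, r => by simp [Val.subst]
  | _, _, _, .func f V, σ, r => by
      simp only [Val.ren, Val.subst]; congr 1; funext j; exact Val.subst_ren (V j) σ r
  | _, _, _, .lam M, σ, r => by
      simp only [Val.ren, Val.subst]; rw [Cmp.subst_ren M, liftSubst_ren]

theorem Cmp.subst_ren : ∀ {a b c : ℕ} (M : Cmp S a) (σ : Fin a → Val S b) (r : Ren b c),
    (M.subst σ).ren r = M.subst (fun i => (σ i).ren r)
  | _, _, _, .ret V, σ, r => by simp only [Cmp.ren, Cmp.subst]; rw [Val.subst_ren V]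
  | _, _, _, .letIn N M, σ, r => by
      simp only [Cmp.ren, Cmp.subst]
      rw [Cmp.subst_ren N, Cmp.subst_ren M, liftSubst_ren]
  | _, _, _, .proc p V, σ, r => by
      simp only [Cmp.ren, Cmp.subst]; congr 1; funext j; exact Val.subst_ren (V j) σ r
  | _, _, _, .app V W, σ, r => by
      simp only [Cmp.ren, Cmp.subst]; rw [Val.subst_ren V, Val.subst_ren W]

end

theorem liftSubst_subst {a b c : ℕ} (σ : Fin a → Val S b) (τ : Fin b → Val S c) :
    (fun i => (liftSubst σ i).subst (liftSubst τ)) = liftSubst (fun i => (σ i).subst τ) := by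
  funext i
  induction i using Fin.lastCases with
  | last => simp [liftSubst, Val.subst]
  | cast i =>
      simp only [liftSubst, Fin.lastCases_castSucc, Val.ren_subst, Val.subst_ren]
      congr 1
      funext j
      simp [liftSubst]

mutual

theorem Val.subst_subst : ∀ {a b c : ℕ} (V : Val S a) (σ : Fin a → Val S b)
    (τ : Fin b → Val S c), (V.subst σ).subst τ = V.subst (fun i => (σ i).subst τ)
  | _, _, _, .var i, σ, τ => by simp [Val.subst]
  | _, _, _, .func f V, σ, τ => by
      simp only [Val.subst]; congr 1; funext j; exact Val.subst_subst (V j) σ τ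
  | _, _, _, .lam M, σ, τ => by
      simp only [Val.subst]; rw [Cmp.subst_subst M, liftSubst_subst]

theorem Cmp.subst_subst : ∀ {a b c : ℕ} (M : Cmp S a) (σ : Fin a → Val S b)
    (τ : Fin b → Val S c), (M.subst σ).subst τ = M.subst (fun i => (σ i).subst τ)
  | _, _, _, .ret V, σ, τ => by simp only [Cmp.subst]; rw [Val.subst_subst V]
  | _, _, _, .letIn N M, σ, τ => by
      simp only [Cmp.subst]
      rw [Cmp.subst_subst N, Cmp.subst_subst M, liftSubst_subst]
  | _, _, _, .proc p V, σ, τ => by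
      simp only [Cmp.subst]; congr 1; funext j; exact Val.subst_subst (V j) σ τ
  | _, _, _, .app V W, σ, τ => by
      simp only [Cmp.subst]; rw [Val.subst_subst V, Val.subst_subst W]

end

theorem liftSubst_var (n : ℕ) : liftSubst (Val.var : Fin n → Val S n) = Val.var := by
  funext i
  induction i using Fin.lastCases with
  | last => simp [liftSubst]
  | cast i => simp [liftSubst, Val.ren]

mutual

theorem Val.subst_var : ∀ {n : ℕ} (V : Val S n), V.subst Val.var = V
  | _, .var i => by simp [Val.subst]
  | _, .func f V => by
      simp only [Val.subst]; congr 1; funext j; exact Val.subst_var (V j)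
  | _, .lam M => by simp only [Val.subst]; rw [liftSubst_var, Cmp.subst_var M]

theorem Cmp.subst_var : ∀ {n : ℕ} (M : Cmp S n), M.subst Val.var = M
  | _, .ret V => by simp only [Cmp.subst]; rw [Val.subst_var V]
  | _, .letIn N M => by
      simp only [Cmp.subst]; rw [liftSubst_var, Cmp.subst_var N, Cmp.subst_var M]
  | _, .proc p V => by
      simp only [Cmp.subst]; congr 1; funext j; exact Val.subst_var (V j)
  | _, .app V W => by simp only [Cmp.subst]; rw [Val.subst_var V, Val.subst_var W]

end

theorem Val.ren_eq_subst {m n : ℕ} (V : Val S m) (r : Ren m n) :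
    V.ren r = V.subst (fun i => .var (r i)) := by
  rw [← Val.subst_var (V.ren r), Val.ren_subst]; rfl

theorem Cmp.ren_eq_subst {m n : ℕ} (M : Cmp S m) (r : Ren m n) :
    M.ren r = M.subst (fun i => .var (r i)) := by
  rw [← Cmp.subst_var (M.ren r), Cmp.ren_subst]; rfl

theorem single_subst {m n : ℕ} (V : Val S m) (σ : Fin m → Val S n) :
    (fun i => (single V i).subst σ) = fun i => (liftSubst σ i).subst (single (V.subst σ)) := by
  funext i
  induction i using Fin.lastCases with
  | last => simp [single, liftSubst, Val.subst]
  | cast i =>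
      simp only [single, liftSubst, Fin.lastCases_castSucc, Val.ren_subst, Val.subst]
      conv_lhs => rw [← Val.subst_var (σ i)]
      congr 1
      funext j
      simp [single]

mutual

theorem ValEq.subst : ∀ {m n : ℕ} {V W : Val S m} (_ : ValEq V W) (σ : Fin m → Val S n),
    ValEq (V.subst σ) (W.subst σ)
  | _, _, _, _, .refl V, σ => .refl _
  | _, _, _, _, .symm h, σ => .symm (ValEq.subst h σ)
  | _, _, _, _, .trans h h', σ => .trans (ValEq.subst h σ) (ValEq.subst h' σ)
  | _, _, _, _, .func f h, σ => by
      simp only [Val.subst]; exact .func f (fun j => ValEq.subst (h j) σ)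
  | _, _, _, _, .lam h, σ => by
      simp only [Val.subst]; exact .lam (CmpEq.subst h _)

theorem CmpEq.subst : ∀ {m n : ℕ} {M N : Cmp S m} (_ : CmpEq M N) (σ : Fin m → Val S n),
    CmpEq (M.subst σ) (N.subst σ)
  | _, _, _, _, .refl V, σ => .refl _
  | _, _, _, _, .symm h, σ => .symm (CmpEq.subst h σ)
  | _, _, _, _, .trans h h', σ => .trans (CmpEq.subst h σ) (CmpEq.subst h' σ)
  | _, _, _, _, .ret h, σ => by
      simp only [Cmp.subst]; exact .ret (ValEq.subst h σ)
  | _, _, _, _, .letIn h h', σ => by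
      simp only [Cmp.subst]; exact .letIn (CmpEq.subst h σ) (CmpEq.subst h' _)
  | _, _, _, _, .proc p h, σ => by
      simp only [Cmp.subst]; exact .proc p (fun j => ValEq.subst (h j) σ)
  | _, _, _, _, .app h h', σ => by
      simp only [Cmp.subst]; exact .app (ValEq.subst h σ) (ValEq.subst h' σ)
  | _, _, _, _, .lunit V M, σ => by
      have h := CmpEq.lunit (V.subst σ) (M.subst (liftSubst σ))
      rw [Cmp.subst_subst, ← single_subst, ← Cmp.subst_subst] at h
      simpa only [Cmp.subst] using h
  | _, _, _, _, .runit M, σ => by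
      simpa [Cmp.subst, Val.subst, liftSubst] using CmpEq.runit (M.subst σ)
  | _, _, _, _, .assoc M₁ M₂ M, σ => by
      have h := CmpEq.assoc (M₁.subst σ) (M₂.subst (liftSubst σ)) (M.subst (liftSubst σ))
      have e : (M.subst (liftSubst σ)).ren (Ren.lift Fin.castSucc) =
          (M.ren (Ren.lift Fin.castSucc)).subst (liftSubst (liftSubst σ)) := by
        rw [Cmp.subst_ren, Cmp.ren_subst, liftSubst_ren, liftSubst_comp_lift]
        congr 2
        funext i
        simp [liftSubst]
      rw [e] at h
      simpa only [Cmp.subst] using h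
  | _, _, _, _, .beta M V, σ => by
      have h := CmpEq.beta (M.subst (liftSubst σ)) (V.subst σ)
      rw [Cmp.subst_subst, ← single_subst, ← Cmp.subst_subst] at h
      simpa only [Cmp.subst, Val.subst] using h

end

theorem ValEq.ren {m n : ℕ} {V W : Val S m} (h : ValEq V W) (r : Ren m n) :
    ValEq (V.ren r) (W.ren r) := by
  rw [Val.ren_eq_subst, Val.ren_eq_subst]; exact h.subst _

theorem CmpEq.ren {m n : ℕ} {M N : Cmp S m} (h : CmpEq M N) (r : Ren m n) :
    CmpEq (M.ren r) (N.ren r) := by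
  rw [Cmp.ren_eq_subst, Cmp.ren_eq_subst]; exact h.subst _

theorem ValEq.liftSubst {m n : ℕ} {σ τ : Fin m → Val S n} (h : ∀ i, ValEq (σ i) (τ i))
    (i : Fin (m + 1)) : ValEq (liftSubst σ i) (liftSubst τ i) := by
  induction i using Fin.lastCases with
  | last => simpa [FreydCLC.liftSubst] using ValEq.refl _
  | cast i => simpa [FreydCLC.liftSubst] using (h i).ren _

mutual

theorem Val.subst_congr : ∀ {m n : ℕ} (V : Val S m) {σ τ : Fin m → Val S n}
    (_ : ∀ i, ValEq (σ i) (τ i)), ValEq (V.subst σ) (V.subst τ)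
  | _, _, .var i, _, _, h => by simpa only [Val.subst] using h i
  | _, _, .func f V, _, _, h => by
      simp only [Val.subst]; exact .func f (fun j => Val.subst_congr (V j) h)
  | _, _, .lam M, _, _, h => by
      simp only [Val.subst]; exact .lam (Cmp.subst_congr M (ValEq.liftSubst h))

theorem Cmp.subst_congr : ∀ {m n : ℕ} (M : Cmp S m) {σ τ : Fin m → Val S n}
    (_ : ∀ i, ValEq (σ i) (τ i)), CmpEq (M.subst σ) (M.subst τ)
  | _, _, .ret V, _, _, h => by
      simp only [Cmp.subst]; exact .ret (Val.subst_congr V h)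
  | _, _, .letIn N M, _, _, h => by
      simp only [Cmp.subst]
      exact .letIn (Cmp.subst_congr N h) (Cmp.subst_congr M (ValEq.liftSubst h))
  | _, _, .proc p V, _, _, h => by
      simp only [Cmp.subst]; exact .proc p (fun j => Val.subst_congr (V j) h)
  | _, _, .app V W, _, _, h => by
      simp only [Cmp.subst]; exact .app (Val.subst_congr V h) (Val.subst_congr W h)

end

/-! ## The term model as a Freyd operad -/

/-- The operations of a preoperad with renamings. For `g : Op n`, the element
`sub a b f g _ _` is the substitution `f{a ⊣ g ⊢ b}` of `g` into the input number `a + 1` of `f`;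
the arities `a + 1 + b` of `f` and `a + n + b` of the result are given up to equality. -/
structure PreoperadData where
  Op : ℕ → Type u
  one : Op 1
  sub : ∀ {t s n : ℕ} (a b : ℕ) (_ : Op t) (_ : Op n), t = a + 1 + b → s = a + n + b → Op s
  ren : ∀ {m n : ℕ}, Op m → Ren m n → Op n

/-- The operations of a Freyd operad: value and computation operations, and a map `ret` from the
former to the latter that preserves the identity, substitution and renaming. -/
structure FreydOperadData where
  V : PreoperadData.{u}
  C : PreoperadData.{u}
  ret : ∀ {n : ℕ}, V.Op n → C.Op n
  ret_one : ret V.one = C.one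
  ret_sub : ∀ {t s n : ℕ} (a b : ℕ) (f : V.Op t) (g : V.Op n) (ht : t = a + 1 + b)
    (hs : s = a + n + b), ret (V.sub a b f g ht hs) = C.sub a b (ret f) (ret g) ht hs
  ret_ren : ∀ {m n : ℕ} (f : V.Op m) (r : Ren m n), ret (V.ren f r) = C.ren (ret f) r

/-- The inclusion of the variables of `Γ` in a context `Γ₁, Γ, Γ₂` with `Γ₁` of length `a`. -/
def midRen {n s : ℕ} (a b : ℕ) (hs : s = a + n + b) : Ren n s :=
  fun j => ⟨a + j.val, by omega⟩

/-- Substitution of the value `W` for the variable number `a + 1` in `V`; the context of `W` takes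
the place of that variable. -/
def Val.plug {t s n : ℕ} (a b : ℕ) (V : Val S t) (W : Val S n) (ht : t = a + 1 + b)
    (hs : s = a + n + b) : Val S s :=
  V.subst fun i =>
    if h : i.val < a then .var ⟨i.val, by omega⟩
    else if h' : i.val = a then W.ren (midRen a b hs)
    else .var ⟨i.val - 1 + n, by omega⟩

/-- The computation `let y = N in M`, where `y` is the variable number `a + 1` of the context of
`M`; the context of `N` takes the place of that variable. -/
def Cmp.plug {t s n : ℕ} (a b : ℕ) (M : Cmp S t) (N : Cmp S n) (ht : t = a + 1 + b)
    (hs : s = a + n + b) : Cmp S s :=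
  .letIn (N.ren (midRen a b hs)) (M.ren fun i =>
    if h : i.val < a then ⟨i.val, by omega⟩
    else if h' : i.val = a then Fin.last s
    else ⟨i.val - 1 + n, by omega⟩)

theorem ValEq.plug {t s n : ℕ} (a b : ℕ) {V V' : Val S t} {W W' : Val S n} (h : ValEq V V')
    (h' : ValEq W W') (ht : t = a + 1 + b) (hs : s = a + n + b) :
    ValEq (V.plug a b W ht hs) (V'.plug a b W' ht hs) := by
  refine .trans (h.subst _) (Val.subst_congr V' fun i => ?_)
  split_ifs
  · exact .refl _
  · exact h'.ren _
  · exact .refl _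

theorem CmpEq.plug {t s n : ℕ} (a b : ℕ) {M M' : Cmp S t} {N N' : Cmp S n} (h : CmpEq M M')
    (h' : CmpEq N N') (ht : t = a + 1 + b) (hs : s = a + n + b) :
    CmpEq (M.plug a b N ht hs) (M'.plug a b N' ht hs) :=
  .letIn (h'.ren _) (h.ren _)

theorem CmpEq.ret_plug {t s n : ℕ} (a b : ℕ) (V : Val S t) (W : Val S n) (ht : t = a + 1 + b)
    (hs : s = a + n + b) :
    CmpEq (.ret (V.plug a b W ht hs)) (Cmp.plug a b (.ret V) (.ret W) ht hs) := by
  have h := CmpEq.lunit (W.ren (midRen a b hs)) (Cmp.ren (.ret V) fun i : Fin t =>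
    if h : i.val < a then (⟨i.val, by omega⟩ : Fin (s + 1))
    else if h' : i.val = a then Fin.last s
    else ⟨i.val - 1 + n, by omega⟩)
  rw [Cmp.ren_subst] at h
  refine .symm ?_
  suffices e : Val.plug a b V W ht hs = V.subst (single (W.ren (midRen a b hs)) ∘ fun i : Fin t =>
      if h : i.val < a then (⟨i.val, by omega⟩ : Fin (s + 1))
      else if h' : i.val = a then Fin.last s
      else ⟨i.val - 1 + n, by omega⟩) by
    rw [e]; exact h
  unfold Val.plug
  congr 1
  funext i
  have key : ∀ (k : ℕ) (hk : k < s), single (W.ren (midRen a b hs)) ⟨k, by omega⟩ =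
      Val.var ⟨k, hk⟩ := fun k hk => by
    have : (⟨k, by omega⟩ : Fin (s + 1)) = Fin.castSucc ⟨k, hk⟩ := rfl
    rw [this, single, Fin.lastCases_castSucc]
  simp only [Function.comp]
  split_ifs with h1 h2
  · exact (key _ _).symm
  · simp [single]
  · exact (key _ _).symm

instance valSetoid (S : Signature.{u}) (n : ℕ) : Setoid (Val S n) :=
  ⟨ValEq, .refl, .symm, .trans⟩

instance cmpSetoid (S : Signature.{u}) (n : ℕ) : Setoid (Cmp S n) :=
  ⟨CmpEq, .refl, .symm, .trans⟩

/-- Values in context modulo provable equality. -/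
def termVal (S : Signature.{u}) : PreoperadData.{u} where
  Op n := Quotient (valSetoid S n)
  one := ⟦.var 0⟧
  sub a b f g ht hs := Quotient.map₂ (fun V W => V.plug a b W ht hs)
    (fun _ _ h _ _ h' => ValEq.plug a b h h' ht hs) f g
  ren f r := Quotient.map (fun V => V.ren r) (fun _ _ h => ValEq.ren h r) f

/-- Computations in context modulo provable equality. -/
def termCmp (S : Signature.{u}) : PreoperadData.{u} where
  Op n := Quotient (cmpSetoid S n)
  one := ⟦.ret (.var 0)⟧
  sub a b f g ht hs := Quotient.map₂ (fun M N => M.plug a b N ht hs)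
    (fun _ _ h _ _ h' => CmpEq.plug a b h h' ht hs) f g
  ren f r := Quotient.map (fun M => M.ren r) (fun _ _ h => CmpEq.ren h r) f

/-- The Freyd operad of the term model. -/
def termModel (S : Signature.{u}) : FreydOperadData.{u} where
  V := termVal S
  C := termCmp S
  ret f := Quotient.map Cmp.ret (fun _ _ h => CmpEq.ret h) f
  ret_one := rfl
  ret_sub a b f g ht hs := by
    induction f using Quotient.inductionOn with | _ V
    induction g using Quotient.inductionOn with | _ W
    exact Quotient.sound (CmpEq.ret_plug a b V W ht hs)
  ret_ren f r := by
    induction f using Quotient.inductionOn with | _ V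
    rfl

namespace termModel

/-- Abstraction in the term model, `[M] ↦ [λ x. M]`. -/
def abs {n : ℕ} (c : (termModel S).C.Op (n + 1)) : (termModel S).V.Op n :=
  Quotient.map Val.lam (fun _ _ h => ValEq.lam h) c

/-- Application in the term model, `[x₁ x₂]`. -/
def app (S : Signature.{u}) : (termModel S).C.Op 2 := ⟦.app (.var 0) (.var 1)⟧

/-- The interpretation `[f(x₁, …, xₙ)]` of a function symbol in the term model. -/
def func {n : ℕ} (f : S.Func n) : (termModel S).V.Op n := ⟦.func f Val.var⟧

/-- The interpretation `[p(x₁, …, xₙ)]` of a procedure symbol in the term model. -/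
def proc {n : ℕ} (p : S.Proc n) : (termModel S).C.Op n := ⟦.proc p Val.var⟧

end termModel

/-! ## Freyd PROPs -/

/-- The operations of a pre-PROP. Composition is written in the order `comp g f = g ∘ f`;
`whiskerL k f` is `k ⊣ f` and `whiskerR f k` is `f ⊢ k`. -/
structure PrePropData where
  Hom : ℕ → ℕ → Type w
  id : ∀ n, Hom n n
  comp : ∀ {m n k : ℕ}, Hom n k → Hom m n → Hom m k
  whiskerL : ∀ (k : ℕ) {m n : ℕ}, Hom m n → Hom (k + m) (k + n)
  whiskerR : ∀ {m n : ℕ}, Hom m n → ∀ k : ℕ, Hom (m + k) (n + k)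
  symm : ∀ m n : ℕ, Hom (m + n) (n + m)

namespace PrePropData

variable (P : PrePropData.{w})

/-- Transport of a morphism along equalities of objects. -/
def cast {m n m' n' : ℕ} (hm : m = m') (hn : n = n') (f : P.Hom m n) : P.Hom m' n' :=
  hm ▸ hn ▸ f

/-- `f` is central: it commutes with every morphism, on both sides. -/
def IsCentral {m n : ℕ} (f : P.Hom m n) : Prop :=
  ∀ {m' n' : ℕ} (g : P.Hom m' n'),
    P.comp (P.whiskerR f n') (P.whiskerL m g) = P.comp (P.whiskerL n g) (P.whiskerR f m') ∧
    P.comp (P.whiskerR g n) (P.whiskerL m' f) = P.comp (P.whiskerL n' f) (P.whiskerR g m)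

/-- The laws of a pre-PROP: a strict symmetric premonoidal category with objects the natural
numbers and tensor product of objects the addition. -/
structure IsPreProp : Prop where
  id_comp : ∀ {m n : ℕ} (f : P.Hom m n), P.comp (P.id n) f = f
  comp_id : ∀ {m n : ℕ} (f : P.Hom m n), P.comp f (P.id m) = f
  assoc : ∀ {m n k l : ℕ} (h : P.Hom k l) (g : P.Hom n k) (f : P.Hom m n),
    P.comp (P.comp h g) f = P.comp h (P.comp g f)
  whiskerL_id : ∀ k n : ℕ, P.whiskerL k (P.id n) = P.id (k + n)
  whiskerL_comp : ∀ (k : ℕ) {l m n : ℕ} (g : P.Hom m n) (f : P.Hom l m),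
    P.whiskerL k (P.comp g f) = P.comp (P.whiskerL k g) (P.whiskerL k f)
  whiskerR_id : ∀ k n : ℕ, P.whiskerR (P.id n) k = P.id (n + k)
  whiskerR_comp : ∀ (k : ℕ) {l m n : ℕ} (g : P.Hom m n) (f : P.Hom l m),
    P.whiskerR (P.comp g f) k = P.comp (P.whiskerR g k) (P.whiskerR f k)
  whiskerL_zero : ∀ {m n : ℕ} (f : P.Hom m n),
    P.cast (Nat.zero_add m) (Nat.zero_add n) (P.whiskerL 0 f) = f
  whiskerR_zero : ∀ {m n : ℕ} (f : P.Hom m n), P.whiskerR f 0 = f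
  whiskerL_add : ∀ (k l : ℕ) {m n : ℕ} (f : P.Hom m n),
    P.cast (Nat.add_assoc k l m) (Nat.add_assoc k l n) (P.whiskerL (k + l) f) =
      P.whiskerL k (P.whiskerL l f)
  whiskerR_add : ∀ (k l : ℕ) {m n : ℕ} (f : P.Hom m n),
    P.cast (Nat.add_assoc m k l) (Nat.add_assoc n k l) (P.whiskerR (P.whiskerR f k) l) =
      P.whiskerR f (k + l)
  whiskerL_whiskerR : ∀ (k l : ℕ) {m n : ℕ} (f : P.Hom m n),
    P.cast (Nat.add_assoc k m l) (Nat.add_assoc k n l) (P.whiskerR (P.whiskerL k f) l) =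
      P.whiskerL k (P.whiskerR f l)
  symm_natural : ∀ {m n : ℕ} (f : P.Hom m n) (k : ℕ),
    P.comp (P.symm n k) (P.whiskerR f k) = P.comp (P.whiskerL k f) (P.symm m k)
  symm_natural' : ∀ {m n : ℕ} (f : P.Hom m n) (k : ℕ),
    P.comp (P.symm k n) (P.whiskerL k f) = P.comp (P.whiskerR f k) (P.symm k m)
  symm_symm : ∀ m n : ℕ, P.comp (P.symm n m) (P.symm m n) = P.id (m + n)
  symm_add : ∀ m n k : ℕ,
    P.symm m (n + k) = P.cast (Nat.add_assoc m n k) (Nat.add_assoc n k m).symm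
      (P.comp (P.whiskerL n (P.symm m k))
        (P.cast rfl (Nat.add_assoc n m k) (P.whiskerR (P.symm m n) k)))
  symm_central : ∀ m n : ℕ, P.IsCentral (P.symm m n)

/-- The tensor product of two morphisms; in a PROP the order of the two factors is irrelevant. -/
def tensor {m n m' n' : ℕ} (f : P.Hom m n) (g : P.Hom m' n') : P.Hom (m + m') (n + n') :=
  P.comp (P.whiskerR f n') (P.whiskerL m g)

/-- `P` with the given copy and discard morphisms is a cartesian PROP. -/
structure IsCartesianProp (copy : ∀ n, P.Hom n (n + n)) (discard : ∀ n, P.Hom n 0) : Prop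
    extends P.IsPreProp where
  central : ∀ {m n : ℕ} (f : P.Hom m n), P.IsCentral f
  copy_natural : ∀ {m n : ℕ} (f : P.Hom m n),
    P.comp (copy n) f = P.comp (P.tensor f f) (copy m)
  discard_natural : ∀ {m n : ℕ} (f : P.Hom m n), P.comp (discard n) f = discard m
  copy_assoc : ∀ n : ℕ,
    P.cast rfl (Nat.add_assoc n n n) (P.comp (P.whiskerR (copy n) n) (copy n)) =
      P.comp (P.whiskerL n (copy n)) (copy n)
  copy_comm : ∀ n : ℕ, P.comp (P.symm n n) (copy n) = copy n
  discard_copy : ∀ n : ℕ,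
    P.cast rfl (Nat.zero_add n) (P.comp (P.whiskerR (discard n) n) (copy n)) = P.id n
  copy_discard : ∀ n : ℕ, P.comp (P.whiskerL n (discard n)) (copy n) = P.id n
  copy_add : ∀ m n : ℕ,
    copy (m + n) = P.comp
      (P.cast (show m + (m + n) + n = m + m + (n + n) by omega)
        (show m + (n + m) + n = m + n + (m + n) by omega)
        (P.whiskerR (P.whiskerL m (P.symm m n)) n))
      (P.tensor (copy m) (copy n))
  discard_add : ∀ m n : ℕ, discard (m + n) = P.tensor (discard m) (discard n)

end PrePropData

/-- The operations of a Freyd PROP. -/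
structure FreydPropData where
  V : PrePropData.{w}
  C : PrePropData.{w}
  copy : ∀ n, V.Hom n (n + n)
  discard : ∀ n, V.Hom n 0
  J : ∀ {m n : ℕ}, V.Hom m n → C.Hom m n

/-- The laws of a Freyd PROP: `V` is a cartesian PROP, `C` is a pre-PROP, and `J` is a pre-PROP
functor with central image. -/
structure FreydPropData.IsFreydProp (P : FreydPropData.{w}) : Prop where
  V_cartesian : P.V.IsCartesianProp P.copy P.discard
  C_preProp : P.C.IsPreProp
  J_id : ∀ n, P.J (P.V.id n) = P.C.id n
  J_comp : ∀ {l m n : ℕ} (g : P.V.Hom m n) (f : P.V.Hom l m),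
    P.J (P.V.comp g f) = P.C.comp (P.J g) (P.J f)
  J_whiskerL : ∀ (k : ℕ) {m n : ℕ} (f : P.V.Hom m n),
    P.J (P.V.whiskerL k f) = P.C.whiskerL k (P.J f)
  J_whiskerR : ∀ {m n : ℕ} (f : P.V.Hom m n) (k : ℕ),
    P.J (P.V.whiskerR f k) = P.C.whiskerR (P.J f) k
  J_symm : ∀ m n, P.J (P.V.symm m n) = P.C.symm m n
  J_central : ∀ {m n : ℕ} (f : P.V.Hom m n), P.C.IsCentral (P.J f)

/-- The operations of a weakly closed Freyd PROP with an interpretation of the signature `S`. -/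
structure ModelData (S : Signature.{u}) extends FreydPropData.{w} where
  abs : ∀ n : ℕ, C.Hom (n + 1) 1 → V.Hom n 1
  app : C.Hom 2 1
  func : ∀ {n : ℕ}, S.Func n → V.Hom n 1
  proc : ∀ {n : ℕ}, S.Proc n → C.Hom n 1

/-- A weakly closed Freyd PROP with an interpretation of the signature `S`: a Freyd PROP with
morphisms that interpret the symbols, a morphism `app`, and a transformation
`abs : C(n + 1, 1) → V(n, 1)`, natural in the object `n` of `V`, such that
`app ∘ (J (abs f) ⊢ 1) = f`. -/
structure Model (S : Signature.{u}) extends ModelData.{u, w} S where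
  isFreydProp : toFreydPropData.IsFreydProp
  abs_natural : ∀ {m n : ℕ} (f : C.Hom (n + 1) 1) (v : V.Hom m n),
    abs m (C.comp f (C.whiskerR (J v) 1)) = V.comp (abs n f) v
  app_abs : ∀ {n : ℕ} (f : C.Hom (n + 1) 1), C.comp app (C.whiskerR (J (abs n f)) 1) = f

/-- A pre-PROP functor: it is the identity on objects and preserves all operations. -/
structure PreFunctor (P : PrePropData.{v}) (Q : PrePropData.{w}) where
  map : ∀ {m n : ℕ}, P.Hom m n → Q.Hom m n
  map_id : ∀ n, map (P.id n) = Q.id n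
  map_comp : ∀ {l m n : ℕ} (g : P.Hom m n) (f : P.Hom l m),
    map (P.comp g f) = Q.comp (map g) (map f)
  map_whiskerL : ∀ (k : ℕ) {m n : ℕ} (f : P.Hom m n),
    map (P.whiskerL k f) = Q.whiskerL k (map f)
  map_whiskerR : ∀ {m n : ℕ} (f : P.Hom m n) (k : ℕ),
    map (P.whiskerR f k) = Q.whiskerR (map f) k
  map_symm : ∀ m n, map (P.symm m n) = Q.symm m n

/-- Morphisms of weakly closed Freyd PROPs with interpretations of `S`: Freyd PROP functors that
preserve abstraction, application and the interpretations of the symbols. -/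
structure Model.Hom {S : Signature.{u}} (X : Model.{u, v} S) (Y : Model.{u, w} S) where
  onV : PreFunctor X.V Y.V
  onC : PreFunctor X.C Y.C
  map_copy : ∀ n, onV.map (X.copy n) = Y.copy n
  map_discard : ∀ n, onV.map (X.discard n) = Y.discard n
  map_J : ∀ {m n : ℕ} (f : X.V.Hom m n), onC.map (X.J f) = Y.J (onV.map f)
  map_abs : ∀ {n : ℕ} (f : X.C.Hom (n + 1) 1), onV.map (X.abs n f) = Y.abs n (onC.map f)
  map_app : onC.map X.app = Y.app
  map_func : ∀ {n : ℕ} (f : S.Func n), onV.map (X.func f) = Y.func f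
  map_proc : ∀ {n : ℕ} (p : S.Proc n), onC.map (X.proc p) = Y.proc p

/-! ## The Freyd PROP of substitutions -/

/-- The letters of substitution words: a single substitution `{a ⊣ g ⊢ b}`, which is an arrow
`a + n + b → a + 1 + b` for `g : Op n`, or a renaming `r : n → m`, which is an arrow `m → n`. -/
inductive Step (O : PreoperadData.{u}) : ℕ → ℕ → Type u
  | sub {s t n : ℕ} (a b : ℕ) (g : O.Op n) (hs : s = a + n + b) (ht : t = a + 1 + b) : Step O s t
  | ren {m n : ℕ} (r : Ren n m) : Step O m n

/-- Pre-substitutions `m → n`: composable words of single substitutions and renamings. The first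
letter of a word is the last one in the order of composition: the word `X Y` is `X ∘ Y`. -/
inductive Word (O : PreoperadData.{u}) : ℕ → ℕ → Type u
  | nil {n : ℕ} : Word O n n
  | cons {m k n : ℕ} (x : Step O k n) (w : Word O m k) : Word O m n

variable {O : PreoperadData.{u}}

namespace Word

/-- The word with one letter. -/
def one {m n : ℕ} (x : Step O m n) : Word O m n := .cons x .nil

/-- The word with two letters. -/
def two {m k n : ℕ} (x : Step O k n) (y : Step O m k) : Word O m n := .cons x (.cons y .nil)

/-- The word with three letters. -/
def three {m k l n : ℕ} (x : Step O k n) (y : Step O l k) (z : Step O m l) : Word O m n :=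
  .cons x (.cons y (.cons z .nil))

/-- Concatenation. -/
def append {l m : ℕ} : {n : ℕ} → Word O m n → Word O l m → Word O l n
  | _, .nil, w => w
  | _, .cons x w', w => .cons x (append w' w)

theorem append_assoc : ∀ {k l m n : ℕ} (x : Word O m n) (y : Word O l m) (z : Word O k l),
    (x.append y).append z = x.append (y.append z)
  | _, _, _, _, .nil, _, _ => rfl
  | _, _, _, _, .cons x w, y, z => by simp only [append]; rw [append_assoc w]

end Word

/-- Left whiskering of a letter: `k ⊣ {a ⊣ g ⊢ b} = {k + a ⊣ g ⊢ b}` and `k ⊣ r = id + r`. -/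
def Step.whiskerL (k : ℕ) : {m n : ℕ} → Step O m n → Step O (k + m) (k + n)
  | _, _, .sub a b g hs ht => .sub (k + a) b g (by omega) (by omega)
  | _, _, .ren r => .ren (Ren.add (id : Ren k k) r)

/-- Right whiskering of a letter: `{a ⊣ g ⊢ b} ⊢ k = {a ⊣ g ⊢ b + k}` and `r ⊢ k = r + id`. -/
def Step.whiskerR (k : ℕ) : {m n : ℕ} → Step O m n → Step O (m + k) (n + k)
  | _, _, .sub a b g hs ht => .sub a (b + k) g (by omega) (by omega)
  | _, _, .ren r => .ren (Ren.add r (id : Ren k k))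

/-- Letterwise left whiskering. -/
def Word.whiskerL (k : ℕ) {m : ℕ} : {n : ℕ} → Word O m n → Word O (k + m) (k + n)
  | _, .nil => .nil
  | _, .cons x w => .cons (x.whiskerL k) (w.whiskerL k)

/-- Letterwise right whiskering. -/
def Word.whiskerR (k : ℕ) {m : ℕ} : {n : ℕ} → Word O m n → Word O (m + k) (n + k)
  | _, .nil => .nil
  | _, .cons x w => .cons (x.whiskerR k) (w.whiskerR k)

theorem Word.whiskerL_append (k : ℕ) : ∀ {l m n : ℕ} (x : Word O m n) (y : Word O l m),
    (x.append y).whiskerL k = (x.whiskerL k).append (y.whiskerL k)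
  | _, _, _, .nil, _ => rfl
  | _, _, _, .cons x w, y => by
      simp only [append, whiskerL]; rw [Word.whiskerL_append k w]

theorem Word.whiskerR_append (k : ℕ) : ∀ {l m n : ℕ} (x : Word O m n) (y : Word O l m),
    (x.append y).whiskerR k = (x.whiskerR k).append (y.whiskerR k)
  | _, _, _, .nil, _ => rfl
  | _, _, _, .cons x w, y => by
      simp only [append, whiskerR]; rw [Word.whiskerR_append k w]

/-- The generating identities between substitution words over `O`. The first seven rules are
imposed on all operations. The last three rules (a substitution commutes with those at other
positions, and is natural with respect to discarding and copying) are imposed on the operations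
that satisfy `P`. -/
inductive Rule (O : PreoperadData.{u}) (P : ∀ n : ℕ, O.Op n → Prop) :
    {m n : ℕ} → Word O m n → Word O m n → Prop
  | unit_sub (a b : ℕ) :
      Rule O P (.one (.sub (s := a + 1 + b) a b O.one rfl rfl)) .nil
  | unit_ren (n : ℕ) : Rule O P (.one (.ren (id : Ren n n))) .nil
  | assoc (a b c d : ℕ) {n k : ℕ} (g : O.Op n) (h : O.Op k) (hn : n = c + 1 + d) :
      Rule O P
        (.two (.sub (s := a + n + b) (t := a + 1 + b) a b g rfl rfl)
          (.sub (s := a + (c + k + d) + b) (a + c) (d + b) h (by omega) (by omega)))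
        (.one (.sub a b (O.sub c d g h hn (rfl : c + k + d = c + k + d)) rfl rfl))
  | ren_ren {k m n : ℕ} (r : Ren n m) (r' : Ren m k) :
      Rule O P (.two (.ren r) (.ren r')) (.one (.ren (r' ∘ r)))
  | sub_ren {a a' b b' n n' : ℕ} (g : O.Op n) (r₁ : Ren a a') (r : Ren n n') (r₂ : Ren b b') :
      Rule O P
        (.two (.sub (t := a + 1 + b) a b g rfl rfl) (.ren (((r₁.add r).add r₂))))
        (.two (.ren ((r₁.add (id : Ren 1 1)).add r₂)) (.sub a' b' (O.ren g r) rfl rfl))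
  | swap_left (a b : ℕ) {n : ℕ} (g : O.Op n) :
      Rule O P
        (.two (.ren ((Ren.add (id : Ren a a) (Ren.symm 1 1)).add (id : Ren b b)))
          (.sub (s := a + (n + 1) + b) a (1 + b) g (by omega) (by omega)))
        (.two (.sub (s := a + (1 + n) + b) (a + 1) b g (by omega) (by omega))
          (.ren ((Ren.add (id : Ren a a) (Ren.symm 1 n)).add (id : Ren b b))))
  | swap_right (a b : ℕ) {n : ℕ} (g : O.Op n) :
      Rule O P
        (.two (.ren ((Ren.add (id : Ren a a) (Ren.symm 1 1)).add (id : Ren b b)))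
          (.sub (s := a + (1 + n) + b) (a + 1) b g (by omega) (by omega)))
        (.two (.sub (s := a + (n + 1) + b) a (1 + b) g (by omega) (by omega))
          (.ren ((Ren.add (id : Ren a a) (Ren.symm n 1)).add (id : Ren b b))))
  | central (a m b : ℕ) {n₁ n₂ : ℕ} (g₁ : O.Op n₁) (g₂ : O.Op n₂) (hP : P _ g₁ ∨ P _ g₂) :
      Rule O P
        (.two (.sub (s := a + n₁ + (m + 1 + b)) (t := a + 1 + m + 1 + b)
            a (m + 1 + b) g₁ rfl (by omega))
          (.sub (s := a + n₁ + m + n₂ + b) (a + n₁ + m) b g₂ rfl (by omega)))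
        (.two (.sub (s := a + 1 + m + n₂ + b) (a + 1 + m) b g₂ rfl rfl)
          (.sub a (m + n₂ + b) g₁ (by omega) (by omega)))
  | discard (a b : ℕ) {n : ℕ} (g : O.Op n) (hP : P _ g) :
      Rule O P
        (.two (.ren ((Ren.add (id : Ren a a) (Ren.discard 1)).add (id : Ren b b)))
          (.sub (s := a + n + b) a b g rfl rfl))
        (.one (.ren ((Ren.add (id : Ren a a) (Ren.discard n)).add (id : Ren b b))))
  | copy (a b : ℕ) {n : ℕ} (g : O.Op n) (hP : P _ g) :
      Rule O P
        (.two (.ren ((Ren.add (id : Ren a a) (Ren.copy 1)).add (id : Ren b b)))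
          (.sub (s := a + n + b) a b g rfl rfl))
        (.three (.sub (s := a + n + (1 + b)) a (1 + b) g rfl (by omega))
          (.sub (s := a + (n + n) + b) (a + n) b g (by omega) (by omega))
          (.ren ((Ren.add (id : Ren a a) (Ren.copy n)).add (id : Ren b b))))

/-- An application of a generating identity inside a word. -/
inductive RuleInContext (O : PreoperadData.{u}) (P : ∀ n : ℕ, O.Op n → Prop) {m n : ℕ} :
    Word O m n → Word O m n → Prop
  | intro {k l : ℕ} (u : Word O l n) {x y : Word O k l} (w : Word O m k) (h : Rule O P x y) :
      RuleInContext O P (u.append (x.append w)) (u.append (y.append w))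

variable {P : ∀ n : ℕ, O.Op n → Prop}

/-! ### The rules are stable under whiskering -/

namespace Rule

theorem sub_ren' {a a' b b' n n' s t s' t' : ℕ} (g : O.Op n) (r₁ : Ren a a') (r : Ren n n')
    (r₂ : Ren b b') (hs : s = a + n + b) (ht : t = a + 1 + b) (hs' : s' = a' + n' + b')
    (ht' : t' = a' + 1 + b') (R : Ren s s') (R' : Ren t t')
    (hR : R = Ren.cast hs.symm hs'.symm ((r₁.add r).add r₂))
    (hR' : R' = Ren.cast ht.symm ht'.symm ((r₁.add (id : Ren 1 1)).add r₂)) :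
    Rule O P (.two (.sub a b g hs ht) (.ren R)) (.two (.ren R') (.sub a' b' (O.ren g r) hs' ht')) := by
  subst hs ht hs' ht' hR hR'
  exact .sub_ren g r₁ r r₂

theorem unit_sub' (a b : ℕ) {s : ℕ} (hs : s = a + 1 + b) :
    Rule O P (.one (.sub (s := s) a b O.one hs hs)) .nil := by
  subst hs; exact .unit_sub a b

theorem assoc' (a b c d : ℕ) {n k s t m a' b' : ℕ} (g : O.Op n) (h : O.Op k) (hn : n = c + 1 + d)
    (h1 : m = a + n + b) (h2 : t = a + 1 + b) (ha : a' = a + c) (hb : b' = d + b)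
    (h3 : s = a' + k + b') (h4 : m = a' + 1 + b') (h5 : s = a + (c + k + d) + b) :
    Rule O P (.two (.sub a b g h1 h2) (.sub a' b' h h3 h4))
      (.one (.sub a b (O.sub c d g h hn (rfl : c + k + d = c + k + d)) h5 h2)) := by
  subst h5 h1 h2 ha hb
  exact .assoc a b c d g h hn

theorem swap_left' (a b : ℕ) {n s s' t a' b' : ℕ} (g : O.Op n) (hb : b' = 1 + b) (ha : a' = a + 1)
    (ht : t = a + (1 + 1) + b) (hs : s = a + (n + 1) + b) (hs' : s' = a + (1 + n) + b)
    (h1 : s = a + n + b') (h2 : t = a + 1 + b') (h3 : s' = a' + n + b) (h4 : t = a' + 1 + b)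
    (R : Ren t t) (R' : Ren s' s)
    (hR : R = Ren.cast ht.symm ht.symm
      ((Ren.add (id : Ren a a) (Ren.symm 1 1)).add (id : Ren b b)))
    (hR' : R' = Ren.cast hs'.symm hs.symm
      ((Ren.add (id : Ren a a) (Ren.symm 1 n)).add (id : Ren b b))) :
    Rule O P (.two (.ren R) (.sub a b' g h1 h2)) (.two (.sub a' b g h3 h4) (.ren R')) := by
  subst ha hb ht hs hs' hR hR'
  exact .swap_left a b g

theorem swap_right' (a b : ℕ) {n s s' t a' b' : ℕ} (g : O.Op n) (hb : b' = 1 + b) (ha : a' = a + 1)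
    (ht : t = a + (1 + 1) + b) (hs : s = a + (n + 1) + b) (hs' : s' = a + (1 + n) + b)
    (h1 : s = a + n + b') (h2 : t = a + 1 + b') (h3 : s' = a' + n + b) (h4 : t = a' + 1 + b)
    (R : Ren t t) (R' : Ren s s')
    (hR : R = Ren.cast ht.symm ht.symm
      ((Ren.add (id : Ren a a) (Ren.symm 1 1)).add (id : Ren b b)))
    (hR' : R' = Ren.cast hs.symm hs'.symm
      ((Ren.add (id : Ren a a) (Ren.symm n 1)).add (id : Ren b b))) :
    Rule O P (.two (.ren R) (.sub a' b g h3 h4)) (.two (.sub a b' g h1 h2) (.ren R')) := by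
  subst ha hb ht hs hs' hR hR'
  exact .swap_right a b g

theorem central' (a m b : ℕ) {n₁ n₂ s t p q b₁ a₂ a₃ b₃ : ℕ} (g₁ : O.Op n₁) (g₂ : O.Op n₂)
    (hP : P _ g₁ ∨ P _ g₂) (hb₁ : b₁ = m + 1 + b) (ha₂ : a₂ = a + n₁ + m) (ha₃ : a₃ = a + 1 + m)
    (hb₃ : b₃ = m + n₂ + b) (h1 : p = a + n₁ + b₁) (h2 : t = a + 1 + b₁) (h3 : s = a₂ + n₂ + b)
    (h4 : p = a₂ + 1 + b) (h5 : q = a₃ + n₂ + b) (h6 : t = a₃ + 1 + b) (h7 : s = a + n₁ + b₃)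
    (h8 : q = a + 1 + b₃) :
    Rule O P (.two (.sub a b₁ g₁ h1 h2) (.sub a₂ b g₂ h3 h4))
      (.two (.sub a₃ b g₂ h5 h6) (.sub a b₃ g₁ h7 h8)) := by
  subst hb₁ ha₂ ha₃ hb₃ h1 h3 h5 h6
  exact .central a m b g₁ g₂ hP

theorem discard' (a b : ℕ) {n s t u : ℕ} (g : O.Op n) (hP : P _ g) (hs : s = a + n + b)
    (ht : t = a + 1 + b) (hu : u = a + 0 + b) (R : Ren u t) (R' : Ren u s)
    (hR : R = Ren.cast hu.symm ht.symm
      ((Ren.add (id : Ren a a) (Ren.discard 1)).add (id : Ren b b)))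
    (hR' : R' = Ren.cast hu.symm hs.symm
      ((Ren.add (id : Ren a a) (Ren.discard n)).add (id : Ren b b))) :
    Rule O P (.two (.ren R) (.sub a b g hs ht)) (.one (.ren R')) := by
  subst hs ht hu hR hR'
  exact .discard a b g hP

theorem copy' (a b : ℕ) {n s t u p q a' b' : ℕ} (g : O.Op n) (hP : P _ g) (ha : a' = a + n)
    (hb : b' = 1 + b) (hs : s = a + n + b)
    (ht : t = a + 1 + b) (hu : u = a + (1 + 1) + b) (hq : q = a + (n + n) + b)
    (h1 : p = a + n + b') (h2 : u = a + 1 + b') (h3 : q = a' + n + b) (h4 : p = a' + 1 + b)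
    (R : Ren u t) (R' : Ren q s)
    (hR : R = Ren.cast hu.symm ht.symm
      ((Ren.add (id : Ren a a) (Ren.copy 1)).add (id : Ren b b)))
    (hR' : R' = Ren.cast hq.symm hs.symm
      ((Ren.add (id : Ren a a) (Ren.copy n)).add (id : Ren b b))) :
    Rule O P (.two (.ren R) (.sub a b g hs ht))
      (.three (.sub a b' g h1 h2) (.sub a' b g h3 h4) (.ren R')) := by
  subst ha hb hs ht hu hq h1 hR hR'
  exact .copy a b g hP

theorem whiskerL (k : ℕ) {m n : ℕ} {x y : Word O m n} (h : Rule O P x y) :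
    Rule O P (x.whiskerL k) (y.whiskerL k) := by
  cases h with
  | unit_sub a b => exact unit_sub' _ _ _
  | unit_ren n =>
      simp only [Word.one, Word.whiskerL, Step.whiskerL, Ren.add_id_id]
      exact .unit_ren _
  | assoc a b c d g h hn => exact assoc' _ _ _ _ _ _ _ _ _ (by omega) rfl _ _ _
  | ren_ren r r' =>
      have e : Ren.add (id : Ren k k) (r' ∘ r) = Ren.add id r' ∘ Ren.add id r :=
        Ren.add_comp id id r r'
      simp only [Word.one, Word.whiskerL, Step.whiskerL, e]
      exact .ren_ren _ _
  | sub_ren g r₁ r r₂ =>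
      exact sub_ren' g (Ren.add id r₁) r r₂ _ _ _ _ _ _
        (Ren.add_left3 k _ _ _) (Ren.add_left3 k _ _ _)
  | swap_left a b g =>
      refine swap_left' (k + a) b g rfl (by omega) (by omega) (by omega) (by omega) _ _ _ _ _ _
        ?_ ?_ <;> rw [Ren.add_left3, Ren.add_id_id]
  | swap_right a b g =>
      refine swap_right' (k + a) b g rfl (by omega) (by omega) (by omega) (by omega) _ _ _ _ _ _
        ?_ ?_ <;> rw [Ren.add_left3, Ren.add_id_id]
  | central a m b g₁ g₂ hP =>
      exact central' (k + a) m b g₁ g₂ hP rfl (by omega) (by omega) rfl _ _ _ _ _ _ _ _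
  | discard a b g hP =>
      refine discard' (k + a) b g hP _ _ (by omega) _ _ ?_ ?_ <;>
        rw [Ren.add_left3, Ren.add_id_id]
  | copy a b g hP =>
      refine copy' (k + a) b g hP (by omega) rfl _ _ (by omega) (by omega) _ _ _ _ _ _ ?_ ?_ <;>
        rw [Ren.add_left3, Ren.add_id_id]

theorem whiskerR (k : ℕ) {m n : ℕ} {x y : Word O m n} (h : Rule O P x y) :
    Rule O P (x.whiskerR k) (y.whiskerR k) := by
  cases h with
  | unit_sub a b => exact unit_sub' _ _ _
  | unit_ren n =>
      simp only [Word.one, Word.whiskerR, Step.whiskerR, Ren.add_id_id]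
      exact .unit_ren _
  | assoc a b c d g h hn => exact assoc' _ _ _ _ _ _ _ _ _ rfl (by omega) _ _ _
  | ren_ren r r' =>
      have e : Ren.add (r' ∘ r) (id : Ren k k) = Ren.add r' id ∘ Ren.add r id :=
        Ren.add_comp r r' id id
      simp only [Word.one, Word.whiskerR, Step.whiskerR, e]
      exact .ren_ren _ _
  | sub_ren g r₁ r r₂ =>
      exact sub_ren' g r₁ r (Ren.add r₂ id) _ _ _ _ _ _
        (Ren.add_right3 k _ _ _) (Ren.add_right3 k _ _ _)
  | swap_left a b g =>
      refine swap_left' a (b + k) g (by omega) rfl (by omega) (by omega) (by omega) _ _ _ _ _ _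
        ?_ ?_ <;> rw [Ren.add_right3, Ren.add_id_id]
  | swap_right a b g =>
      refine swap_right' a (b + k) g (by omega) rfl (by omega) (by omega) (by omega) _ _ _ _ _ _
        ?_ ?_ <;> rw [Ren.add_right3, Ren.add_id_id]
  | central a m b g₁ g₂ hP =>
      exact central' a m (b + k) g₁ g₂ hP (by omega) rfl rfl (by omega) _ _ _ _ _ _ _ _
  | discard a b g hP =>
      refine discard' a (b + k) g hP _ _ (by omega) _ _ ?_ ?_ <;>
        rw [Ren.add_right3, Ren.add_id_id]
  | copy a b g hP =>
      refine copy' a (b + k) g hP rfl (by omega) _ _ (by omega) (by omega) _ _ _ _ _ _ ?_ ?_ <;>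
        rw [Ren.add_right3, Ren.add_id_id]

end Rule

/-- Substitutions `m → n`: words modulo the congruence generated by the rules. -/
def Subs (O : PreoperadData.{u}) (P : ∀ n : ℕ, O.Op n → Prop) (m n : ℕ) : Type u :=
  Quot (RuleInContext O P (m := m) (n := n))

namespace Subs

/-- The class of a word. -/
def mk {m n : ℕ} (x : Word O m n) : Subs O P m n := Quot.mk _ x

/-- The class of the one letter word `{0 ⊣ g ⊢ 0}`. -/
def single {n : ℕ} (g : O.Op n) : Subs O P n 1 :=
  mk (.one (.sub 0 0 g (by omega) rfl))

/-- The class of the one letter word `r`. -/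
def ren {m n : ℕ} (r : Ren n m) : Subs O P m n := mk (.one (.ren r))

/-- Composition is induced by concatenation. -/
def comp {l m n : ℕ} (x : Subs O P m n) (y : Subs O P l m) : Subs O P l n :=
  Quot.map₂ Word.append
    (by
      rintro z _ _ ⟨u, w, h⟩
      simpa only [Word.append_assoc] using RuleInContext.intro (z.append u) w h)
    (by
      rintro _ _ z ⟨u, w, h⟩
      simpa only [Word.append_assoc] using RuleInContext.intro u (w.append z) h) x y

/-- Left whiskering is induced by letterwise left whiskering. -/
def whiskerL (k : ℕ) {m n : ℕ} (x : Subs O P m n) : Subs O P (k + m) (k + n) :=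
  Quot.map (Word.whiskerL k)
    (by
      rintro _ _ ⟨u, w, h⟩
      simpa only [Word.whiskerL_append] using
        RuleInContext.intro (u.whiskerL k) (w.whiskerL k) (h.whiskerL k)) x

/-- Right whiskering is induced by letterwise right whiskering. -/
def whiskerR {m n : ℕ} (x : Subs O P m n) (k : ℕ) : Subs O P (m + k) (n + k) :=
  Quot.map (Word.whiskerR k)
    (by
      rintro _ _ ⟨u, w, h⟩
      simpa only [Word.whiskerR_append] using
        RuleInContext.intro (u.whiskerR k) (w.whiskerR k) (h.whiskerR k)) x

end Subs

/-- The PROP operations on substitutions. -/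
def subsProp (O : PreoperadData.{u}) (P : ∀ n : ℕ, O.Op n → Prop) : PrePropData.{u} where
  Hom := Subs O P
  id _ := Subs.mk .nil
  comp := Subs.comp
  whiskerL k := Subs.whiskerL k
  whiskerR x k := Subs.whiskerR x k
  symm m n := Subs.ren (Ren.symm n m)

/-- `CSub(V)`: substitution words of value operations modulo all the rules. -/
abbrev CSub (F : FreydOperadData.{u}) : PrePropData.{u} :=
  subsProp F.V (fun _ _ => True)

/-- `g` is a computation of the form `ret f`. -/
def FreydOperadData.IsPure (F : FreydOperadData.{u}) {n : ℕ} (g : F.C.Op n) : Prop :=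
  ∃ f : F.V.Op n, F.ret f = g

/-- `Sub(C)`: substitution words of computation operations, modulo the rules for all operations
and the rules that express that the pure computations `ret f` are central and are discarded and
copied like values. -/
abbrev Sub (F : FreydOperadData.{u}) : PrePropData.{u} :=
  subsProp F.C (fun _ => F.IsPure)

/-- The letterwise action of `ret`. -/
def Step.ret (F : FreydOperadData.{u}) : {m n : ℕ} → Step F.V m n → Step F.C m n
  | _, _, .sub a b g hs ht => .sub a b (F.ret g) hs ht
  | _, _, .ren r => .ren r

/-- The letterwise action of `ret`. -/
def Word.ret (F : FreydOperadData.{u}) {m : ℕ} : {n : ℕ} → Word F.V m n → Word F.C m n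
  | _, .nil => .nil
  | _, .cons x w => .cons (x.ret F) (w.ret F)

theorem Word.ret_append (F : FreydOperadData.{u}) : ∀ {l m n : ℕ} (x : Word F.V m n)
    (y : Word F.V l m), (x.append y).ret F = (x.ret F).append (y.ret F)
  | _, _, _, .nil, _ => rfl
  | _, _, _, .cons x w, y => by
      simp only [append, Word.ret]; rw [Word.ret_append F w]

theorem Rule.ret (F : FreydOperadData.{u}) {m n : ℕ} {x y : Word F.V m n}
    (h : Rule F.V (fun _ _ => True) x y) : Rule F.C (fun _ => F.IsPure) (x.ret F) (y.ret F) := by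
  cases h with
  | unit_sub a b =>
      simp only [Word.one, Word.ret, Step.ret, F.ret_one]
      exact .unit_sub a b
  | unit_ren => exact .unit_ren _
  | assoc a b c d g h hn =>
      simp only [Word.one, Word.two, Word.ret, Step.ret, F.ret_sub]
      exact .assoc a b c d _ _ hn
  | ren_ren r r' => exact .ren_ren r r'
  | sub_ren g r₁ r r₂ =>
      simp only [Word.two, Word.ret, Step.ret, F.ret_ren]
      exact .sub_ren _ r₁ r r₂
  | swap_left a b g => exact .swap_left a b _
  | swap_right a b g => exact .swap_right a b _
  | central a m b g₁ g₂ hP => exact .central a m b _ _ (.inl ⟨g₁, rfl⟩)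
  | discard a b g hP => exact .discard a b _ ⟨g, rfl⟩
  | copy a b g hP => exact .copy a b _ ⟨g, rfl⟩

/-- The operations of the Freyd PROP of substitutions `(CSub(V), Sub(C), ret^Sub)`. -/
def freydPropOfSubstitutions (F : FreydOperadData.{u}) : FreydPropData.{u} where
  V := CSub F
  C := Sub F
  copy n := Subs.ren (Ren.copy n)
  discard n := Subs.ren (Ren.discard n)
  J x := Quot.map (Word.ret F)
    (by
      rintro _ _ ⟨u, w, h⟩
      simpa only [Word.ret_append] using RuleInContext.intro (u.ret F) (w.ret F) (h.ret F)) x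

/-- The Freyd PROP of substitutions on the term model, with application and the symbols
interpreted by the one letter words on their interpretations in the term model, and with a given
abstraction operation. -/
def termModelProp (S : Signature.{u})
    (abs : ∀ n : ℕ, (Sub (termModel S)).Hom (n + 1) 1 → (CSub (termModel S)).Hom n 1) :
    ModelData.{u, u} S where
  toFreydPropData := freydPropOfSubstitutions (termModel S)
  abs := abs
  app := Subs.single (termModel.app S)
  func f := Subs.single (termModel.func f)
  proc p := Subs.single (termModel.proc p)

/-- `abs` is the abstraction operation of the term model, transported along the assignments
`g ↦ {0 ⊣ g ⊢ 0}` of substitutions with codomain `1` to values and computations. -/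
def IsTermAbs (S : Signature.{u})
    (abs : ∀ n : ℕ, (Sub (termModel S)).Hom (n + 1) 1 → (CSub (termModel S)).Hom n 1) : Prop :=
  ∀ (n : ℕ) (c : (termModel S).C.Op (n + 1)),
    abs n (Subs.single c) = Subs.single (termModel.abs c)

end FreydCLC

namespace FreydCLC

/-! ## Two-sided whiskering in a pre-PROP -/

namespace PrePropData

variable {P : PrePropData.{w}}

theorem cast_heq {m n m' n' : ℕ} (hm : m = m') (hn : n = n') (f : P.Hom m n) :
    HEq (P.cast hm hn f) f := by
  subst hm hn; rfl

theorem whiskerR_heq {k k' m n m' n' : ℕ} (hk : k = k') (hm : m = m') (hn : n = n') {f : P.Hom m n}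
    {f' : P.Hom m' n'} (h : HEq f f') : HEq (P.whiskerR f k) (P.whiskerR f' k') := by
  subst hk hm hn h; rfl

theorem comp_heq {l m n l' m' n' : ℕ} (hl : l = l') (hm : m = m') (hn : n = n') {g : P.Hom m n}
    {g' : P.Hom m' n'} {f : P.Hom l m} {f' : P.Hom l' m'} (hg : HEq g g') (hf : HEq f f') :
    HEq (P.comp g f) (P.comp g' f') := by
  subst hl hm hn hg hf; rfl

theorem cast_comp {l m n l' m' n' : ℕ} (hl : l = l') (hm : m = m') (hn : n = n') (g : P.Hom m n)
    (f : P.Hom l m) :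
    P.cast hl hn (P.comp g f) = P.comp (P.cast hm hn g) (P.cast hl hm f) := by
  subst hl hm hn; rfl

variable (P) in
/-- The two-sided whiskering `a ⊣ f ⊢ b`, with source and target given up to equality. -/
def wh {m n s t : ℕ} (a b : ℕ) (f : P.Hom m n) (hs : s = a + m + b) (ht : t = a + n + b) :
    P.Hom s t :=
  P.cast hs.symm ht.symm (P.whiskerR (P.whiskerL a f) b)

theorem wh_heq {m n s t : ℕ} (a b : ℕ) (f : P.Hom m n) (hs : s = a + m + b) (ht : t = a + n + b) :
    HEq (P.wh a b f hs ht) (P.whiskerR (P.whiskerL a f) b) :=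
  cast_heq _ _ _

theorem wh_congr {m n s t a b a' b' : ℕ} (f : P.Hom m n) (ha : a = a') (hb : b = b')
    (hs : s = a + m + b) (ht : t = a + n + b) (hs' : s = a' + m + b') (ht' : t = a' + n + b') :
    P.wh a b f hs ht = P.wh a' b' f hs' ht' := by
  subst ha hb; rfl

theorem cast_eq_wh {m n s t m' n' s' t' a b : ℕ} (f : P.Hom m n) (hs : s = a + m + b)
    (ht : t = a + n + b) (es : s = s') (et : t = t') (em : m = m') (en : n = n') :
    P.cast es et (P.wh a b f hs ht) = P.wh a b (P.cast em en f) (by omega) (by omega) := by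
  subst es et em en; rfl

namespace IsPreProp

variable (h : P.IsPreProp)
include h

theorem whiskerL_add_heq (k l : ℕ) {m n : ℕ} (f : P.Hom m n) :
    HEq (P.whiskerL k (P.whiskerL l f)) (P.whiskerL (k + l) f) := by
  rw [← h.whiskerL_add]; exact cast_heq _ _ _

theorem whiskerR_add_heq (k l : ℕ) {m n : ℕ} (f : P.Hom m n) :
    HEq (P.whiskerR (P.whiskerR f k) l) (P.whiskerR f (k + l)) := by
  rw [← h.whiskerR_add]; exact (cast_heq _ _ _).symm

theorem whiskerL_whiskerR_heq (k l : ℕ) {m n : ℕ} (f : P.Hom m n) :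
    HEq (P.whiskerL k (P.whiskerR f l)) (P.whiskerR (P.whiskerL k f) l) := by
  rw [← h.whiskerL_whiskerR]; exact cast_heq _ _ _

theorem whiskerL_zero_heq {m n : ℕ} (f : P.Hom m n) : HEq (P.whiskerL 0 f) f := by
  conv_rhs => rw [← h.whiskerL_zero f]
  exact (cast_heq _ _ _).symm

theorem whiskerL_eq_wh (k : ℕ) {m n : ℕ} (f : P.Hom m n) :
    P.whiskerL k f = P.wh k 0 f rfl rfl := by
  rw [wh, h.whiskerR_zero]; rfl

theorem whiskerR_eq_wh {m n : ℕ} (f : P.Hom m n) (k : ℕ) :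
    P.whiskerR f k = P.wh 0 k f (by omega) (by omega) :=
  eq_of_heq (.trans (whiskerR_heq rfl (by omega) (by omega) (h.whiskerL_zero_heq f).symm)
    (wh_heq _ _ _ _ _).symm)

theorem wh_zero {m n : ℕ} (f : P.Hom m n) (hs : m = 0 + m + 0) (ht : n = 0 + n + 0) :
    P.wh 0 0 f hs ht = f :=
  eq_of_heq ((wh_heq _ _ _ _ _).trans (by rw [h.whiskerR_zero]; exact h.whiskerL_zero_heq f))

theorem wh_wh {m n s t s' t' a b c d a' b' : ℕ} (f : P.Hom m n) (hs : s = c + m + d)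
    (ht : t = c + n + d) (hs' : s' = a + s + b) (ht' : t' = a + t + b) (ha : a' = a + c)
    (hb : b' = d + b) :
    P.wh a b (P.wh c d f hs ht) hs' ht' = P.wh a' b' f (by omega) (by omega) := by
  subst ha hb hs ht
  refine eq_of_heq ((wh_heq _ _ _ _ _).trans (.trans ?_ (wh_heq _ _ _ _ _).symm))
  have e : P.wh c d f rfl rfl = P.whiskerR (P.whiskerL c f) d := rfl
  rw [e]
  refine .trans (whiskerR_heq rfl (by omega) (by omega) (h.whiskerL_whiskerR_heq a d _)) ?_
  refine .trans (h.whiskerR_add_heq _ _ _) ?_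
  exact whiskerR_heq rfl (by omega) (by omega) (h.whiskerL_add_heq a c _)

theorem wh_id {s a b m : ℕ} (hs hs' : s = a + m + b) : P.wh a b (P.id m) hs hs' = P.id s := by
  subst hs
  change P.whiskerR (P.whiskerL a (P.id m)) b = _
  rw [h.whiskerL_id, h.whiskerR_id]

theorem wh_comp {k m n s t x a b : ℕ} (g : P.Hom k n) (f : P.Hom m k) (hs : s = a + m + b)
    (hx : x = a + k + b) (ht : t = a + n + b) :
    P.comp (P.wh a b g hx ht) (P.wh a b f hs hx) = P.wh a b (P.comp g f) hs ht := by
  subst hs hx ht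
  change P.comp (P.whiskerR (P.whiskerL a g) b) (P.whiskerR (P.whiskerL a f) b) =
    P.whiskerR (P.whiskerL a (P.comp g f)) b
  rw [h.whiskerL_comp, h.whiskerR_comp]

theorem wh_symm_natural {m n s t a b k x y : ℕ} (f : P.Hom m n) (hs : s = a + m + (k + b))
    (ht : t = a + n + (k + b)) (hx : x = a + k + m + b) (hy : y = a + k + n + b) :
    P.comp (P.wh a b (P.symm n k) (by omega : t = _) (by omega : y = _)) (P.wh a (k + b) f hs ht) =
      P.comp (P.wh (a + k) b f hx hy) (P.wh a b (P.symm m k) (by omega) (by omega)) := by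
  have e := congrArg (fun z => P.wh a b z (by omega : s = _) (by omega : y = _))
    (h.symm_natural f k)
  simp only [h.whiskerL_eq_wh, h.whiskerR_eq_wh] at e
  rw [← h.wh_comp _ _ _ (by omega : t = _), ← h.wh_comp _ _ _ (by omega : x = _),
    h.wh_wh _ _ _ _ _ (by omega : a = _) rfl, h.wh_wh _ _ _ _ _ rfl (by omega : b = _)] at e
  exact e

theorem wh_symm_natural' {m n s t a b k x y : ℕ} (f : P.Hom m n) (hs : s = a + m + (k + b))
    (ht : t = a + n + (k + b)) (hx : x = a + k + m + b) (hy : y = a + k + n + b) :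
    P.comp (P.wh a b (P.symm k n) (by omega : y = _) (by omega : t = _)) (P.wh (a + k) b f hx hy) =
      P.comp (P.wh a (k + b) f hs ht) (P.wh a b (P.symm k m) (by omega) (by omega)) := by
  have e := congrArg (fun z => P.wh a b z (by omega : x = _) (by omega : t = _))
    (h.symm_natural' f k)
  simp only [h.whiskerL_eq_wh, h.whiskerR_eq_wh] at e
  rw [← h.wh_comp _ _ _ (by omega : y = _), ← h.wh_comp _ _ _ (by omega : s = _),
    h.wh_wh _ _ _ _ _ rfl (by omega : b = _), h.wh_wh _ _ _ _ _ (by omega : a = _) rfl] at e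
  exact e

theorem interchange {m n m' n' a b p x y s t b₁ a₂ a₃ b₃ : ℕ} (f : P.Hom m n) (g : P.Hom m' n')
    (hc : P.IsCentral f ∨ P.IsCentral g) (hb₁ : b₁ = p + n' + b) (ha₂ : a₂ = a + m + p)
    (ha₃ : a₃ = a + n + p) (hb₃ : b₃ = p + m' + b) (hx : x = a + m + b₁) (ht : t = a + n + b₁)
    (hs : s = a₂ + m' + b) (hx' : x = a₂ + n' + b) (hy : y = a₃ + m' + b) (ht' : t = a₃ + n' + b)
    (hs' : s = a + m + b₃) (hy' : y = a + n + b₃) :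
    P.comp (P.wh a b₁ f hx ht) (P.wh a₂ b g hs hx') =
      P.comp (P.wh a₃ b g hy ht') (P.wh a b₃ f hs' hy') := by
  have key : P.comp (P.wh 0 (p + n') f (by omega : m + (p + n') = _) (by omega : n + (p + n') = _))
        (P.wh (m + p) 0 g (by omega : m + (p + m') = _) (by omega)) =
      P.comp (P.wh (n + p) 0 g (by omega : n + (p + m') = _) (by omega))
        (P.wh 0 (p + m') f (by omega) (by omega)) := by
    rcases hc with hc | hc
    · have e := (hc (P.whiskerL p g)).1
      simp only [h.whiskerL_eq_wh, h.whiskerR_eq_wh] at e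
      rw [h.wh_wh _ _ _ _ _ rfl rfl, h.wh_wh _ _ _ _ _ rfl rfl] at e
      exact e
    · have e := (hc (P.whiskerR f p)).2
      simp only [h.whiskerL_eq_wh, h.whiskerR_eq_wh] at e
      rw [h.wh_wh _ _ _ _ _ rfl rfl, h.wh_wh _ _ _ _ _ rfl rfl] at e
      have c := congrArg (P.cast (by omega : m + p + m' = m + (p + m'))
        (by omega : n + p + n' = n + (p + n'))) e
      rw [cast_comp _ (by omega : m + p + n' = m + (p + n')) _,
        cast_comp _ (by omega : n + p + m' = n + (p + m')) _] at c
      iterate 4 rw [cast_eq_wh _ _ _ _ _ rfl rfl] at c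
      exact c
  subst hb₁ ha₂ ha₃ hb₃
  have e := congrArg (fun z => P.wh a b z (by omega : s = _) (by omega : t = _)) key
  rw [← h.wh_comp _ _ _ (by omega : x = _), ← h.wh_comp _ _ _ (by omega : y = _),
    h.wh_wh _ _ _ _ _ rfl rfl, h.wh_wh _ _ _ _ _ (by omega : a + m + p = _) (by omega : b = _),
    h.wh_wh _ _ _ _ _ (by omega : a + n + p = _) (by omega : b = _),
    h.wh_wh _ _ _ _ _ rfl rfl] at e
  exact e

end IsPreProp

end PrePropData

/-- Pre-PROP functors preserve two-sided whiskering. -/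
theorem PreFunctor.map_wh {P : PrePropData.{v}} {Q : PrePropData.{w}} (F : PreFunctor P Q)
    {m n s t : ℕ} (a b : ℕ) (f : P.Hom m n) (hs : s = a + m + b) (ht : t = a + n + b) :
    F.map (P.wh a b f hs ht) = Q.wh a b (F.map f) hs ht := by
  subst hs ht
  change F.map (P.whiskerR (P.whiskerL a f) b) = Q.whiskerR (Q.whiskerL a (F.map f)) b
  rw [F.map_whiskerR, F.map_whiskerL]

namespace PrePropData

/-! ## Finite products in a cartesian PROP -/

namespace IsCartesianProp

variable {P : PrePropData.{w}} {copy : ∀ n, P.Hom n (n + n)} {discard : ∀ n, P.Hom n 0}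
  (h : P.IsCartesianProp copy discard)

/-- The projection to the first `k` coordinates. -/
def fst (_ : P.IsCartesianProp copy discard) (k l : ℕ) : P.Hom (k + l) k :=
  P.wh k 0 (discard l) rfl rfl

/-- The projection to the last `l` coordinates. -/
def snd (_ : P.IsCartesianProp copy discard) (k l : ℕ) : P.Hom (k + l) l :=
  P.wh 0 l (discard k) (by omega) (by omega)

/-- The pairing of two morphisms. -/
def pair (_ : P.IsCartesianProp copy discard) {m k l : ℕ} (f : P.Hom m k) (g : P.Hom m l) :
    P.Hom m (k + l) :=
  P.comp (P.comp (P.whiskerR f l) (P.whiskerL m g)) (copy m)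

/-- The projection to one coordinate. -/
def proj (_ : P.IsCartesianProp copy discard) {n : ℕ} (i : Fin n) : P.Hom n 1 :=
  P.comp (P.wh 0 1 (discard i.val) (by omega : i.val + 1 = _) rfl)
    (P.wh (i.val + 1) 0 (discard (n - 1 - i.val)) (by omega) rfl)

/-- The morphism with given coordinates. -/
def tuple (h : P.IsCartesianProp copy discard) {n : ℕ} : {k : ℕ} → (Fin k → P.Hom n 1) → P.Hom n k
  | 0, _ => discard n
  | k + 1, v => h.pair (h.tuple fun i : Fin k => v i.castSucc) (v (Fin.last k))

/-- The interpretation of a renaming. -/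
def ofRen (h : P.IsCartesianProp copy discard) {m n : ℕ} (r : Ren m n) : P.Hom n m :=
  h.tuple fun i => h.proj (r i)

include h

theorem discard_zero : discard 0 = P.id 0 := by
  have e := h.discard_copy 0
  have e' : P.comp (P.whiskerR (discard 0) 0) (copy 0) = P.id 0 := e
  rw [h.whiskerR_zero, h.discard_natural] at e'
  exact e'

theorem to_zero {n : ℕ} (f : P.Hom n 0) : f = discard n := by
  rw [← h.discard_natural f, h.discard_zero, h.id_comp]

theorem wh_discard_copy (n : ℕ) : P.comp (h.snd n n) (copy n) = P.id n := by
  have e := h.discard_copy n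
  rw [h.whiskerR_eq_wh, cast_comp _ rfl, cast_eq_wh _ _ _ _ _ rfl rfl] at e
  exact e

theorem wh_copy_discard (n : ℕ) : P.comp (h.fst n n) (copy n) = P.id n := by
  have e := h.copy_discard n
  rw [h.whiskerL_eq_wh] at e
  exact e

theorem fst_whiskerR {m n : ℕ} (f : P.Hom m n) (l : ℕ) :
    P.comp (h.fst n l) (P.whiskerR f l) = P.comp f (h.fst m l) := by
  rw [h.whiskerR_eq_wh]
  conv_rhs => rw [← h.wh_zero f (by omega) (by omega)]
  exact (h.interchange f (discard l) (.inl (h.central f)) (p := 0) (by omega) (by omega) (by omega)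
    (by omega) _ _ _ _ _ _ _ _).symm

theorem fst_whiskerL {m n : ℕ} (k : ℕ) (f : P.Hom m n) :
    P.comp (h.fst k n) (P.whiskerL k f) = h.fst k m := by
  rw [h.whiskerL_eq_wh, fst, h.wh_comp, h.discard_natural]; rfl

theorem snd_whiskerL {m n : ℕ} (k : ℕ) (f : P.Hom m n) :
    P.comp (h.snd k n) (P.whiskerL k f) = P.comp f (h.snd k m) := by
  rw [h.whiskerL_eq_wh]
  conv_rhs => rw [← h.wh_zero f (by omega) (by omega)]
  exact h.interchange (discard k) f (.inr (h.central f)) (p := 0) (by omega) (by omega) (by omega)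
    (by omega) _ _ _ _ _ _ _ _

theorem snd_whiskerR {m n : ℕ} (f : P.Hom m n) (l : ℕ) :
    P.comp (h.snd n l) (P.whiskerR f l) = h.snd m l := by
  rw [h.whiskerR_eq_wh, snd, h.wh_comp, h.discard_natural]; rfl

theorem fst_pair {m k l : ℕ} (f : P.Hom m k) (g : P.Hom m l) :
    P.comp (h.fst k l) (h.pair f g) = f := by
  rw [pair, ← h.assoc, ← h.assoc, h.fst_whiskerR, h.assoc, h.assoc, ← h.assoc (h.fst m l),
    h.fst_whiskerL, h.wh_copy_discard, h.comp_id]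

theorem snd_pair {m k l : ℕ} (f : P.Hom m k) (g : P.Hom m l) :
    P.comp (h.snd k l) (h.pair f g) = g := by
  rw [pair, ← h.assoc, ← h.assoc, h.snd_whiskerR, h.snd_whiskerL, h.assoc, h.wh_discard_copy,
    h.comp_id]

theorem pair_comp {j m k l : ℕ} (f : P.Hom m k) (g : P.Hom m l) (x : P.Hom j m) :
    P.comp (h.pair f g) x = h.pair (P.comp f x) (P.comp g x) := by
  rw [pair, pair, h.assoc, h.copy_natural, tensor, h.whiskerR_comp, h.whiskerL_comp]
  simp only [h.assoc]
  rw [← h.assoc (P.whiskerL m g), ← (h.central x g).1]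
  simp only [h.assoc]

theorem pair_fst_snd (k l : ℕ) : h.pair (h.fst k l) (h.snd k l) = P.id (k + l) := by
  have e1 : P.cast (show k + (k + l) + l = k + k + (l + l) by omega)
        (show k + (l + k) + l = k + l + (k + l) by omega)
        (P.whiskerR (P.whiskerL k (P.symm k l)) l) =
      P.wh k l (P.symm k l) (by omega) (by omega) := rfl
  rw [pair, h.copy_add, e1, tensor, h.whiskerR_eq_wh (h.fst k l), h.whiskerL_eq_wh _ (h.snd k l),
    h.whiskerR_eq_wh (copy k), h.whiskerL_eq_wh _ (copy l), fst, snd,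
    h.wh_wh _ _ _ _ _ (Nat.zero_add k).symm (Nat.zero_add l).symm, h.wh_wh _ _ _ _ _ rfl rfl]
  have e2 : P.wh (k + l + 0) (l + 0) (discard k) (by omega : k + l + (k + l) = _)
      (by omega : k + l + l = _) =
      P.wh k l (P.wh l 0 (discard k) rfl rfl) (by omega) (by omega) :=
    .symm ((h.wh_wh _ _ _ _ _ rfl rfl).trans (wh_congr _ rfl (by omega) _ _ _ _))
  rw [e2, h.wh_comp, h.to_zero (P.comp _ _), ← h.assoc (P.wh k l _ _ _), h.wh_comp,
    h.to_zero (P.comp _ _), show discard (k + l) = P.comp (discard k) (P.wh k 0 (discard l) rfl rfl) from (h.to_zero _).symm,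
    ← h.wh_comp (a := k) (b := l) _ _ _ (by omega : k + k + l = k + k + l), h.wh_wh _ _ _ _ _ rfl (Nat.zero_add l).symm,
    h.assoc, ← h.assoc (P.wh (k + k) l _ _ _),
    ← h.interchange (copy k) (discard l) (.inl (h.central _)) (p := 0) (b₁ := l) (a₂ := k)
      (x := k + l) (by omega) (by omega) (by omega) (by omega)
      (by omega) (by omega) (by omega) (by omega) (by omega) (by omega) (by omega) (by omega),
    h.assoc]
  have e3 : P.comp (P.wh k l (discard l) (by omega : k + (l + l) = _) (by omega : k + l = _))
      (P.wh k 0 (copy l) rfl rfl) = P.id _ := by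
    have := h.wh_wh (discard l) (by omega : l + l = 0 + l + l) (by omega : l = 0 + 0 + l)
      (by omega : k + (l + l) = k + (l + l) + 0) (by omega : k + l = k + l + 0) rfl rfl
    have e : P.wh k 0 (h.snd l l) (by omega : k + (l + l) = _) (by omega : k + l = _) =
      P.wh k l (discard l) (by omega) (by omega) := this
    rw [← e, h.wh_comp, h.wh_discard_copy, h.wh_id]
  have e4 : P.comp (P.wh k l (discard k) (by omega : k + k + l = _) (by omega : k + l = _))
      (P.wh 0 l (copy k) (by omega) (by omega)) = P.id _ := by
    have e : P.wh 0 l (h.fst k k) (by omega : k + k + l = _) (by omega : k + l = _) =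
      P.wh k l (discard k) (by omega) (by omega) :=
      h.wh_wh _ _ _ _ _ (by omega) (by omega)
    rw [← e, h.wh_comp, h.wh_copy_discard, h.wh_id]
  rw [e3]
  exact (congrArg _ (h.comp_id _)).trans e4

theorem pair_ext {m k l : ℕ} {x y : P.Hom m (k + l)}
    (h1 : P.comp (h.fst k l) x = P.comp (h.fst k l) y)
    (h2 : P.comp (h.snd k l) x = P.comp (h.snd k l) y) : x = y := by
  rw [← h.id_comp x, ← h.id_comp y, ← h.pair_fst_snd, h.pair_comp, h.pair_comp, h1, h2]

theorem proj_castAdd {k : ℕ} (l : ℕ) (i : Fin k) :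
    h.proj (Fin.castAdd l i) = P.comp (h.proj i) (h.fst k l) := by
  have e : h.fst k l = P.wh (i.val + 1) 0 (P.wh (k - 1 - i.val) 0 (discard l) rfl rfl)
      (by omega) (by omega) := by
    rw [h.wh_wh _ _ _ _ _ rfl rfl]; exact wh_congr _ (by omega) (by omega) _ _ _ _
  rw [proj, proj, h.assoc, e, h.wh_comp, h.to_zero (P.comp _ _)]
  congr 1
  have : ∀ j (_ : j = k - 1 - i.val + l), P.wh (i.val + 1) 0 (discard j) (by omega : k + l = _) rfl =
    P.wh (i.val + 1) 0 (discard (k - 1 - i.val + l)) (by omega : k + l = _) (by omega) := by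
    rintro _ rfl; rfl
  exact this _ (by simp only [Fin.val_castAdd]; omega)

theorem proj_natAdd (k : ℕ) {l : ℕ} (j : Fin l) :
    h.proj (Fin.natAdd k j) = P.comp (h.proj j) (h.snd k l) := by
  rw [proj, proj, h.assoc, snd, ← h.interchange (discard k) (discard (l - 1 - j.val))
    (.inl (h.central _)) (p := j.val + 1) (b₁ := j.val + 1) (a₂ := k + (j.val + 1))
    (x := k + (j.val + 1)) (by omega) (by omega) (by omega) (by omega)
      (by omega) (by omega) (by omega) (by omega) (by omega) (by omega) (by omega) (by omega)]
  have e : P.wh 0 (j.val + 1) (discard k) (by omega : k + (j.val + 1) = _)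
      (by omega : j.val + 1 = _) =
      P.wh 0 1 (P.wh 0 j.val (discard k) (by omega : k + j.val = 0 + k + j.val)
        (by omega : j.val = 0 + 0 + j.val)) (by omega) (by omega) := by
    rw [h.wh_wh _ _ _ _ _ rfl rfl]
  rw [e, ← h.assoc, h.wh_comp, h.to_zero (P.comp _ _)]
  have : ∀ a b c (_ : a = b) (ha : c = a + 1) (hb : c = b + 1) d d' (_ : d = d') (_ : k + l = c + d),
    P.comp (P.wh 0 1 (discard a) (by omega : a + 1 = _) rfl)
      (P.wh (a + 1) 0 (discard d) (by omega : k + l = _) rfl) =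
    P.comp (P.wh 0 1 (discard b) (by omega : c = _) rfl)
      (P.wh c 0 (discard d') (by omega : k + l = _) rfl) := by
    rintro a b c rfl rfl _ d _ rfl _; rfl
  refine this _ _ _ ?_ ?_ ?_ _ _ ?_ ?_ <;> (try simp only [Fin.val_natAdd]) <;> omega

theorem proj_zero : h.proj (0 : Fin 1) = P.id 1 := by
  change P.comp (P.wh 0 1 (discard 0) _ _) (P.wh (0 + 1) 0 (discard 0) _ _) = _
  rw [h.discard_zero, h.wh_id, h.wh_id, h.id_comp]

theorem proj_castSucc {k : ℕ} (i : Fin k) :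
    h.proj i.castSucc = P.comp (h.proj i) (h.fst k 1) := h.proj_castAdd 1 i

theorem proj_last (k : ℕ) : h.proj (Fin.last k) = h.snd k 1 := by
  have := h.proj_natAdd k (0 : Fin 1)
  rw [h.proj_zero, h.id_comp] at this
  exact this

theorem proj_ext : ∀ {k m : ℕ} {x y : P.Hom m k}
    (_ : ∀ i, P.comp (h.proj i) x = P.comp (h.proj i) y), x = y
  | 0, _, x, y, _ => (h.to_zero x).trans (h.to_zero y).symm
  | k + 1, _, x, y, e => by
      refine h.pair_ext (proj_ext fun i => ?_) ?_
      · rw [← h.assoc, ← h.assoc, ← h.proj_castSucc]; exact e _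
      · rw [← h.proj_last]; exact e _

theorem proj_tuple : ∀ {k n : ℕ} (v : Fin k → P.Hom n 1) (i : Fin k),
    P.comp (h.proj i) (h.tuple v) = v i
  | 0, _, _, i => i.elim0
  | k + 1, n, v, i => by
      rw [tuple]
      induction i using Fin.lastCases with
      | last => rw [h.proj_last, h.snd_pair]
      | cast i => rw [h.proj_castSucc, h.assoc, h.fst_pair, proj_tuple]

theorem eq_tuple {k n : ℕ} {x : P.Hom n k} {v : Fin k → P.Hom n 1}
    (e : ∀ i, P.comp (h.proj i) x = v i) : x = h.tuple v :=
  h.proj_ext fun i => by rw [e, h.proj_tuple]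

theorem tuple_comp {k m n : ℕ} (v : Fin k → P.Hom n 1) (x : P.Hom m n) :
    P.comp (h.tuple v) x = h.tuple fun i => P.comp (v i) x :=
  h.eq_tuple fun i => by rw [← h.assoc, h.proj_tuple]

/-! ### The interpretation of renamings -/

theorem proj_ofRen {m n : ℕ} (r : Ren m n) (i : Fin m) :
    P.comp (h.proj i) (h.ofRen r) = h.proj (r i) := h.proj_tuple _ _

theorem ofRen_id (n : ℕ) : h.ofRen (_root_.id : Ren n n) = P.id n :=
  (h.eq_tuple fun i => by rw [h.comp_id]; rfl).symm

theorem ofRen_comp {k m n : ℕ} (r : Ren m n) (s : Ren n k) :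
    P.comp (h.ofRen r) (h.ofRen s) = h.ofRen (s ∘ r) :=
  h.eq_tuple fun i => by rw [← h.assoc, h.proj_ofRen, h.proj_ofRen]; rfl

theorem ofRen_whiskerR {m n : ℕ} (r : Ren m n) (k : ℕ) :
    P.whiskerR (h.ofRen r) k = h.ofRen (r.add (_root_.id : Ren k k)) :=
  h.eq_tuple fun i => by
    induction i using Fin.addCases with
    | left i =>
      rw [h.proj_castAdd, h.assoc, h.fst_whiskerR, ← h.assoc, h.proj_ofRen, ← h.proj_castAdd,
        Ren.add, Fin.addCases_left]
    | right i => rw [h.proj_natAdd, h.assoc, h.snd_whiskerR, ← h.proj_natAdd, Ren.add,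
        Fin.addCases_right, _root_.id]

theorem ofRen_whiskerL {m n : ℕ} (r : Ren m n) (k : ℕ) :
    P.whiskerL k (h.ofRen r) = h.ofRen (Ren.add (_root_.id : Ren k k) r) :=
  h.eq_tuple fun i => by
    induction i using Fin.addCases with
    | left i => rw [h.proj_castAdd, h.assoc, h.fst_whiskerL, ← h.proj_castAdd, Ren.add,
        Fin.addCases_left, _root_.id]
    | right i =>
      rw [h.proj_natAdd, h.assoc, h.snd_whiskerL, ← h.assoc, h.proj_ofRen, ← h.proj_natAdd,
        Ren.add, Fin.addCases_right]

theorem symm_zero_heq (m : ℕ) : HEq (P.symm m 0) (P.id m) ∧ HEq (P.symm 0 m) (P.id m) := by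
  obtain ⟨D, hD⟩ : ∃ D : P.Hom m m, HEq (P.symm m 0) D :=
    ⟨P.cast rfl (Nat.zero_add m) (P.symm m 0), (cast_heq _ _ _).symm⟩
  obtain ⟨E, hE⟩ : ∃ E : P.Hom m m, HEq (P.symm 0 m) E :=
    ⟨P.cast (Nat.zero_add m) rfl (P.symm 0 m), (cast_heq _ _ _).symm⟩
  have hED : P.comp E D = P.id m := by
    refine eq_of_heq ((comp_heq rfl (Nat.zero_add m) rfl hE hD).symm.trans ?_)
    exact heq_of_eq (h.symm_symm m 0)
  have hDD : D = P.comp D D := by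
    refine eq_of_heq (hD.symm.trans ?_)
    have e := h.symm_add m 0 0
    refine (heq_of_eq e).trans ((cast_heq _ _ _).trans ?_)
    refine comp_heq rfl (by omega) (by omega) ((h.whiskerL_zero_heq _).trans hD) ?_
    refine (cast_heq _ _ _).trans ?_
    rw [h.whiskerR_zero]; exact hD
  have hD' : D = P.id m := by
    rw [← h.id_comp D, ← hED, h.assoc, ← hDD]
  refine ⟨hD.trans (heq_of_eq hD'), hE.trans (heq_of_eq ?_)⟩
  rw [← hED, hD', h.comp_id]

theorem fst_symm (m n : ℕ) : P.comp (h.fst n m) (P.symm m n) = h.snd m n := by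
  have e := h.symm_natural (discard m) n
  rw [h.whiskerL_eq_wh] at e
  refine e.symm.trans ?_
  have hE := (h.symm_zero_heq n).2
  refine eq_of_heq (.trans (comp_heq (g := P.symm 0 n) (g' := P.id n) rfl (Nat.zero_add n) rfl hE
    (f := P.whiskerR (discard m) n) (f' := h.snd m n) ?_) (heq_of_eq (h.id_comp _)))
  rw [h.whiskerR_eq_wh]
  exact (wh_heq _ _ _ _ _).trans (wh_heq _ _ _ _ _).symm

theorem snd_symm (m n : ℕ) : P.comp (h.snd n m) (P.symm m n) = h.fst m n := by
  rw [← h.fst_symm, h.assoc, h.symm_symm, h.comp_id]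

theorem symm_eq_ofRen (m n : ℕ) : P.symm m n = h.ofRen (Ren.symm n m) :=
  h.eq_tuple fun i => by
    induction i using Fin.addCases with
    | left i => rw [h.proj_castAdd, h.assoc, h.fst_symm, ← h.proj_natAdd, Ren.symm,
        Fin.addCases_left]
    | right i => rw [h.proj_natAdd, h.assoc, h.snd_symm, ← h.proj_castAdd, Ren.symm,
        Fin.addCases_right]

theorem copy_eq_ofRen (n : ℕ) : copy n = h.ofRen (Ren.copy n) :=
  h.eq_tuple fun i => by
    induction i using Fin.addCases with
    | left i => rw [h.proj_castAdd, h.assoc, h.wh_copy_discard, h.comp_id, Ren.copy,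
        Fin.addCases_left, _root_.id]
    | right i => rw [h.proj_natAdd, h.assoc, h.wh_discard_copy, h.comp_id, Ren.copy,
        Fin.addCases_right, _root_.id]

theorem discard_eq_ofRen (n : ℕ) : discard n = h.ofRen (Ren.discard n) :=
  (h.to_zero _).symm

theorem wh_ofRen {m n s t a b : ℕ} (r : Ren m n) (hs : s = a + n + b) (ht : t = a + m + b) :
    P.wh a b (h.ofRen r) hs ht = h.ofRen (Ren.cast ht.symm hs.symm
      ((Ren.add (_root_.id : Ren a a) r).add (_root_.id : Ren b b))) := by
  subst hs ht
  change P.whiskerR (P.whiskerL a (h.ofRen r)) b = h.ofRen _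
  rw [h.ofRen_whiskerL, h.ofRen_whiskerR]; rfl

theorem wh_symm {m n s t a b : ℕ} (hs : s = a + (m + n) + b) (ht : t = a + (n + m) + b) :
    P.wh a b (P.symm m n) hs ht = h.ofRen (Ren.cast ht.symm hs.symm
      ((Ren.add (_root_.id : Ren a a) (Ren.symm n m)).add (_root_.id : Ren b b))) := by
  rw [h.symm_eq_ofRen, h.wh_ofRen]

theorem wh_copy {m s t a b : ℕ} (hs : s = a + m + b) (ht : t = a + (m + m) + b) :
    P.wh a b (copy m) hs ht = h.ofRen (Ren.cast ht.symm hs.symm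
      ((Ren.add (_root_.id : Ren a a) (Ren.copy m)).add (_root_.id : Ren b b))) := by
  rw [h.copy_eq_ofRen, h.wh_ofRen]

theorem wh_discard {m s t a b : ℕ} (hs : s = a + m + b) (ht : t = a + 0 + b) :
    P.wh a b (discard m) hs ht = h.ofRen (Ren.cast ht.symm hs.symm
      ((Ren.add (_root_.id : Ren a a) (Ren.discard m)).add (_root_.id : Ren b b))) := by
  rw [h.discard_eq_ofRen, h.wh_ofRen]

end IsCartesianProp

end PrePropData

/-! ### Functors that preserve copying and discarding -/

section Map

variable {P : PrePropData.{v}} {copy : ∀ n, P.Hom n (n + n)} {discard : ∀ n, P.Hom n 0}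
  (hP : P.IsCartesianProp copy discard) {Q : PrePropData.{w}} {copy' : ∀ n, Q.Hom n (n + n)}
  {discard' : ∀ n, Q.Hom n 0} (hQ : Q.IsCartesianProp copy' discard') (F : PreFunctor P Q)
  (hc : ∀ n, F.map (copy n) = copy' n) (hd : ∀ n, F.map (discard n) = discard' n)

include hd in
theorem PreFunctor.map_proj {n : ℕ} (i : Fin n) : F.map (hP.proj i) = hQ.proj i := by
  simp only [PrePropData.IsCartesianProp.proj, F.map_comp, F.map_wh, hd]

include hc in
theorem PreFunctor.map_pair {m k l : ℕ} (f : P.Hom m k) (g : P.Hom m l) :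
    F.map (hP.pair f g) = hQ.pair (F.map f) (F.map g) := by
  simp only [PrePropData.IsCartesianProp.pair, F.map_comp, F.map_whiskerL, F.map_whiskerR, hc]

include hc hd in
theorem PreFunctor.map_tuple : ∀ {n k : ℕ} (x : Fin k → P.Hom n 1),
    F.map (hP.tuple x) = hQ.tuple fun i => F.map (x i)
  | _, 0, _ => hd _
  | _, k + 1, x => by
      simp only [PrePropData.IsCartesianProp.tuple]
      rw [F.map_pair hP hQ hc, PreFunctor.map_tuple]

include hc hd in
theorem PreFunctor.map_ofRen {m n : ℕ} (r : Ren m n) : F.map (hP.ofRen r) = hQ.ofRen r := by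
  simp only [PrePropData.IsCartesianProp.ofRen, F.map_tuple hP hQ hc hd, F.map_proj hP hQ hd]

end Map

/-! ## Calculus of substitution words -/

namespace Ren

theorem symm_val (m n : ℕ) (i : Fin (m + n)) :
    (symm m n i).val = if i.val < m then n + i.val else i.val - m := by
  induction i using Fin.addCases with
  | left i => simp [symm]
  | right j => simp [symm]

theorem copy_val (n : ℕ) (i : Fin (n + n)) :
    (copy n i).val = if i.val < n then i.val else i.val - n := by
  induction i using Fin.addCases with
  | left i => simp [copy]
  | right j => rw [copy, Fin.addCases_right]; simp

theorem cast_val {m n m' n' : ℕ} (hm : m = m') (hn : n = n') (r : Ren m n) (i : Fin m') :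
    (cast hm hn r i).val = (r ⟨i.val, by omega⟩).val := rfl

theorem lift_val {m n : ℕ} (r : Ren m n) (i : Fin (m + 1)) :
    (lift r i).val = if h : i.val < m then (r ⟨i.val, h⟩).val else n := by
  induction i using Fin.lastCases with
  | last => simp [lift]
  | cast i => simp [lift]

/-- The permutation that moves the first `n` inputs behind the following `a` ones. -/
def unfront (s a n : ℕ) (h : a + n ≤ s) : Ren s s := fun i =>
  ⟨if i.val < n then a + i.val else if i.val < n + a then i.val - n else i.val, by
    split_ifs <;> omega⟩

/-- The permutation that moves the `n` inputs behind the first `a` ones to the front. -/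
def front (s a n : ℕ) (h : a + n ≤ s) : Ren s s := fun i =>
  ⟨if i.val < a then n + i.val else if i.val < a + n then i.val - a else i.val, by
    split_ifs <;> omega⟩

theorem unfront_val (s a n : ℕ) (h : a + n ≤ s) (i : Fin s) : (unfront s a n h i).val =
    if i.val < n then a + i.val else if i.val < n + a then i.val - n else i.val := rfl

theorem front_val (s a n : ℕ) (h : a + n ≤ s) (i : Fin s) : (front s a n h i).val =
    if i.val < a then n + i.val else if i.val < a + n then i.val - a else i.val := rfl

theorem unfront_front (s a n : ℕ) (h : a + n ≤ s) : unfront s a n h ∘ front s a n h = id := by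
  funext i
  apply Fin.ext
  simp only [Function.comp, unfront_val, front_val, id]
  split_ifs <;> omega

theorem front_unfront (s a n : ℕ) (h : a + n ≤ s) : front s a n h ∘ unfront s a n h = id := by
  funext i
  apply Fin.ext
  simp only [Function.comp, unfront_val, front_val, id]
  split_ifs <;> omega

end Ren

theorem Word.append_nil {O : PreoperadData.{u}} : ∀ {m n : ℕ} (x : Word O m n), x.append .nil = x
  | _, _, .nil => rfl
  | _, _, .cons x w => by rw [append, append_nil w]

namespace Subs

variable {O : PreoperadData.{u}} {P : ∀ n : ℕ, O.Op n → Prop}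

/-- The class of the one letter word `{a ⊣ g ⊢ b}`. -/
def sub {s t n : ℕ} (a b : ℕ) (g : O.Op n) (hs : s = a + n + b) (ht : t = a + 1 + b) :
    Subs O P s t := mk (.one (.sub a b g hs ht))

theorem sound {m n : ℕ} {x y : Word O m n} (h : Rule O P x y) :
    (mk x : Subs O P m n) = mk y := by
  have := Quot.sound (RuleInContext.intro .nil .nil h)
  rwa [Word.append_nil, Word.append_nil] at this

theorem nil_comp {m n : ℕ} (x : Subs O P m n) : comp (mk .nil) x = x := by
  induction x using Quot.ind; rfl

theorem comp_nil {m n : ℕ} (x : Subs O P m n) : comp x (mk .nil) = x := by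
  induction x using Quot.ind with | _ x
  exact congrArg mk (Word.append_nil x)

theorem comp_assoc {k l m n : ℕ} (x : Subs O P m n) (y : Subs O P l m) (z : Subs O P k l) :
    comp (comp x y) z = comp x (comp y z) := by
  induction x using Quot.ind with | _ x
  induction y using Quot.ind with | _ y
  induction z using Quot.ind with | _ z
  exact congrArg mk (Word.append_assoc x y z)

theorem ind {motive : ∀ {m n : ℕ}, Subs O P m n → Prop}
    (nil : ∀ n, motive (mk .nil : Subs O P n n))
    (ren : ∀ {k m n : ℕ} (r : Ren n k) (x : Subs O P m k), motive x → motive (comp (ren r) x))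
    (sub : ∀ {l s t n : ℕ} (a b : ℕ) (g : O.Op n) (hs : s = a + n + b) (ht : t = a + 1 + b)
      (x : Subs O P l s), motive x → motive (comp (sub a b g hs ht) x))
    {m n : ℕ} (x : Subs O P m n) : motive x := by
  induction x using Quot.ind with | _ w
  induction w with
  | nil => exact nil _
  | cons x w ih =>
    cases x with
    | sub a b g hs ht => exact sub a b g hs ht _ ih
    | ren r => exact ren r _ ih

/-- A variant of the induction principle without auxiliary compositions. -/
theorem ind' {motive : ∀ {m n : ℕ}, Subs O P m n → Prop}
    (nil : ∀ n, motive (mk .nil : Subs O P n n))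
    (ren : ∀ {m n : ℕ} (r : Ren n m), motive (ren r : Subs O P m n))
    (sub : ∀ {s t n : ℕ} (a b : ℕ) (g : O.Op n) (hs : s = a + n + b) (ht : t = a + 1 + b),
      motive (sub a b g hs ht : Subs O P s t))
    (comp : ∀ {l m n : ℕ} (y : Subs O P m n) (x : Subs O P l m), motive y → motive x →
      motive (comp y x)) {m n : ℕ} (x : Subs O P m n) : motive x :=
  ind (motive := motive) nil (fun r x h => comp _ x (ren r) h)
    (fun a b g hs ht x h => comp _ x (sub a b g hs ht) h) x

theorem ren_id (n : ℕ) : (ren id : Subs O P n n) = mk .nil := sound (.unit_ren n)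

theorem ren_comp {k m n : ℕ} (r : Ren n m) (r' : Ren m k) :
    comp (ren r : Subs O P m n) (ren r') = ren (r' ∘ r) := sound (.ren_ren r r')

theorem sub_congr {s t n a b a' b' : ℕ} (g : O.Op n) (ha : a = a') (hb : b = b')
    (hs : s = a + n + b) (ht : t = a + 1 + b) (hs' : s = a' + n + b') (ht' : t = a' + 1 + b') :
    (sub a b g hs ht : Subs O P s t) = sub a' b' g hs' ht' := by
  subst ha hb; rfl

theorem swap_right_eq (a b : ℕ) {n s t : ℕ} (g : O.Op n) (hs : s = a + 1 + n + b)
    (ht : t = a + 1 + 1 + b) (hs₁ : s = a + n + (1 + b)) (ht₁ : t = a + 1 + (1 + b))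
    (ht' : a + (1 + 1) + b = t) (hs' : a + (n + 1) + b = s) (hs'' : a + (1 + n) + b = s) :
    comp (ren (Ren.cast ht' ht' ((Ren.add (id : Ren a a) (Ren.symm 1 1)).add (id : Ren b b))))
        (sub (a + 1) b g hs ht : Subs O P s t) =
      comp (sub a (1 + b) g hs₁ ht₁)
        (ren (Ren.cast hs' hs'' ((Ren.add (id : Ren a a) (Ren.symm n 1)).add (id : Ren b b)))) :=
  sound (Rule.swap_right' a b g rfl rfl ht'.symm hs'.symm hs''.symm _ _ _ _ _ _ rfl rfl)

theorem sub_ren_eq {a a' b b' n n' s t s' t' : ℕ} (g : O.Op n) (r₁ : Ren a a') (r : Ren n n')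
    (r₂ : Ren b b') (hs : s = a + n + b) (ht : t = a + 1 + b) (hs' : s' = a' + n' + b')
    (ht' : t' = a' + 1 + b') :
    comp (sub a b g hs ht : Subs O P s t) (ren (Ren.cast hs.symm hs'.symm ((r₁.add r).add r₂))) =
      comp (ren (Ren.cast ht.symm ht'.symm ((r₁.add (id : Ren 1 1)).add r₂)))
        (sub a' b' (O.ren g r) hs' ht') :=
  sound (Rule.sub_ren' g r₁ r r₂ hs ht hs' ht' _ _ rfl rfl)

theorem front_sub : ∀ (a b : ℕ) {n s t : ℕ} (g : O.Op n) (hs : s = a + n + b) (ht : t = a + 1 + b),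
    comp (ren (Ren.unfront t a 1 (by omega))) (sub a b g hs ht : Subs O P s t) =
      comp (sub 0 (a + b) g (by omega) (by omega)) (ren (Ren.unfront s a n (by omega)))
  | 0, b, n, s, t, g, hs, ht => by
      have e : ∀ s n (h : 0 + n ≤ s), Ren.unfront s 0 n h = id := fun s n h => by
        funext i; apply Fin.ext; simp only [Ren.unfront_val, id]; split_ifs <;> omega
      rw [e, e, ren_id, ren_id, nil_comp, comp_nil]
      exact sub_congr g rfl (by omega) _ _ _ _
  | a + 1, b, n, s, t, g, hs, ht => by
      have e := swap_right_eq (P := P) a b g hs ht (by omega) (by omega) (by omega) (by omega)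
        (by omega)
      have e' : ∀ R R' h1 h2, comp (ren R) (sub (a + 1) b g hs ht : Subs O P s t) =
          comp (sub a (1 + b) g h1 h2) (ren R') →
          Ren.unfront t (a + 1) 1 (by omega) = R ∘ Ren.unfront t a 1 (by omega) →
          Ren.unfront s (a + 1) n (by omega) = R' ∘ Ren.unfront s a n (by omega) →
          comp (ren (Ren.unfront t (a + 1) 1 (by omega))) (sub (a + 1) b g hs ht : Subs O P s t) =
          comp (sub 0 (a + 1 + b) g (by omega) (by omega))
            (ren (Ren.unfront s (a + 1) n (by omega))) := by
        intro R R' h1 h2 e hR hR'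
        rw [hR, hR', ← ren_comp, ← ren_comp, comp_assoc, e, ← comp_assoc, front_sub, comp_assoc]
        congr 1
        exact sub_congr g rfl (by omega) _ _ _ _
      refine e' _ _ _ _ e ?_ ?_ <;> funext i <;> apply Fin.ext <;>
        simp only [Function.comp, Ren.unfront_val, Ren.cast_val, Ren.add_val, Ren.symm_val, id] <;>
        split_ifs <;> omega

theorem front_sub' (a b : ℕ) {n s t : ℕ} (g : O.Op n) (hs : s = a + n + b) (ht : t = a + 1 + b) :
    comp (ren (Ren.front t a 1 (by omega))) (sub 0 (a + b) g (by omega) (by omega)) =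
      comp (sub a b g hs ht : Subs O P s t) (ren (Ren.front s a n (by omega))) := by
  have e := congrArg (fun x => comp (ren (Ren.front t a 1 (by omega)))
    (comp x (ren (Ren.front s a n (by omega))))) (front_sub (P := P) a b g hs ht)
  simp only [comp_assoc, ren_comp, Ren.front_unfront, ren_id, comp_nil] at e
  rw [← comp_assoc, ren_comp, Ren.unfront_front, ren_id, nil_comp] at e
  exact e.symm

variable (hO : ∀ {n : ℕ} (g : O.Op n), O.ren g id = g)
include hO

theorem ren_sub_aux {s t s' t' a b a' b' n : ℕ} (g : O.Op n) (hs : s = a + n + b) (ht : t = a + 1 + b)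
    (hs' : s' = a' + n + b') (ht' : t' = a' + 1 + b') (R : Ren t' t) (R' : Ren s' s)
    (h : ∀ i : Fin t', (R i).val = a ↔ i.val = a')
    (hR' : ∀ j : Fin s', (R' j).val =
      if h : a' ≤ j.val ∧ j.val < a' + n then a + (j.val - a')
      else
        (if (R ⟨if j.val < a' then j.val else j.val - n + 1, by split_ifs <;> omega⟩).val < a then
          (R ⟨if j.val < a' then j.val else j.val - n + 1, by split_ifs <;> omega⟩).val
        else (R ⟨if j.val < a' then j.val else j.val - n + 1, by split_ifs <;> omega⟩).val + n - 1)) :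
    comp (ren R) (sub a b g hs ht : Subs O P s t) =
      comp (sub a' b' g hs' ht') (ren R') := by
  obtain ⟨f, hf⟩ : ∃ f : ℕ → ℕ, ∀ i (hi : i < t'), (R ⟨i, hi⟩).val = f i :=
    ⟨fun i => if hi : i < t' then (R ⟨i, hi⟩).val else 0, fun i hi => by simp only [dif_pos hi]⟩
  have hf' : ∀ i : Fin t', (R i).val = f i.val := fun i => hf _ _
  have hft : ∀ i, i < t' → f i < t := fun i hi => by rw [← hf i hi]; exact Fin.isLt _
  simp only [hf'] at h hR'
  have hfa : f a' = a := (h ⟨a', by omega⟩).2 rfl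
  have hfi : ∀ i, i < t' → f i = a → i = a' := fun i hi => (h ⟨i, hi⟩).1
  obtain ⟨R₀, hR₀⟩ : ∃ R₀ : Ren (a' + b') (a + b), ∀ k x, x ≠ a' → x < t' →
      k.val = (if x < a' then x else x - 1) → (R₀ k).val = if f x < a then f x else f x - 1 := by
    refine ⟨fun k => ⟨if f (if k.val < a' then k.val else k.val + 1) < a then
      f (if k.val < a' then k.val else k.val + 1)
      else f (if k.val < a' then k.val else k.val + 1) - 1, ?_⟩, ?_⟩
    · have h1 := hft (if k.val < a' then k.val else k.val + 1) (by split_ifs <;> omega)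
      have h2 := hfi (if k.val < a' then k.val else k.val + 1) (by split_ifs <;> omega)
      have h3 : (if k.val < a' then k.val else k.val + 1) ≠ a' := by split_ifs <;> omega
      generalize (if k.val < a' then k.val else k.val + 1) = x at *
      split_ifs <;> omega
    · intro k x hx hx' hk
      have : (if k.val < a' then k.val else k.val + 1) = x := by
        rw [hk]; split_ifs <;> omega
      simp only [this]
  have key := sub_ren_eq (P := P) g (id : Ren 0 0) (id : Ren n n) R₀
    (by omega : s' = _) (by omega : t' = _) (by omega : s = _) (by omega : t = _)
  rw [hO] at key
  have e1 : sub a b g hs ht = comp (ren (Ren.front t a 1 (by omega)))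
      (comp (sub 0 (a + b) g (by omega) (by omega) : Subs O P s t)
        (ren (Ren.unfront s a n (by omega)))) := by
    rw [← comp_assoc, front_sub' a b g hs ht, comp_assoc, ren_comp, Ren.unfront_front, ren_id, comp_nil]
  rw [e1, ← comp_assoc, ren_comp]
  have e2 : ∀ S S', comp (sub 0 (a' + b') g (by omega) (by omega) : Subs O P s' t') (ren S) =
      comp (ren S') (sub 0 (a + b) g (by omega) (by omega)) →
      S' ∘ Ren.front t' a' 1 (by omega) = Ren.front t a 1 (by omega) ∘ R →
      Ren.unfront s a n (by omega) ∘ S ∘ Ren.front s' a' n (by omega) = R' →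
      comp (ren (Ren.front t a 1 (by omega) ∘ R))
      (comp (sub 0 (a + b) g (by omega) (by omega) : Subs O P s t)
        (ren (Ren.unfront s a n (by omega)))) =
      comp (sub a' b' g hs' ht') (ren R') := by
    intro S S' e hS' hS
    rw [← hS', ← ren_comp, comp_assoc, ← comp_assoc (ren S'), ← e, comp_assoc, ← comp_assoc,
      front_sub', comp_assoc, ren_comp, ren_comp, ← hS]; rfl
  refine e2 _ _ key ?_ ?_
  · funext i
    apply Fin.ext
    have hl := i.isLt
    have hi' := hfi _ hl
    simp only [Function.comp, Ren.front_val, Ren.cast_val, Ren.add_val, id, hf']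
    rcases lt_trichotomy i.val a' with hi | hi | hi
    · simp only [if_pos hi]
      rw [dif_neg (by omega), hR₀ _ i.val (by omega) hl (by simp only [if_pos hi]; omega)]
      split_ifs <;> omega
    · simp [hi, hfa]
    · have e1 : ¬ i.val < a' := by omega
      have e2 : ¬ i.val < a' + 1 := by omega
      simp only [if_neg e1, if_neg e2]
      rw [dif_neg (by omega), hR₀ _ i.val (by omega) hl (by simp only [if_neg e1])]
      split_ifs <;> omega
  · funext j
    apply Fin.ext
    rw [hR']
    have hl := j.isLt
    simp only [Function.comp, Ren.front_val, Ren.unfront_val, Ren.cast_val, Ren.add_val, id]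
    by_cases hj : j.val < a'
    · have e := hfi j.val (by omega)
      simp only [if_pos hj]
      rw [dif_neg (by omega), dif_neg (by omega),
        hR₀ _ j.val (by omega) (by omega) (by simp only [if_pos hj]; omega)]
      split_ifs <;> omega
    · by_cases hj' : j.val < a' + n
      · simp only [if_neg hj, if_pos hj']
        rw [dif_pos (show a' ≤ j.val ∧ j.val < a' + n by omega),
          dif_pos (show j.val - a' < 0 + n by omega), dif_neg (show ¬ j.val - a' < 0 by omega),
          if_pos (by omega)]
        omega
      · have e := hfi (j.val - n + 1) (by omega)
        simp only [if_neg hj, if_neg hj']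
        have e3 : ¬ j.val - n + 1 < a' := by omega
        rw [dif_neg (by omega), dif_neg (by omega), hR₀ _ (j.val - n + 1) (by omega) (by omega)
          (by simp only [if_neg e3]; omega)]
        split_ifs <;> omega

/-- A renaming for which the position of a substitution has exactly one preimage commutes with
this substitution. -/
theorem ren_sub {s t s' t' a b a' b' n : ℕ} (g : O.Op n) (hs : s = a + n + b) (ht : t = a + 1 + b)
    (hs' : s' = a' + n + b') (ht' : t' = a' + 1 + b') (R : Ren t' t) (R' : Ren s' s)
    (h : ∀ i : Fin t', (R i).val = a ↔ i.val = a')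
    (h₁ : ∀ j : Fin s', a' ≤ j.val → j.val < a' + n → (R' j).val = a + (j.val - a'))
    (h₂ : ∀ (i : Fin t') (j : Fin s'), i.val < a' ∧ j.val = i.val ∨
      a' < i.val ∧ j.val + 1 = i.val + n →
      (R' j).val = if (R i).val < a then (R i).val else (R i).val + n - 1) :
    comp (ren R) (sub a b g hs ht : Subs O P s t) =
      comp (sub a' b' g hs' ht') (ren R') := by
  refine ren_sub_aux hO g hs ht hs' ht' R R' h fun j => ?_
  by_cases hj : a' ≤ j.val ∧ j.val < a' + n
  · rw [dif_pos hj]; exact h₁ j hj.1 hj.2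
  · rw [dif_neg hj]
    refine h₂ ⟨_, _⟩ j ?_
    dsimp only
    split_ifs <;> omega

end Subs

namespace Subs

variable {O : PreoperadData.{u}} {P : ∀ n : ℕ, O.Op n → Prop}

/-! ### The pre-PROP of substitutions -/

theorem ren_congr {m n : ℕ} {r r' : Ren n m} (h : ∀ i, (r i).val = (r' i).val) :
    (ren r : Subs O P m n) = ren r' := by
  rw [show r = r' from funext fun i => Fin.ext (h i)]

theorem cast_sub {s t s' t' n a b : ℕ} (es : s = s') (et : t = t') (g : O.Op n)
    (hs : s = a + n + b) (ht : t = a + 1 + b) :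
    (subsProp O P).cast es et (sub a b g hs ht) = sub a b g (es ▸ hs) (et ▸ ht) := by
  subst es et; rfl

theorem cast_ren {m n m' n' : ℕ} (em : m = m') (en : n = n') (r : Ren n m) :
    (subsProp O P).cast em en (ren r) = ren (Ren.cast en em r) := by
  subst em en; rfl

theorem cast_nil {m m' : ℕ} (em em' : m = m') :
    (subsProp O P).cast em em' (mk .nil) = mk .nil := by
  subst em; rfl

theorem cast_comp {l m n l' m' n' : ℕ} (hl : l = l') (hm : m = m') (hn : n = n')
    (x : Subs O P m n) (y : Subs O P l m) :
    (subsProp O P).cast hl hn (comp x y) =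
      comp ((subsProp O P).cast hm hn x) ((subsProp O P).cast hl hm y) :=
  PrePropData.cast_comp (P := subsProp O P) hl hm hn x y

theorem whiskerL_comp (k : ℕ) {l m n : ℕ} (x : Subs O P m n) (y : Subs O P l m) :
    whiskerL k (comp x y) = comp (whiskerL k x) (whiskerL k y) := by
  induction x using Quot.ind with | _ x
  induction y using Quot.ind with | _ y
  exact congrArg mk (Word.whiskerL_append k x y)

theorem whiskerR_comp (k : ℕ) {l m n : ℕ} (x : Subs O P m n) (y : Subs O P l m) :
    whiskerR (comp x y) k = comp (whiskerR x k) (whiskerR y k) := by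
  induction x using Quot.ind with | _ x
  induction y using Quot.ind with | _ y
  exact congrArg mk (Word.whiskerR_append k x y)

/-- The interchange law for two substitutions. -/
def Interchange {m n m' n' : ℕ} (x : Subs O P m n) (y : Subs O P m' n') : Prop :=
  comp (whiskerR x n') (whiskerL m y) = comp (whiskerL n y) (whiskerR x m')

theorem Interchange.comp_left {m n k m' n' : ℕ} {x : Subs O P m n} {z : Subs O P k m}
    {y : Subs O P m' n'} (hx : Interchange x y) (hz : Interchange z y) :
    Interchange (comp x z) y := by
  unfold Interchange at *
  rw [whiskerR_comp, whiskerR_comp, comp_assoc, hz, ← comp_assoc, hx, comp_assoc]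

theorem Interchange.comp_right {m n k m' n' : ℕ} {x : Subs O P m' n'} {y : Subs O P m n}
    {z : Subs O P k m} (hy : Interchange x y) (hz : Interchange x z) :
    Interchange x (comp y z) := by
  unfold Interchange at *
  rw [whiskerL_comp, whiskerL_comp, ← comp_assoc, hy, comp_assoc, hz, comp_assoc]

theorem interchange_nil_left {m' n' : ℕ} (m : ℕ) (y : Subs O P m' n') :
    Interchange (mk .nil : Subs O P m m) y :=
  (nil_comp _).trans (comp_nil _).symm

theorem interchange_nil_right {m' n' : ℕ} (m : ℕ) (y : Subs O P m' n') :
    Interchange y (mk .nil : Subs O P m m) :=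
  (comp_nil _).trans (nil_comp _).symm

theorem interchange_ren_ren {m n m' n' : ℕ} (r : Ren n m) (r' : Ren n' m') :
    Interchange (ren r : Subs O P m n) (ren r') := by
  refine (ren_comp _ _).trans (.trans ?_ (ren_comp _ _).symm)
  rw [← Ren.add_comp, ← Ren.add_comp]; rfl

theorem interchange_sub_sub {s t s' t' a b n a' b' n' : ℕ} (g : O.Op n) (g' : O.Op n')
    (hP : P _ g ∨ P _ g') (hs : s = a + n + b) (ht : t = a + 1 + b) (hs' : s' = a' + n' + b')
    (ht' : t' = a' + 1 + b') :
    Interchange (sub a b g hs ht : Subs O P s t) (sub a' b' g' hs' ht') :=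
  sound (Rule.central' a (b + a') b' g g' hP (by omega) (by omega) (by omega) (by omega)
    _ _ _ _ _ _ _ _)

section

variable (hO : ∀ {n : ℕ} (g : O.Op n), O.ren g id = g)
include hO

theorem interchange_ren_left {m n m' n' : ℕ} (r : Ren n m) (y : Subs O P m' n') :
    Interchange (ren r) y := by
  induction y using ind' with
  | nil k => exact interchange_nil_right _ _
  | ren r' => exact interchange_ren_ren r r'
  | comp y x hy hx => exact hy.comp_right hx
  | @sub s t k a b g hs ht =>
    refine ren_sub hO g (a' := n + a) (b' := b) _ _ (by omega) (by omega) _ _ (fun i => ?_)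
      (fun j h1 h2 => ?_) (fun i j h => ?_)
    · rw [Ren.add_val]
      split_ifs
      · omega
      · simp only [id]; omega
    · rw [Ren.add_val, dif_neg (by omega)]; simp only [id]; omega
    · rw [Ren.add_val, Ren.add_val]
      by_cases h1 : i.val < n
      · have h2 : j.val < n := by omega
        have h3 : (⟨j.val, h2⟩ : Fin n) = ⟨i.val, h1⟩ := Fin.ext (by dsimp only; omega)
        have := (r ⟨i.val, h1⟩).isLt
        rw [dif_pos h1, dif_pos h2, if_pos (by omega), h3]
      · have h2 : ¬ j.val < n := by omega
        rw [dif_neg h1, dif_neg h2]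
        simp only [id]
        split_ifs <;> omega

theorem interchange_ren_right {m n m' n' : ℕ} (y : Subs O P m' n') (r : Ren n m) :
    Interchange y (ren r) := by
  induction y using ind' with
  | nil k => exact interchange_nil_left _ _
  | ren r' => exact interchange_ren_ren r' r
  | comp y x hy hx => exact hy.comp_left hx
  | @sub s t k a b g hs ht =>
    unfold Interchange
    symm
    refine ren_sub hO g (a' := a) (b' := b + n) _ _ (by omega) (by omega) _ _ (fun i => ?_)
      (fun j h1 h2 => ?_) (fun i j h => ?_)
    · rw [Ren.add_val]
      split_ifs
      · simp only [id]
      · omega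
    · rw [Ren.add_val, dif_pos (by omega)]; simp only [id]; omega
    · rw [Ren.add_val, Ren.add_val]
      by_cases h1 : i.val < t
      · have h2 : j.val < s := by omega
        rw [dif_pos h1, dif_pos h2]
        simp only [id]
        split_ifs <;> omega
      · have h2 : ¬ j.val < s := by omega
        have h3 : (⟨j.val - s, by omega⟩ : Fin n) = ⟨i.val - t, by omega⟩ :=
          Fin.ext (by dsimp only; omega)
        rw [dif_neg h1, dif_neg h2, if_neg (by omega), h3]
        omega

theorem symm_natural {m n : ℕ} (x : Subs O P m n) (k : ℕ) :
    comp (ren (Ren.symm k n)) (whiskerR x k) = comp (whiskerL k x) (ren (Ren.symm k m)) := by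
  induction x using ind' with
  | nil k => exact (comp_nil _).trans (nil_comp _).symm
  | comp y x hy hx =>
    rw [whiskerR_comp, whiskerL_comp, ← comp_assoc, hy, comp_assoc, hx, comp_assoc]
  | @ren m n r =>
    refine (ren_comp _ _).trans (.trans (ren_congr fun i => ?_) (ren_comp _ _).symm)
    simp only [Function.comp]
    rw [Ren.symm_val, Ren.add_val, Ren.add_val]
    by_cases h : i.val < k
    · have h1 : ¬ (Ren.symm k n i).val < n := by rw [Ren.symm_val, if_pos h]; omega
      have h2 : (Ren.symm k n i).val = n + i.val := by rw [Ren.symm_val, if_pos h]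
      rw [dif_pos h, dif_neg h1]
      simp only [id, if_pos h]
      omega
    · have h1 : (Ren.symm k n i).val = i.val - k := by rw [Ren.symm_val, if_neg h]
      have h2 := (r ⟨i.val - k, by omega⟩).isLt
      have h3 : (⟨(Ren.symm k n i).val, by omega⟩ : Fin n) = ⟨i.val - k, by omega⟩ := Fin.ext h1
      rw [dif_neg h, dif_pos (by omega), if_neg (by omega), h3]
      omega
  | sub a b g hs ht =>
    refine ren_sub hO g (a' := k + a) (b' := b) _ _ _ _ _ _ (fun i => ?_) (fun j h1 h2 => ?_)
      (fun i j h => ?_) <;> simp only [Ren.symm_val] <;> split_ifs <;> omega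

theorem symm_natural' {m n : ℕ} (x : Subs O P m n) (k : ℕ) :
    comp (ren (Ren.symm n k)) (whiskerL k x) = comp (whiskerR x k) (ren (Ren.symm m k)) := by
  have e : ∀ m n, (comp (ren (Ren.symm n m)) (ren (Ren.symm m n)) : Subs O P (n + m) (n + m)) =
      mk .nil := fun m n => by
    rw [ren_comp, ← ren_id]
    refine ren_congr fun i => ?_
    simp only [Function.comp, Ren.symm_val, id]
    split_ifs <;> omega
  have h := congrArg (fun z => comp (ren (Ren.symm n k)) (comp z (ren (Ren.symm m k))))
    (symm_natural hO x k)
  simp only [comp_assoc, e, comp_nil] at h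
  rw [← comp_assoc, e, nil_comp] at h
  exact h.symm

/-- Substitution words form a pre-PROP. -/
theorem isPreProp : (subsProp O P).IsPreProp where
  id_comp := nil_comp
  comp_id := comp_nil
  assoc := comp_assoc
  whiskerL_id _ _ := rfl
  whiskerL_comp k _ _ _ := whiskerL_comp k
  whiskerR_id _ _ := rfl
  whiskerR_comp k _ _ _ := whiskerR_comp k
  whiskerL_zero f := by
    change (subsProp O P).cast _ _ (whiskerL 0 f) = f
    induction f using ind' with
    | nil => exact cast_nil _ _
    | ren r =>
      refine (cast_ren _ _ _).trans (ren_congr fun i => ?_)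
      simp [Ren.cast_val, Ren.add_val]
    | sub a b g hs ht => exact (cast_sub _ _ _ _ _).trans (sub_congr _ (by omega) rfl _ _ _ _)
    | comp y x hy hx => rw [whiskerL_comp, cast_comp _ (Nat.zero_add _), hy, hx]
  whiskerR_zero f := by
    change whiskerR f 0 = f
    induction f using ind' with
    | nil => rfl
    | ren r =>
      refine ren_congr fun i => ?_
      simp [Ren.add_val]
    | sub a b g hs ht => rfl
    | comp y x hy hx => rw [whiskerR_comp, hy, hx]
  whiskerL_add k l _ _ f := by
    change (subsProp O P).cast _ _ (whiskerL (k + l) f) = whiskerL k (whiskerL l f)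
    induction f using ind' with
    | nil => exact cast_nil _ _
    | ren r =>
      refine (cast_ren _ _ _).trans (ren_congr fun i => ?_)
      simp only [Ren.cast_val, Ren.add_val, id]
      split_ifs <;> first | omega | simp only [Nat.sub_sub, Nat.add_assoc]
    | sub a b g hs ht => exact (cast_sub _ _ _ _ _).trans (sub_congr _ (by omega) rfl _ _ _ _)
    | comp y x hy hx =>
      rw [whiskerL_comp, whiskerL_comp, whiskerL_comp, cast_comp _ (Nat.add_assoc _ _ _), hy, hx]
  whiskerR_add k l _ _ f := by
    change (subsProp O P).cast _ _ (whiskerR (whiskerR f k) l) = whiskerR f (k + l)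
    induction f using ind' with
    | nil => exact cast_nil _ _
    | ren r =>
      refine (cast_ren _ _ _).trans (ren_congr fun i => ?_)
      simp only [Ren.cast_val, Ren.add_val, id]
      split_ifs <;> omega
    | sub a b g hs ht => exact (cast_sub _ _ _ _ _).trans (sub_congr _ rfl (by omega) _ _ _ _)
    | comp y x hy hx =>
      rw [whiskerR_comp, whiskerR_comp, whiskerR_comp, cast_comp _ (Nat.add_assoc _ _ _), hy, hx]
  whiskerL_whiskerR k l _ _ f := by
    change (subsProp O P).cast _ _ (whiskerR (whiskerL k f) l) = whiskerL k (whiskerR f l)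
    induction f using ind' with
    | nil => exact cast_nil _ _
    | ren r =>
      refine (cast_ren _ _ _).trans (ren_congr fun i => ?_)
      simp only [Ren.cast_val, Ren.add_val, id]
      split_ifs <;> omega
    | sub a b g hs ht => exact cast_sub _ _ _ _ _
    | comp y x hy hx =>
      rw [whiskerR_comp, whiskerL_comp, whiskerR_comp, whiskerL_comp,
        cast_comp _ (Nat.add_assoc _ _ _), hy, hx]
  symm_natural := symm_natural hO
  symm_natural' := symm_natural' hO
  symm_symm m n := by
    refine (ren_comp _ _).trans (.trans (ren_congr fun i => ?_) (ren_id _))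
    simp only [Function.comp, Ren.symm_val, id]
    split_ifs <;> omega
  symm_add m n k := by
    refine .symm (.trans (congrArg _ (.trans (congrArg _ (cast_ren _ _ _)) (ren_comp _ _))) ?_)
    refine (cast_ren _ _ _).trans (ren_congr fun i => ?_)
    simp only [Function.comp, Ren.cast_val, Ren.symm_val, Ren.add_val, id]
    split_ifs <;> omega
  symm_central _ _ _ _ g := ⟨interchange_ren_left hO _ g, interchange_ren_right hO g _⟩

end

/-! ### The cartesian PROP of substitutions -/

section

theorem interchange_all (hO : ∀ {n : ℕ} (g : O.Op n), O.ren g id = g) {m n m' n' : ℕ}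
    (x : Subs O (fun _ _ => True) m n) (y : Subs O (fun _ _ => True) m' n') :
    Interchange x y := by
  induction x using ind' with
  | nil => exact interchange_nil_left _ _
  | ren r => exact interchange_ren_left hO r y
  | comp z x hz hx => exact hz.comp_left hx
  | sub a b g hs ht =>
    induction y using ind' with
    | nil => exact interchange_nil_right _ _
    | ren r => exact interchange_ren_right hO _ r
    | comp z x hz hx => exact hz.comp_right hx
    | sub a' b' g' hs' ht' => exact interchange_sub_sub g g' (.inl trivial) _ _ _ _

theorem ren_discard_sub {s t a b n : ℕ} (g : O.Op n) (hP : P _ g) (hs : s = a + n + b)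
    (ht : t = a + 1 + b) :
    comp (ren (Ren.discard t)) (sub a b g hs ht : Subs O P s t) = ren (Ren.discard s) := by
  have e := sound (Rule.discard' a b g hP hs ht (by omega : a + b = _) _ _ rfl rfl)
  have e1 : (ren (Ren.discard t) : Subs O P t 0) = comp (ren (Ren.discard (a + b))) (ren
      (Ren.cast (by omega : a + 0 + b = a + b) ht.symm
        ((Ren.add (id : Ren a a) (Ren.discard 1)).add (id : Ren b b)))) := by
    rw [ren_comp]; exact ren_congr fun i => i.elim0
  rw [e1, comp_assoc]
  refine (congrArg _ e).trans ((ren_comp _ _).trans (ren_congr fun i => i.elim0))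

theorem ren_copy_sub (hO : ∀ {n : ℕ} (g : O.Op n), O.ren g id = g) {s t a b n : ℕ} (g : O.Op n)
    (hP : P _ g) (hs : s = a + n + b) (ht : t = a + 1 + b) :
    comp (ren (Ren.copy t)) (sub a b g hs ht : Subs O P s t) =
      comp (comp (whiskerR (sub a b g hs ht) t) (whiskerL s (sub a b g hs ht)))
        (ren (Ren.copy s)) := by
  have e : comp (ren (Ren.cast (by omega : a + (1 + 1) + b = t + 1) ht.symm
        ((Ren.add (id : Ren a a) (Ren.copy 1)).add (id : Ren b b)))) (sub a b g hs ht) =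
      comp (sub a (1 + b) g (by omega : s + 1 = _) (by omega : t + 1 = _))
        (comp (sub (a + n) b g (by omega : s + n = _) (by omega))
          (ren (Ren.cast (by omega : a + (n + n) + b = s + n) hs.symm
            ((Ren.add (id : Ren a a) (Ren.copy n)).add (id : Ren b b)))) : Subs O P s (s + 1)) :=
    sound (Rule.copy' a b g hP rfl rfl hs ht (by omega) (by omega) _ _ _ _ _ _ rfl rfl)
  obtain ⟨R, hR⟩ : ∃ R : Ren (t + t) (t + 1), ∀ i : Fin (t + t),
      (i.val ≤ a ∧ (R i).val = i.val) ∨ (a < i.val ∧ i.val < t ∧ (R i).val = i.val + 1) ∨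
      (t ≤ i.val ∧ i.val < t + a ∧ (R i).val = i.val - t) ∨
      (t + a ≤ i.val ∧ (R i).val = i.val - t + 1) :=
    ⟨fun i => ⟨if i.val ≤ a then i.val else if i.val < t then i.val + 1
      else if i.val < t + a then i.val - t else i.val - t + 1, by split_ifs <;> omega⟩,
      fun i => by dsimp only; split_ifs <;> omega⟩
  obtain ⟨R₁, hR₁⟩ : ∃ R₁ : Ren (s + t) (s + 1), ∀ i : Fin (s + t),
      (i.val < a + n ∧ (R₁ i).val = i.val) ∨ (a + n ≤ i.val ∧ i.val < s ∧ (R₁ i).val = i.val + 1) ∨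
      (s ≤ i.val ∧ i.val < s + a ∧ (R₁ i).val = i.val - s) ∨
      (i.val = s + a ∧ (R₁ i).val = a + n) ∨
      (s + a < i.val ∧ (R₁ i).val = i.val - s + n) :=
    ⟨fun i => ⟨if i.val < a + n then i.val else if i.val < s then i.val + 1
      else if i.val < s + a then i.val - s else if i.val = s + a then a + n else i.val - s + n, by
      split_ifs <;> omega⟩, fun i => by dsimp only; split_ifs <;> omega⟩
  obtain ⟨R₂, hR₂⟩ : ∃ R₂ : Ren (s + s) (s + n), ∀ i : Fin (s + s),
      (i.val < a + n ∧ (R₂ i).val = i.val) ∨ (a + n ≤ i.val ∧ i.val < s ∧ (R₂ i).val = i.val + n) ∨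
      (s ≤ i.val ∧ i.val < s + a ∧ (R₂ i).val = i.val - s) ∨
      (s + a ≤ i.val ∧ (R₂ i).val = i.val - s + n) :=
    ⟨fun i => ⟨if i.val < a + n then i.val else if i.val < s then i.val + n
      else if i.val < s + a then i.val - s else i.val - s + n, by split_ifs <;> omega⟩,
      fun i => by dsimp only; split_ifs <;> omega⟩
  have e1 : (ren (Ren.copy t) : Subs O P t (t + t)) = comp (ren R) (ren
      (Ren.cast (by omega : a + (1 + 1) + b = t + 1) ht.symm
        ((Ren.add (id : Ren a a) (Ren.copy 1)).add (id : Ren b b)))) := by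
    rw [ren_comp]
    refine ren_congr fun i => ?_
    simp only [Function.comp, Ren.cast_val, Ren.copy_val, Ren.add_val, id]
    have := hR i
    split_ifs <;> omega
  have e2 : comp (ren R) (sub a (1 + b) g (by omega : s + 1 = _) (by omega) : Subs O P _ _) =
      comp (whiskerR (sub a b g hs ht) t) (ren R₁) := by
    refine ren_sub hO g _ _ _ _ _ _ (fun i => by have := hR i; omega)
      (fun j _ _ => by have := hR₁ j; omega) (fun i j _ => ?_)
    have h1 := hR i
    have h2 := hR₁ j
    split_ifs <;> omega
  have e3 : comp (ren R₁) (sub (a + n) b g (by omega : s + n = _) (by omega) : Subs O P _ _) =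
      comp (whiskerL s (sub a b g hs ht)) (ren R₂) := by
    refine ren_sub hO g _ _ _ _ _ _ (fun i => by have := hR₁ i; omega)
      (fun j _ _ => by have := hR₂ j; omega) (fun i j _ => ?_)
    have h1 := hR₁ i
    have h2 := hR₂ j
    split_ifs <;> omega
  rw [e1, comp_assoc, e, ← comp_assoc, e2, comp_assoc, ← comp_assoc (ren R₁), e3, comp_assoc, comp_assoc, ren_comp]
  congr 2
  refine ren_congr fun i => ?_
  simp only [Function.comp, Ren.cast_val, Ren.copy_val, Ren.add_val, id]
  have := hR₂ i
  split_ifs <;> omega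

/-- Substitution words on values form a cartesian PROP. -/
theorem isCartesianProp (hO : ∀ {n : ℕ} (g : O.Op n), O.ren g id = g) :
    (subsProp O (fun _ _ => True)).IsCartesianProp (fun n => ren (Ren.copy n))
      (fun n => ren (Ren.discard n)) where
  toIsPreProp := isPreProp hO
  central f _ _ g := ⟨interchange_all hO f g, interchange_all hO g f⟩
  copy_natural {m n} f := by
    change comp (ren (Ren.copy n)) f =
      comp (comp (whiskerR f n) (whiskerL m f)) (ren (Ren.copy m))
    induction f using ind' with
    | nil => exact (comp_nil _).trans (nil_comp _).symm
    | @ren m n r =>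
      refine (ren_comp _ _).trans (.trans ?_ (congrArg (comp · _) (ren_comp _ _)).symm)
      rw [← Ren.add_comp]
      refine .trans (ren_congr fun i => ?_) (ren_comp _ _).symm
      simp only [Function.comp, Ren.copy_val, Ren.add_val, id]
      by_cases h : i.val < n
      · rw [show Ren.copy n i = ⟨i.val, h⟩ from Fin.ext (by rw [Ren.copy_val, if_pos h]), dif_pos h,
          if_pos (Fin.isLt _)]
      · rw [show Ren.copy n i = ⟨i.val - n, by omega⟩ from
          Fin.ext (by rw [Ren.copy_val, if_neg h]), dif_neg h, if_neg (by omega)]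
        omega
    | sub a b g hs ht => exact ren_copy_sub hO g trivial _ _
    | @comp l m n y x hy hx =>
      have i := interchange_all hO x y
      unfold Interchange at i
      rw [← comp_assoc, hy, comp_assoc, hx, whiskerR_comp, whiskerL_comp]
      simp only [comp_assoc]
      rw [← comp_assoc (whiskerL m y), ← i]
      simp only [comp_assoc]
  discard_natural {m n} f := by
    change comp (ren (Ren.discard n)) f = ren (Ren.discard m)
    induction f using ind' with
    | nil => exact comp_nil _
    | ren r => exact (ren_comp _ _).trans (ren_congr fun i => i.elim0)
    | sub a b g hs ht => exact ren_discard_sub g trivial _ _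
    | comp y x hy hx => rw [← comp_assoc, hy, hx]
  copy_assoc n := by
    refine .trans (.trans (congrArg _ (ren_comp _ _)) (cast_ren _ _ _))
      (.trans (ren_congr fun i => ?_) (ren_comp _ _).symm)
    simp only [Function.comp, Ren.cast_val, Ren.copy_val, Ren.add_val, id]
    split_ifs <;> omega
  copy_comm n := by
    refine (ren_comp _ _).trans (ren_congr fun i => ?_)
    simp only [Function.comp, Ren.symm_val, Ren.copy_val]
    split_ifs <;> omega
  discard_copy n := by
    refine .trans (congrArg _ (ren_comp _ _)) (.trans (cast_ren _ _ _)
      (.trans (ren_congr fun i => ?_) (ren_id _)))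
    simp only [Function.comp, Ren.cast_val, Ren.copy_val, Ren.add_val, id]
    split_ifs <;> omega
  copy_discard n := by
    refine (ren_comp _ _).trans (.trans (ren_congr fun i => ?_) (ren_id _))
    simp only [Function.comp, Ren.copy_val, Ren.add_val, id]
    split_ifs <;> omega
  copy_add m n := by
    refine .symm (.trans (congrArg₂ _ (cast_ren _ _ _) (ren_comp _ _))
      ((ren_comp _ _).trans (ren_congr fun i => ?_)))
    simp only [Function.comp, Ren.cast_val, Ren.copy_val, Ren.add_val, Ren.symm_val, id]
    split_ifs <;> omega
  discard_add m n := by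
    refine .symm ((ren_comp _ _).trans (ren_congr fun i => i.elim0))

end

end Subs

/-! ## Functors out of the pre-PROP of substitutions -/

theorem Subs.sub_eq_wh {O : PreoperadData.{u}} {P : ∀ n : ℕ, O.Op n → Prop} {s t n : ℕ} (a b : ℕ)
    (g : O.Op n) (hs : s = a + n + b) (ht : t = a + 1 + b) :
    (Subs.sub a b g hs ht : Subs O P s t) = (subsProp O P).wh a b (Subs.single g) hs ht :=
  .trans (Subs.sub_congr g rfl (Nat.zero_add b).symm _ _ _ _) (Subs.cast_sub _ _ _ _ _).symm

/-- The data of an interpretation of operations and renamings in a pre-PROP, subject to the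
identities that make it respect the rules for substitution words. -/
structure WordInterp (O : PreoperadData.{u}) (P : ∀ n : ℕ, O.Op n → Prop)
    (Q : PrePropData.{w}) where
  op : ∀ {n : ℕ}, O.Op n → Q.Hom n 1
  ren : ∀ {m n : ℕ}, Ren m n → Q.Hom n m
  op_one : op O.one = Q.id 1
  op_sub : ∀ {t s n : ℕ} (a b : ℕ) (f : O.Op t) (g : O.Op n) (ht : t = a + 1 + b)
    (hs : s = a + n + b), op (O.sub a b f g ht hs) = Q.comp (op f) (Q.wh a b (op g) hs ht)
  op_ren : ∀ {m n : ℕ} (f : O.Op m) (r : Ren m n), op (O.ren f r) = Q.comp (op f) (ren r)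
  ren_id : ∀ n, ren (id : Ren n n) = Q.id n
  ren_comp : ∀ {k m n : ℕ} (r : Ren m n) (s : Ren n k), Q.comp (ren r) (ren s) = ren (s ∘ r)
  ren_whiskerL : ∀ {m n : ℕ} (r : Ren m n) (k : ℕ),
    Q.whiskerL k (ren r) = ren (Ren.add (id : Ren k k) r)
  ren_whiskerR : ∀ {m n : ℕ} (r : Ren m n) (k : ℕ),
    Q.whiskerR (ren r) k = ren (Ren.add r (id : Ren k k))
  ren_symm : ∀ m n : ℕ, ren (Ren.symm n m) = Q.symm m n
  ren_central : ∀ {m n : ℕ} (r : Ren m n), Q.IsCentral (ren r)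
  op_central : ∀ {n : ℕ} (g : O.Op n), P n g → Q.IsCentral (op g)
  op_discard : ∀ {n : ℕ} (g : O.Op n), P n g →
    Q.comp (ren (Ren.discard 1)) (op g) = ren (Ren.discard n)
  op_copy : ∀ {n : ℕ} (g : O.Op n), P n g →
    Q.comp (ren (Ren.copy 1)) (op g) = Q.comp (Q.tensor (op g) (op g)) (ren (Ren.copy n))

namespace WordInterp

variable {O : PreoperadData.{u}} {P : ∀ n : ℕ, O.Op n → Prop} {Q : PrePropData.{w}}
  (I : WordInterp O P Q)

/-- The interpretation of a letter. -/
def step : {m n : ℕ} → Step O m n → Q.Hom m n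
  | _, _, .sub a b g hs ht => Q.wh a b (I.op g) hs ht
  | _, _, .ren r => I.ren r

/-- The interpretation of a word. -/
def word {m : ℕ} : {n : ℕ} → Word O m n → Q.Hom m n
  | _, .nil => Q.id m
  | _, .cons x w => Q.comp (I.step x) (word w)

theorem wh_ren {m n s t a b : ℕ} (r : Ren m n) (hs : s = a + n + b) (ht : t = a + m + b) :
    Q.wh a b (I.ren r) hs ht = I.ren (Ren.cast ht.symm hs.symm
      ((Ren.add (id : Ren a a) r).add (id : Ren b b))) := by
  subst hs ht
  change Q.whiskerR (Q.whiskerL a (I.ren r)) b = I.ren _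
  rw [I.ren_whiskerL, I.ren_whiskerR]; rfl

theorem ren_whisker {m n a b : ℕ} (r : Ren m n) :
    I.ren ((Ren.add (id : Ren a a) r).add (id : Ren b b)) = Q.wh a b (I.ren r) rfl rfl :=
  (I.wh_ren r rfl rfl).symm

theorem ren_symm_whisker {m n a b : ℕ} :
    I.ren ((Ren.add (id : Ren a a) (Ren.symm m n)).add (id : Ren b b)) =
      Q.wh a b (Q.symm n m) rfl rfl := by
  rw [I.ren_whisker, I.ren_symm]

theorem ren_add₃ {a a' b b' k : ℕ} (r₁ : Ren a a') (r₂ : Ren b b') :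
    I.ren ((r₁.add (id : Ren k k)).add r₂) =
      Q.comp (Q.wh 0 (k + b) (I.ren r₁) (by omega : a' + k + b = _) (by omega))
        (Q.wh (a' + k) 0 (I.ren r₂) rfl rfl) := by
  rw [I.wh_ren, I.wh_ren, I.ren_comp]
  congr 1
  funext i
  apply Fin.ext
  have e1 : ∀ (j : Fin (a + k + b)) (h1 h2), (Ren.cast h1 h2 ((Ren.add (id : Ren 0 0) r₁).add
      (id : Ren (k + b) (k + b))) j : Fin (a' + k + b)).val =
      if h : j.val < a then (r₁ ⟨j.val, h⟩).val else a' + (j.val - a) := by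
    intro j h1 h2
    simp [Ren.cast_val, Ren.add_val]
  have e2 : ∀ (j : Fin (a' + k + b)) (h1 h2), (Ren.cast h1 h2 ((Ren.add
      (id : Ren (a' + k) (a' + k)) r₂).add (id : Ren 0 0)) j : Fin (a' + k + b')).val =
      if h : j.val < a' + k then j.val else a' + k + (r₂ ⟨j.val - (a' + k), by omega⟩).val := by
    intro j h1 h2
    simp [Ren.cast_val, Ren.add_val]
  rw [Function.comp, e2, Ren.add_val]
  have e := e1 i (by omega) (by omega)
  by_cases h : i.val < a
  · have h' := (r₁ ⟨i.val, h⟩).isLt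
    rw [dif_pos h] at e
    rw [dif_pos (by omega), Ren.add_val, dif_pos h, dif_pos (by omega), e]
  · rw [dif_neg h] at e
    by_cases h' : i.val < a + k
    · rw [dif_pos h', Ren.add_val, dif_neg h, dif_pos (by omega), e]; rfl
    · rw [dif_neg h', dif_neg (by omega)]
      exact congrArg (fun z => a' + k + (r₂ z).val) (Fin.ext (by dsimp only; omega))

variable (hQ : Q.IsPreProp)
include hQ

theorem word_append : ∀ {l m n : ℕ} (x : Word O m n) (y : Word O l m),
    I.word (x.append y) = Q.comp (I.word x) (I.word y)
  | _, _, _, .nil, y => (hQ.id_comp _).symm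
  | _, _, _, .cons x w, y => by
      rw [Word.append, word, word, word_append w, hQ.assoc]

theorem word_one {m n : ℕ} (x : Step O m n) : I.word (.one x) = I.step x := hQ.comp_id _

theorem word_two {k m n : ℕ} (x : Step O m n) (y : Step O k m) :
    I.word (.two x y) = Q.comp (I.step x) (I.step y) :=
  congrArg _ (hQ.comp_id _)

theorem word_three {k l m n : ℕ} (x : Step O m n) (y : Step O l m) (z : Step O k l) :
    I.word (.three x y z) = Q.comp (I.step x) (Q.comp (I.step y) (I.step z)) :=
  congrArg _ (I.word_two hQ _ _)

theorem word_rule {m n : ℕ} {x y : Word O m n} (h : Rule O P x y) : I.word x = I.word y := by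
  cases h with
  | unit_sub a b =>
    rw [I.word_one hQ, step, I.op_one, hQ.wh_id]; rfl
  | unit_ren n => rw [I.word_one hQ, step, I.ren_id]; rfl
  | assoc a b c d g h hn =>
    rw [I.word_one hQ, I.word_two hQ, step, step, step, I.op_sub, ← hQ.wh_comp, hQ.wh_wh]
    all_goals rfl
  | ren_ren r r' => rw [I.word_one hQ, I.word_two hQ, step, step, step, I.ren_comp]
  | @sub_ren a a' b b' n n' g r₁ r r₂ =>
    rw [I.word_two hQ, I.word_two hQ, step, step, step, step, I.op_ren]
    have e : I.ren ((r₁.add r).add r₂) = Q.comp (Q.wh a b (I.ren r) rfl rfl)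
        (I.ren ((r₁.add (id : Ren n' n')).add r₂)) := by
      rw [I.wh_ren, I.ren_comp]
      change _ = I.ren (_ ∘ Ren.add (Ren.add id r) id)
      rw [← Ren.add_comp, ← Ren.add_comp]; rfl
    have i1 := hQ.interchange (I.ren r₁) (Q.comp (I.op g) (I.ren r)) (.inl (I.ren_central r₁))
      (a := 0) (b := b) (p := 0) (b₁ := 1 + b) (a₂ := a') (a₃ := a) (b₃ := n' + b)
      (s := a' + n' + b) (x := a' + 1 + b) (y := a + n' + b) (t := a + 1 + b) (by omega) (by omega)
      (by omega) (by omega) (by omega) (by omega) rfl rfl rfl rfl (by omega) (by omega)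
    have i2 := hQ.interchange (Q.comp (I.op g) (I.ren r)) (I.ren r₂) (.inr (I.ren_central r₂))
      (a := a') (b := 0) (p := 0) (b₁ := b) (a₂ := a' + n') (a₃ := a' + 1) (b₃ := b')
      (s := a' + n' + b') (x := a' + n' + b) (y := a' + 1 + b') (t := a' + 1 + b) (by omega)
      (by omega) (by omega) (by omega) rfl rfl rfl rfl rfl rfl rfl rfl
    rw [e, ← hQ.assoc, hQ.wh_comp, I.ren_add₃, I.ren_add₃, ← hQ.assoc, ← i1, hQ.assoc, i2,
      hQ.assoc]
  | swap_left a b g =>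
    rw [I.word_two hQ, I.word_two hQ, step, step, step, step, I.ren_symm_whisker,
      I.ren_symm_whisker]
    exact hQ.wh_symm_natural (I.op g) _ _ _ _
  | swap_right a b g =>
    rw [I.word_two hQ, I.word_two hQ, step, step, step, step, I.ren_symm_whisker,
      I.ren_symm_whisker]
    exact hQ.wh_symm_natural' (I.op g) _ _ _ _
  | central a m b g₁ g₂ hP =>
    rw [I.word_two hQ, I.word_two hQ, step, step, step, step]
    exact hQ.interchange _ _ (hP.imp (I.op_central _) (I.op_central _)) rfl (by omega) (by omega)
      rfl _ _ _ _ _ _ _ _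
  | discard a b g hP =>
    rw [I.word_one hQ, I.word_two hQ, step, step, step, I.ren_whisker, I.ren_whisker, hQ.wh_comp,
      I.op_discard g hP]
  | @copy a b n g hP =>
    rw [I.word_two hQ, I.word_three hQ, step, step, step, step, step, I.ren_whisker, I.ren_whisker,
      hQ.wh_comp, I.op_copy g hP, PrePropData.tensor, hQ.whiskerR_eq_wh, hQ.whiskerL_eq_wh,
      ← hQ.wh_comp _ _ _ rfl,
      ← hQ.wh_comp _ _ _ (by omega : a + n + (1 + b) = a + (n + 1) + b), hQ.wh_wh _ _ _ _ _ rfl rfl,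
      hQ.wh_wh _ _ _ _ _ rfl (Nat.zero_add b).symm, hQ.assoc]
    rfl

/-- The functor that an interpretation induces. -/
def functor : PreFunctor (subsProp O P) Q where
  map x := Quot.lift I.word (by
    rintro _ _ ⟨u, w, h⟩
    rw [I.word_append hQ, I.word_append hQ, I.word_append hQ, I.word_append hQ,
      I.word_rule hQ h]) x
  map_id _ := rfl
  map_comp g f := by
    induction f using Quot.ind with | _ x
    induction g using Quot.ind with | _ y
    exact I.word_append hQ y x
  map_whiskerL k m n f := by
    induction f using Quot.ind with | _ x
    change I.word (x.whiskerL k) = Q.whiskerL k (I.word x)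
    induction x with
    | nil => exact (hQ.whiskerL_id k _).symm
    | cons x w ih =>
      rw [Word.whiskerL, word, word, ih, hQ.whiskerL_comp]
      congr 1
      cases x with
      | sub a b g hs ht => exact .symm ((hQ.whiskerL_eq_wh _ _).trans (hQ.wh_wh _ hs ht _ _ rfl rfl))
      | ren r => exact (I.ren_whiskerL r k).symm
  map_whiskerR {m n} f k := by
    induction f using Quot.ind with | _ x
    change I.word (x.whiskerR k) = Q.whiskerR (I.word x) k
    induction x with
    | nil => exact (hQ.whiskerR_id k _).symm
    | cons x w ih =>
      rw [Word.whiskerR, word, word, ih, hQ.whiskerR_comp]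
      congr 1
      cases x with
      | sub a b g hs ht =>
        exact .symm ((hQ.whiskerR_eq_wh _ _).trans
          (hQ.wh_wh _ hs ht _ _ (Nat.zero_add _).symm rfl))
      | ren r => exact (I.ren_whiskerR r k).symm
  map_symm m n := (I.word_one hQ _).trans (I.ren_symm m n)

theorem functor_single {n : ℕ} (g : O.Op n) : (I.functor hQ).map (Subs.single g) = I.op g :=
  (I.word_one hQ _).trans (hQ.wh_zero _ (by omega) rfl)

theorem functor_ren {m n : ℕ} (r : Ren n m) : (I.functor hQ).map (Subs.ren r) = I.ren r :=
  I.word_one hQ _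

end WordInterp

/-- A functor on substitutions is determined by its values on operations and renamings. -/
theorem PreFunctor.subs_ext {O : PreoperadData.{u}} {P : ∀ n : ℕ, O.Op n → Prop}
    {Q : PrePropData.{w}} (F G : PreFunctor (subsProp O P) Q)
    (hop : ∀ {n : ℕ} (g : O.Op n), F.map (Subs.single g) = G.map (Subs.single g))
    (hren : ∀ {m n : ℕ} (r : Ren n m), F.map (Subs.ren r) = G.map (Subs.ren r)) : F = G := by
  have key : ∀ {m n : ℕ} (x : Subs O P m n), F.map x = G.map x := by
    intro m n x
    induction x using Subs.ind' with
    | nil n => exact (F.map_id n).trans (G.map_id n).symm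
    | ren r => exact hren r
    | sub a b g hs ht =>
      rw [Subs.sub_eq_wh]
      refine (F.map_wh a b (P := subsProp O P) (Subs.single g) hs ht).trans
        (.trans ?_ (G.map_wh a b (P := subsProp O P) (Subs.single g) hs ht).symm)
      exact congrArg (fun z => Q.wh a b z hs ht) (hop g)
    | comp y x hy hx => exact (F.map_comp y x).trans (by rw [hy, hx]; exact (G.map_comp y x).symm)
  cases F; cases G
  congr
  funext m n x
  exact key x

/-! ## The interpretation of terms in a model -/

theorem Ren.lift_eq_add {m n : ℕ} (r : Ren m n) : r.lift = r.add (id : Ren 1 1) := by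
  funext i
  apply Fin.ext
  rw [Ren.lift_val, Ren.add_val]
  split_ifs
  · rfl
  · simp only [id]; omega

namespace Model

variable {S : Signature.{u}} (Y : Model.{u, w} S)

/-- `J` as a pre-PROP functor. -/
def functorJ : PreFunctor Y.V Y.C where
  map := Y.J
  map_id := Y.isFreydProp.J_id
  map_comp := Y.isFreydProp.J_comp
  map_whiskerL := Y.isFreydProp.J_whiskerL
  map_whiskerR := Y.isFreydProp.J_whiskerR
  map_symm := Y.isFreydProp.J_symm

theorem J_wh {m n s t : ℕ} (a b : ℕ) (f : Y.V.Hom m n) (hs : s = a + m + b) (ht : t = a + n + b) :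
    Y.J (Y.V.wh a b f hs ht) = Y.C.wh a b (Y.J f) hs ht :=
  Y.functorJ.map_wh a b f hs ht

theorem cart : Y.V.IsCartesianProp Y.copy Y.discard := Y.isFreydProp.V_cartesian

theorem preC : Y.C.IsPreProp := Y.isFreydProp.C_preProp

/-- The composite of `f : n → 1` and `g : n + 1 → 1` that interprets sequencing. -/
def bind {n : ℕ} (f : Y.C.Hom n 1) (g : Y.C.Hom (n + 1) 1) : Y.C.Hom n 1 :=
  Y.C.comp g (Y.C.comp (Y.C.whiskerL n f) (Y.J (Y.copy n)))

mutual

/-- The interpretation of values. -/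
def evalVal : {n : ℕ} → Val S n → Y.V.Hom n 1
  | _, .var i => Y.cart.proj i
  | _, .func f V => Y.V.comp (Y.func f) (Y.cart.tuple fun j => evalVal (V j))
  | n, .lam M => Y.abs n (evalCmp M)

/-- The interpretation of computations. -/
def evalCmp : {n : ℕ} → Cmp S n → Y.C.Hom n 1
  | _, .ret V => Y.J (evalVal V)
  | _, .letIn N M => Y.bind (evalCmp N) (evalCmp M)
  | _, .proc p V => Y.C.comp (Y.proc p) (Y.J (Y.cart.tuple fun j => evalVal (V j)))
  | _, .app V W => Y.C.comp Y.app (Y.J (Y.cart.pair (evalVal V) (evalVal W)))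

end

theorem bind_comp {m n : ℕ} (f : Y.C.Hom n 1) (g : Y.C.Hom (n + 1) 1) (v : Y.V.Hom m n) :
    Y.C.comp (Y.bind f g) (Y.J v) =
      Y.bind (Y.C.comp f (Y.J v)) (Y.C.comp g (Y.C.whiskerR (Y.J v) 1)) := by
  have hC := Y.preC
  rw [bind, bind, hC.assoc, hC.assoc, hC.assoc, ← Y.isFreydProp.J_comp, Y.cart.copy_natural,
    Y.isFreydProp.J_comp, PrePropData.tensor, Y.isFreydProp.J_comp, Y.isFreydProp.J_whiskerR,
    Y.isFreydProp.J_whiskerL, hC.whiskerL_comp]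
  congr 1
  simp only [← hC.assoc]
  rw [((Y.isFreydProp.J_central v) f).1]

theorem ofRen_lift {m n : ℕ} (r : Ren m n) :
    Y.cart.ofRen r.lift = Y.V.whiskerR (Y.cart.ofRen r) 1 := by
  rw [Y.cart.ofRen_whiskerR, Ren.lift_eq_add]

theorem pair_comp' {m n : ℕ} (f g : Y.V.Hom n 1) (v : Y.V.Hom m n) :
    Y.C.comp (Y.C.comp Y.app (Y.J (Y.cart.pair f g))) (Y.J v) =
      Y.C.comp Y.app (Y.J (Y.cart.pair (Y.V.comp f v) (Y.V.comp g v))) := by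
  rw [Y.preC.assoc, ← Y.isFreydProp.J_comp, Y.cart.pair_comp]

mutual

theorem evalVal_ren : ∀ {m n : ℕ} (V : Val S m) (r : Ren m n),
    Y.evalVal (V.ren r) = Y.V.comp (Y.evalVal V) (Y.cart.ofRen r)
  | _, _, .var i, r => by
      rw [Val.ren, evalVal, evalVal, Y.cart.proj_ofRen]
  | _, _, .func f V, r => by
      rw [Val.ren, evalVal, evalVal, Y.cart.assoc, Y.cart.tuple_comp]
      congr 2; funext j; exact evalVal_ren (V j) r
  | _, _, .lam M, r => by
      rw [Val.ren, evalVal, evalVal, evalCmp_ren M, ofRen_lift, Y.isFreydProp.J_whiskerR,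
        Y.abs_natural]

theorem evalCmp_ren : ∀ {m n : ℕ} (M : Cmp S m) (r : Ren m n),
    Y.evalCmp (M.ren r) = Y.C.comp (Y.evalCmp M) (Y.J (Y.cart.ofRen r))
  | _, _, .ret V, r => by
      rw [Cmp.ren, evalCmp, evalCmp, evalVal_ren V, Y.isFreydProp.J_comp]
  | _, _, .letIn N M, r => by
      rw [Cmp.ren, evalCmp, evalCmp, evalCmp_ren N, evalCmp_ren M, ofRen_lift, bind_comp,
        Y.isFreydProp.J_whiskerR]
  | _, _, .proc p V, r => by
      rw [Cmp.ren, evalCmp, evalCmp, Y.preC.assoc, ← Y.isFreydProp.J_comp, Y.cart.tuple_comp]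
      congr 3; funext j; exact evalVal_ren (V j) r
  | _, _, .app V W, r => by
      rw [Cmp.ren, evalCmp, evalCmp, evalVal_ren V, evalVal_ren W, pair_comp']

end

/-- The interpretation of a simultaneous substitution. -/
def evalSubst {m n : ℕ} (σ : Fin m → Val S n) : Y.V.Hom n m :=
  Y.cart.tuple fun i => Y.evalVal (σ i)

theorem evalSubst_lift {m n : ℕ} (σ : Fin m → Val S n) :
    Y.evalSubst (liftSubst σ) = Y.V.whiskerR (Y.evalSubst σ) 1 := by
  refine (Y.cart.eq_tuple fun i => ?_).symm
  induction i using Fin.lastCases with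
  | last =>
    rw [Y.cart.proj_last, Y.cart.snd_whiskerR, liftSubst, Fin.lastCases_last, evalVal,
      Y.cart.proj_last]
  | cast i =>
    rw [Y.cart.proj_castSucc, Y.cart.assoc, Y.cart.fst_whiskerR, ← Y.cart.assoc, evalSubst,
      Y.cart.proj_tuple, liftSubst, Fin.lastCases_castSucc, evalVal_ren]
    congr 1
    exact Y.cart.eq_tuple fun j => (Y.cart.proj_castSucc j).symm

mutual

theorem evalVal_subst : ∀ {m n : ℕ} (V : Val S m) (σ : Fin m → Val S n),
    Y.evalVal (V.subst σ) = Y.V.comp (Y.evalVal V) (Y.evalSubst σ)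
  | _, _, .var i, σ => by
      rw [Val.subst, evalVal, evalSubst, Y.cart.proj_tuple]
  | _, _, .func f V, σ => by
      rw [Val.subst, evalVal, evalVal, Y.cart.assoc, Y.cart.tuple_comp]
      congr 2; funext j; exact evalVal_subst (V j) σ
  | _, _, .lam M, σ => by
      rw [Val.subst, evalVal, evalVal, evalCmp_subst M, evalSubst_lift, Y.isFreydProp.J_whiskerR,
        Y.abs_natural]

theorem evalCmp_subst : ∀ {m n : ℕ} (M : Cmp S m) (σ : Fin m → Val S n),
    Y.evalCmp (M.subst σ) = Y.C.comp (Y.evalCmp M) (Y.J (Y.evalSubst σ))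
  | _, _, .ret V, σ => by
      rw [Cmp.subst, evalCmp, evalCmp, evalVal_subst V, Y.isFreydProp.J_comp]
  | _, _, .letIn N M, σ => by
      rw [Cmp.subst, evalCmp, evalCmp, evalCmp_subst N, evalCmp_subst M, evalSubst_lift, bind_comp,
        Y.isFreydProp.J_whiskerR]
  | _, _, .proc p V, σ => by
      rw [Cmp.subst, evalCmp, evalCmp, Y.preC.assoc, ← Y.isFreydProp.J_comp, Y.cart.tuple_comp]
      congr 3; funext j; exact evalVal_subst (V j) σ
  | _, _, .app V W, σ => by
      rw [Cmp.subst, evalCmp, evalCmp, evalVal_subst V, evalVal_subst W, pair_comp']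

end

theorem evalSubst_single {n : ℕ} (V : Val S n) :
    Y.evalSubst (single V) = Y.V.comp (Y.V.whiskerL n (Y.evalVal V)) (Y.copy n) := by
  refine (Y.cart.eq_tuple fun i => ?_).symm
  induction i using Fin.lastCases with
  | last =>
    rw [Y.cart.proj_last, ← Y.cart.assoc, Y.cart.snd_whiskerL, Y.cart.assoc,
      Y.cart.wh_discard_copy, Y.cart.comp_id, single, Fin.lastCases_last]
  | cast i =>
    rw [Y.cart.proj_castSucc, Y.cart.assoc, ← Y.cart.assoc (Y.cart.fst n 1), Y.cart.fst_whiskerL,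
      Y.cart.wh_copy_discard, Y.cart.comp_id, single, Fin.lastCases_castSucc, evalVal]

theorem bind_ret {n : ℕ} (V : Val S n) (g : Y.C.Hom (n + 1) 1) :
    Y.bind (Y.J (Y.evalVal V)) g = Y.C.comp g (Y.J (Y.evalSubst (single V))) := by
  rw [bind, evalSubst_single, Y.isFreydProp.J_comp, Y.isFreydProp.J_whiskerL]

theorem bind_proj_last {n : ℕ} (f : Y.C.Hom n 1) :
    Y.bind f (Y.J (Y.cart.proj (Fin.last n))) = f := by
  have e : Y.C.comp (Y.J (Y.cart.snd n 1)) (Y.C.whiskerL n f) =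
      Y.C.comp f (Y.J (Y.cart.snd n n)) := by
    rw [Y.preC.whiskerL_eq_wh, PrePropData.IsCartesianProp.snd, PrePropData.IsCartesianProp.snd,
      J_wh, J_wh]
    conv_rhs => rw [← Y.preC.wh_zero f (by omega) (by omega)]
    exact Y.preC.interchange (Y.J (Y.discard n)) f (.inl (Y.isFreydProp.J_central _)) (p := 0)
      (by omega) (by omega) (by omega) (by omega) _ _ _ _ _ _ _ _
  rw [bind, Y.cart.proj_last, ← Y.preC.assoc, e, Y.preC.assoc, ← Y.isFreydProp.J_comp,
    Y.cart.wh_discard_copy, Y.isFreydProp.J_id, Y.preC.comp_id]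

theorem bind_bind {n : ℕ} (f : Y.C.Hom n 1) (g k : Y.C.Hom (n + 1) 1) :
    Y.bind (Y.bind f g) k = Y.bind f (Y.bind g
      (Y.C.comp k (Y.J (Y.cart.ofRen (Ren.lift Fin.castSucc))))) := by
  have hC := Y.preC
  have e1 := (Y.isFreydProp.J_central (Y.cart.ofRen (Fin.castSucc : Ren n (n + 1))) g).1
  have e2 : Y.V.comp (Y.V.whiskerR (Y.cart.ofRen (Fin.castSucc : Ren n (n + 1))) (n + 1))
      (Y.copy (n + 1)) = Y.V.wh 0 1 (Y.copy n) (by omega) (by omega) := by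
    rw [Y.cart.ofRen_whiskerR, Y.cart.copy_eq_ofRen, Y.cart.ofRen_comp, Y.cart.wh_copy]
    congr 1
    funext i
    apply Fin.ext
    simp only [Function.comp, Ren.cast_val, Ren.add_val, Ren.copy_val, id, Fin.val_castSucc]
    split_ifs <;> omega
  have e3 : Y.C.comp (Y.C.wh 0 1 (Y.J (Y.copy n)) (by omega) (by omega)) (Y.C.wh n 0 f rfl rfl) =
      Y.C.comp (Y.C.wh n 0 (Y.C.wh n 0 f rfl rfl) (rfl : n + (n + n) = _) rfl)
        (Y.C.wh 0 n (Y.J (Y.copy n)) (by omega) (by omega)) := by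
    rw [hC.wh_wh f rfl rfl _ _ rfl rfl]
    exact hC.interchange (Y.J (Y.copy n)) f (.inl (Y.isFreydProp.J_central _)) (p := 0)
      (by omega) (by omega) (by omega) (by omega) _ _ _ _ _ _ _ _
  have e4 : Y.V.comp (Y.V.wh 0 n (Y.copy n) (by omega) (by omega : n + (n + n) = _)) (Y.copy n) =
      Y.V.comp (Y.V.wh n 0 (Y.copy n) rfl rfl) (Y.copy n) := by
    rw [Y.cart.wh_copy, Y.cart.wh_copy, Y.cart.copy_eq_ofRen, Y.cart.ofRen_comp, Y.cart.ofRen_comp]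
    congr 1
    funext i
    apply Fin.ext
    simp only [Function.comp, Ren.cast_val, Ren.add_val, Ren.copy_val, id]
    split_ifs <;> omega
  calc Y.bind (Y.bind f g) k
      = Y.C.comp k (Y.C.comp (Y.C.whiskerL n g) (Y.C.comp (Y.C.comp
          (Y.C.wh n 0 (Y.C.wh n 0 f rfl rfl) (rfl : n + (n + n) = _) rfl)
          (Y.C.wh n 0 (Y.J (Y.copy n)) rfl rfl)) (Y.J (Y.copy n)))) := by
        simp only [bind, hC.whiskerL_comp, hC.assoc, hC.whiskerL_eq_wh]
    _ = Y.C.comp k (Y.C.comp (Y.C.whiskerL n g) (Y.C.comp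
          (Y.C.wh 0 1 (Y.J (Y.copy n)) (by omega) (by omega))
          (Y.C.comp (Y.C.wh n 0 f rfl rfl) (Y.J (Y.copy n))))) := by
        rw [← hC.assoc _ (Y.C.wh n 0 f rfl rfl), e3, hC.assoc, hC.assoc, ← J_wh, ← J_wh,
          ← Y.isFreydProp.J_comp, ← Y.isFreydProp.J_comp, e4]
    _ = _ := by
        rw [← J_wh, ← e2, Y.isFreydProp.J_comp, Y.isFreydProp.J_whiskerR, bind, bind, ofRen_lift,
          Y.isFreydProp.J_whiskerR]
        simp only [hC.assoc]
        rw [← hC.assoc (Y.C.whiskerL n g), ← e1, hC.whiskerL_eq_wh n f]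
        simp only [hC.assoc]

mutual

theorem evalVal_sound : ∀ {n : ℕ} {V W : Val S n} (_ : ValEq V W), Y.evalVal V = Y.evalVal W
  | _, _, _, .refl V => rfl
  | _, _, _, .symm h => (evalVal_sound h).symm
  | _, _, _, .trans h h' => (evalVal_sound h).trans (evalVal_sound h')
  | _, _, _, .func f h => by
      rw [evalVal, evalVal]; congr 2; funext j; exact evalVal_sound (h j)
  | _, _, _, .lam h => by rw [evalVal, evalVal, evalCmp_sound h]

theorem evalCmp_sound : ∀ {n : ℕ} {M N : Cmp S n} (_ : CmpEq M N), Y.evalCmp M = Y.evalCmp N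
  | _, _, _, .refl V => rfl
  | _, _, _, .symm h => (evalCmp_sound h).symm
  | _, _, _, .trans h h' => (evalCmp_sound h).trans (evalCmp_sound h')
  | _, _, _, .ret h => by rw [evalCmp, evalCmp, evalVal_sound h]
  | _, _, _, .letIn h h' => by rw [evalCmp, evalCmp, evalCmp_sound h, evalCmp_sound h']
  | _, _, _, .proc f h => by
      rw [evalCmp, evalCmp]; congr 3; funext j; exact evalVal_sound (h j)
  | _, _, _, .app h h' => by rw [evalCmp, evalCmp, evalVal_sound h, evalVal_sound h']
  | _, _, _, .lunit V M => by rw [evalCmp, evalCmp, bind_ret, evalCmp_subst]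
  | _, _, _, .runit M => by rw [evalCmp, evalCmp, evalVal, bind_proj_last]
  | _, _, _, .assoc M₁ M₂ M => by
      rw [evalCmp, evalCmp, evalCmp, evalCmp, evalCmp_ren, bind_bind]
  | _, _, _, .beta M V => by
      rw [evalCmp, evalCmp_subst, evalVal, evalSubst_single, PrePropData.IsCartesianProp.pair,
        Y.cart.assoc, Y.isFreydProp.J_comp, Y.isFreydProp.J_whiskerR, ← Y.preC.assoc, Y.app_abs]

end

/-! ### The interpretation of substitution for one variable -/

theorem evalVal_plug {t s n : ℕ} (a b : ℕ) (V : Val S t) (W : Val S n) (ht : t = a + 1 + b)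
    (hs : s = a + n + b) :
    Y.evalVal (V.plug a b W ht hs) = Y.V.comp (Y.evalVal V) (Y.V.wh a b (Y.evalVal W) hs ht) := by
  subst ht hs
  rw [Val.plug, evalVal_subst]
  congr 1
  refine (Y.cart.eq_tuple fun i => ?_).symm
  change Y.V.comp _ (Y.V.whiskerR (Y.V.whiskerL a (Y.evalVal W)) b) = _
  beta_reduce
  induction i using Fin.addCases with
  | left i =>
    rw [Y.cart.proj_castAdd, Y.cart.assoc, Y.cart.fst_whiskerR, ← Y.cart.assoc]
    induction i using Fin.addCases with
    | left i =>
      rw [Y.cart.proj_castAdd, Y.cart.assoc _ _ (Y.V.whiskerL a _), Y.cart.fst_whiskerL,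
        ← Y.cart.proj_castAdd, ← Y.cart.proj_castAdd, dif_pos (by simp), evalVal]
      rfl
    | right j =>
      obtain rfl : j = 0 := Subsingleton.elim _ _
      rw [Y.cart.proj_natAdd, Y.cart.proj_zero, Y.cart.id_comp, Y.cart.snd_whiskerL,
        dif_neg (by simp), dif_pos (by simp), evalVal_ren, Y.cart.assoc]
      congr 1
      refine Y.cart.eq_tuple fun j => ?_
      rw [← Y.cart.assoc, ← Y.cart.proj_natAdd, ← Y.cart.proj_castAdd]
      rfl
  | right j =>
    rw [Y.cart.proj_natAdd, Y.cart.assoc, Y.cart.snd_whiskerR, ← Y.cart.proj_natAdd,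
      dif_neg (by simp; omega), dif_neg (by simp; omega), evalVal]
    congr 1
    apply Fin.ext
    simp
    omega

theorem evalCmp_plug {t s n : ℕ} (a b : ℕ) (M : Cmp S t) (N : Cmp S n) (ht : t = a + 1 + b)
    (hs : s = a + n + b) :
    Y.evalCmp (M.plug a b N ht hs) = Y.C.comp (Y.evalCmp M) (Y.C.wh a b (Y.evalCmp N) hs ht) := by
  subst ht hs
  have hC := Y.preC
  have e1 : Y.cart.ofRen (fun i : Fin (a + 1 + b) =>
      if h : i.val < a then (⟨i.val, by omega⟩ : Fin (a + n + b + 1))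
      else if h' : i.val = a then Fin.last (a + n + b)
      else ⟨i.val - 1 + n, by omega⟩) =
      Y.V.comp (Y.V.wh a 0 (Y.V.symm b 1) (by omega : a + b + 1 = _) (by omega))
        (Y.V.wh a (b + 1) (Y.discard n) (by omega) (by omega)) := by
    rw [Y.cart.wh_symm, Y.cart.wh_discard, Y.cart.ofRen_comp]
    congr 1
    funext i
    apply Fin.ext
    simp only [Function.comp, Ren.cast_val, Ren.add_val, Ren.symm_val, id]
    split_ifs <;> simp <;> omega
  have e2 := hC.interchange (Y.J (Y.discard n)) (Y.evalCmp N)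
    (.inl (Y.isFreydProp.J_central _)) (a := a) (p := b) (b := 0) (b₁ := b + 1)
    (a₂ := a + n + b) (a₃ := a + b) (b₃ := b + n) (x := a + n + b + 1) (t := a + b + 1)
    (s := a + n + b + n) (y := a + b + n) (by omega) (by omega) (by omega) (by omega)
    (by omega) (by omega) (by omega) (by omega) (by omega) (by omega) (by omega) (by omega)
  have e3 := hC.wh_symm_natural' (a := a) (b := 0) (k := b) (Y.evalCmp N)
    (by omega : a + n + b = _) (by omega : a + 1 + b = _) (by omega : a + b + n = _)
    (by omega : a + b + 1 = _)
  have e4 : Y.V.comp (Y.V.comp (Y.V.wh a 0 (Y.V.symm b n) (by omega : a + b + n = _)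
      (by omega : a + n + b = _)) (Y.V.wh a (b + n) (Y.discard n) (by omega : a + n + b + n = _)
      (by omega : _ = _)))
      (Y.V.comp (Y.V.whiskerL (a + n + b) (Y.cart.ofRen (midRen a b rfl))) (Y.copy (a + n + b))) =
      Y.V.id _ := by
    have e5 : Y.V.comp (Y.V.wh a 0 (Y.V.symm b n) (by omega : a + b + n = _)
        (by omega : a + n + b = _)) (Y.V.wh a (b + n) (Y.discard n) (by omega : a + n + b + n = _)
        (by omega : _ = _)) = Y.cart.ofRen (fun i => (⟨if i.val < a then i.val else
          if i.val < a + n then i.val + n + b else i.val, by split_ifs <;> omega⟩ :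
            Fin (a + n + b + n))) := by
      rw [Y.cart.wh_symm, Y.cart.wh_discard, Y.cart.ofRen_comp]
      congr 1
      funext i
      apply Fin.ext
      simp only [Function.comp, Ren.cast_val, Ren.add_val, Ren.symm_val, id]
      split_ifs <;> omega
    have e6 : Y.V.comp (Y.V.whiskerL (a + n + b) (Y.cart.ofRen (midRen a b rfl)))
        (Y.copy (a + n + b)) = Y.cart.ofRen (fun i : Fin (a + n + b + n) =>
          (⟨if i.val < a + n + b then i.val else a + (i.val - (a + n + b)),
            by split_ifs <;> omega⟩ : Fin (a + n + b))) := by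
      rw [Y.cart.ofRen_whiskerL, Y.cart.copy_eq_ofRen, Y.cart.ofRen_comp]
      congr 1
      funext i
      apply Fin.ext
      simp only [Function.comp, Ren.add_val, Ren.copy_val, id, midRen]
      split_ifs <;> simp; omega
    rw [e5, e6, Y.cart.ofRen_comp, ← Y.cart.ofRen_id]
    congr 1
    funext i
    apply Fin.ext
    simp only [Function.comp, id]
    split_ifs <;> omega
  rw [Cmp.plug, evalCmp, evalCmp_ren, evalCmp_ren, bind, e1, Y.isFreydProp.J_comp, J_wh, J_wh,
    Y.isFreydProp.J_symm, hC.assoc, hC.assoc, hC.whiskerL_comp, hC.whiskerL_eq_wh _ (Y.evalCmp N)]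
  congr 1
  calc _ = Y.C.comp (Y.C.wh a 0 (Y.C.symm b 1) (by omega : a + b + 1 = _) (by omega))
        (Y.C.comp (Y.C.comp (Y.C.wh a (b + 1) (Y.J (Y.discard n)) (by omega : a + n + b + 1 = _) (by omega))
          (Y.C.wh (a + n + b) 0 (Y.evalCmp N) rfl (by omega)))
          (Y.J (Y.V.comp (Y.V.whiskerL (a + n + b) (Y.cart.ofRen (midRen a b rfl)))
            (Y.copy (a + n + b))))) := by
        simp only [hC.assoc, Y.isFreydProp.J_comp, Y.isFreydProp.J_whiskerL]
    _ = Y.C.comp (Y.C.wh a b (Y.evalCmp N) rfl rfl) (Y.J (Y.V.id _)) := by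
        rw [e2, hC.assoc, ← hC.assoc, e3, hC.assoc, ← e4]
        simp only [Y.isFreydProp.J_comp, J_wh, Y.isFreydProp.J_symm, hC.assoc]
        rfl
    _ = _ := by rw [Y.isFreydProp.J_id, hC.comp_id]

/-! ### The induced interpretations of substitutions -/

/-- The interpretation of values up to provable equality. -/
def evalValQ {n : ℕ} (f : (termVal S).Op n) : Y.V.Hom n 1 :=
  Quotient.lift Y.evalVal (fun _ _ h => Y.evalVal_sound h) f

/-- The interpretation of computations up to provable equality. -/
def evalCmpQ {n : ℕ} (f : (termCmp S).Op n) : Y.C.Hom n 1 :=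
  Quotient.lift Y.evalCmp (fun _ _ h => Y.evalCmp_sound h) f

theorem ofRen_symm (m n : ℕ) : Y.cart.ofRen (Ren.symm n m) = Y.V.symm m n :=
  (Y.cart.symm_eq_ofRen m n).symm

/-- The interpretation of value operations and renamings in a model. -/
def interpV : WordInterp (termVal S) (fun _ _ => True) Y.V where
  op := Y.evalValQ
  ren := Y.cart.ofRen
  op_one := Y.cart.proj_zero
  op_sub a b f g ht hs := by
    induction f using Quotient.inductionOn with | _ V
    induction g using Quotient.inductionOn with | _ W
    exact Y.evalVal_plug a b V W ht hs
  op_ren f r := by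
    induction f using Quotient.inductionOn with | _ V
    exact Y.evalVal_ren V r
  ren_id := Y.cart.ofRen_id
  ren_comp := Y.cart.ofRen_comp
  ren_whiskerL := Y.cart.ofRen_whiskerL
  ren_whiskerR := Y.cart.ofRen_whiskerR
  ren_symm := Y.ofRen_symm
  ren_central _ := Y.cart.central _
  op_central _ _ := Y.cart.central _
  op_discard g _ := by
    rw [← Y.cart.discard_eq_ofRen, ← Y.cart.discard_eq_ofRen, Y.cart.discard_natural]
  op_copy g _ := by
    rw [← Y.cart.copy_eq_ofRen, ← Y.cart.copy_eq_ofRen, Y.cart.copy_natural]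

theorem evalCmpQ_ret {n : ℕ} (f : (termVal S).Op n) :
    Y.evalCmpQ ((termModel S).ret f) = Y.J (Y.evalValQ f) := by
  induction f using Quotient.inductionOn with | _ V
  exact evalCmp.eq_1 Y _ V

theorem exists_evalCmpQ_eq {n : ℕ} (g : (termCmp S).Op n) (hg : (termModel S).IsPure g) :
    ∃ v : Y.V.Hom n 1, Y.evalCmpQ g = Y.J v := by
  obtain ⟨f, rfl⟩ := hg
  exact ⟨_, Y.evalCmpQ_ret f⟩

/-- The interpretation of computation operations and renamings in a model. -/
def interpC : WordInterp (termCmp S) (fun _ => (termModel S).IsPure) Y.C where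
  op := Y.evalCmpQ
  ren r := Y.J (Y.cart.ofRen r)
  op_one := (Y.evalCmpQ_ret (termVal S).one).trans
    ((congrArg Y.J Y.cart.proj_zero).trans (Y.isFreydProp.J_id 1))
  op_sub a b f g ht hs := by
    induction f using Quotient.inductionOn with | _ M
    induction g using Quotient.inductionOn with | _ N
    exact Y.evalCmp_plug a b M N ht hs
  op_ren f r := by
    induction f using Quotient.inductionOn with | _ M
    exact Y.evalCmp_ren M r
  ren_id n := by rw [Y.cart.ofRen_id, Y.isFreydProp.J_id]
  ren_comp r s := by rw [← Y.isFreydProp.J_comp, Y.cart.ofRen_comp]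
  ren_whiskerL r k := by rw [← Y.isFreydProp.J_whiskerL, Y.cart.ofRen_whiskerL]
  ren_whiskerR r k := by rw [← Y.isFreydProp.J_whiskerR, Y.cart.ofRen_whiskerR]
  ren_symm m n := by rw [Y.ofRen_symm, Y.isFreydProp.J_symm]
  ren_central _ := Y.isFreydProp.J_central _
  op_central := by
    intro n g hg
    obtain ⟨v, hv⟩ := Y.exists_evalCmpQ_eq g hg
    rw [hv]
    exact Y.isFreydProp.J_central _
  op_discard := by
    intro n g hg
    obtain ⟨v, hv⟩ := Y.exists_evalCmpQ_eq g hg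
    rw [hv, ← Y.isFreydProp.J_comp, ← Y.cart.discard_eq_ofRen,
      ← Y.cart.discard_eq_ofRen, Y.cart.discard_natural]
  op_copy := by
    intro n g hg
    obtain ⟨v, hv⟩ := Y.exists_evalCmpQ_eq g hg
    rw [hv, ← Y.isFreydProp.J_comp, ← Y.cart.copy_eq_ofRen,
      ← Y.cart.copy_eq_ofRen, Y.cart.copy_natural, Y.isFreydProp.J_comp, PrePropData.tensor,
      PrePropData.tensor, Y.isFreydProp.J_comp, Y.isFreydProp.J_whiskerL,
      Y.isFreydProp.J_whiskerR]

/-- The functor from substitutions of values to a model. -/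
def functorV : PreFunctor (CSub (termModel S)) Y.V := Y.interpV.functor Y.cart.toIsPreProp

/-- The functor from substitutions of computations to a model. -/
def functorC : PreFunctor (Sub (termModel S)) Y.C := Y.interpC.functor Y.preC

theorem functorV_single {n : ℕ} (f : (termModel S).V.Op n) :
    Y.functorV.map (Subs.single f) = Y.evalValQ f :=
  Y.interpV.functor_single Y.cart.toIsPreProp f

theorem functorC_single {n : ℕ} (f : (termModel S).C.Op n) :
    Y.functorC.map (Subs.single f) = Y.evalCmpQ f :=
  Y.interpC.functor_single Y.preC f

theorem functorV_ren {m n : ℕ} (r : Ren m n) :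
    Y.functorV.map (Subs.ren r) = Y.cart.ofRen r :=
  Y.interpV.functor_ren Y.cart.toIsPreProp r

theorem functorC_ren {m n : ℕ} (r : Ren m n) :
    Y.functorC.map (Subs.ren r) = Y.J (Y.cart.ofRen r) :=
  Y.interpC.functor_ren Y.preC r

theorem functorC_J {m n : ℕ} (x : (CSub (termModel S)).Hom m n) :
    Y.functorC.map ((freydPropOfSubstitutions (termModel S)).J x) = Y.J (Y.functorV.map x) := by
  induction x using Quot.ind with | _ x
  change Y.interpC.word (x.ret _) = Y.J (Y.interpV.word x)
  induction x with
  | nil => exact (Y.isFreydProp.J_id _).symm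
  | cons x w ih =>
    change Y.C.comp (Y.interpC.step (x.ret _)) (Y.interpC.word (w.ret _)) =
      Y.J (Y.V.comp (Y.interpV.step x) (Y.interpV.word w))
    rw [ih, Y.isFreydProp.J_comp]
    congr 1
    cases x with
    | sub a b g hs ht =>
      change _ = Y.J (Y.V.wh a b (Y.evalValQ g) hs ht)
      rw [J_wh]
      exact congrArg (fun z => Y.C.wh a b z hs ht) (Y.evalCmpQ_ret g)
    | ren r => rfl

end Model

/-! ## The action of substitution words on operations -/

section Act

variable {O : PreoperadData.{u}} {P : ∀ n : ℕ, O.Op n → Prop}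

/-- The action of a letter on operations. -/
def Step.act : {s t : ℕ} → O.Op t → Step O s t → O.Op s
  | _, _, f, .sub a b g hs ht => O.sub a b f g ht hs
  | _, _, f, .ren r => O.ren f r

/-- The action of a word on operations. -/
def Word.act {s : ℕ} : {t : ℕ} → O.Op t → Word O s t → O.Op s
  | _, f, .nil => f
  | _, f, .cons x w => Word.act (x.act f) w

theorem Word.act_append : ∀ {r s t : ℕ} (f : O.Op t) (x : Word O s t) (y : Word O r s),
    Word.act f (x.append y) = Word.act (Word.act f x) y
  | _, _, _, _, .nil, _ => rfl
  | _, _, _, f, .cons x w, y => Word.act_append (x.act f) w y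

variable (O P) in
/-- The action of words on operations respects the rules. -/
def ActsByRules : Prop :=
  ∀ {s t : ℕ} {x y : Word O s t}, Rule O P x y → ∀ f : O.Op t, Word.act f x = Word.act f y

namespace Subs

/-- The action of substitutions on operations. -/
def act (h : ActsByRules O P) {s t : ℕ} (f : O.Op t) (x : Subs O P s t) : O.Op s :=
  Quot.lift (Word.act f) (by
    rintro _ _ ⟨u, w, hr⟩
    rw [Word.act_append, Word.act_append, Word.act_append, Word.act_append, h hr]) x

theorem act_comp (h : ActsByRules O P) {r s t : ℕ} (f : O.Op t) (x : Subs O P s t)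
    (y : Subs O P r s) : act h f (Subs.comp x y) = act h (act h f x) y := by
  induction x using Quot.ind with | _ x
  induction y using Quot.ind with | _ y
  exact Word.act_append f x y

theorem single_comp_sub {s t n : ℕ} (f : O.Op t) (a b : ℕ) (g : O.Op n) (hs : s = a + n + b)
    (ht : t = a + 1 + b) :
    (Subs.comp (single f) (sub a b g hs ht) : Subs O P s 1) = single (O.sub a b f g ht hs) := by
  subst hs
  exact sound (Rule.assoc' 0 0 a b f g ht _ _ (by omega) (by omega) (by omega) (by omega) (by omega))

theorem single_comp_ren {m n : ℕ} (f : O.Op n) (r : Ren n m) :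
    (Subs.comp (single f) (ren r) : Subs O P m 1) = single (O.ren f r) := by
  have h1 : r = Ren.cast (by omega) (by omega) ((Ren.add (id : Ren 0 0) r).add (id : Ren 0 0)) := by
    funext i
    apply Fin.ext
    simp [Ren.cast_val, Ren.add_val]
  have h2 : (id : Ren 1 1) = Ren.cast (by omega) (by omega)
      ((Ren.add (id : Ren 0 0) (id : Ren 1 1)).add (id : Ren 0 0)) := by
    funext i
    apply Fin.ext
    simp
  refine (sound (Rule.sub_ren' f (id : Ren 0 0) r (id : Ren 0 0) (by omega) (by omega)
    (by omega) (by omega) r (id : Ren 1 1) h1 h2)).trans ?_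
  exact (congrArg (fun z => Subs.comp z (single (O.ren f r))) (ren_id 1)).trans (nil_comp _)

theorem single_comp (h : ActsByRules O P) {s t : ℕ} (f : O.Op t) (x : Subs O P s t) :
    Subs.comp (single f) x = single (act h f x) := by
  induction x using Subs.ind' with
  | nil n => exact comp_nil _
  | ren r => exact single_comp_ren f r
  | sub a b g hs ht => exact single_comp_sub f a b g hs ht
  | comp y x hy hx =>
    rw [act_comp, ← hx, ← hy]
    exact (comp_assoc _ _ _).symm

theorem single_one : (single O.one : Subs O P 1 1) = mk .nil :=
  sound (Rule.unit_sub' 0 0 rfl)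

/-- The operation that a substitution with codomain `1` represents. -/
def toOp (h : ActsByRules O P) {n : ℕ} (x : Subs O P n 1) : O.Op n := act h O.one x

theorem single_toOp (h : ActsByRules O P) {n : ℕ} (x : Subs O P n 1) : single (toOp h x) = x := by
  change single (act h O.one x) = x
  rw [← single_comp, single_one]
  exact nil_comp x

end Subs

end Act

/-! ## Substitution in the term model -/

variable {S : Signature.{u}}

/-- The renaming of the body of the let expression `Cmp.plug`. -/
def topRen {t s n : ℕ} (a b : ℕ) (ht : t = a + 1 + b) (hs : s = a + n + b) : Ren t (s + 1) :=
  fun i => if h : i.val < a then ⟨i.val, by omega⟩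
    else if h' : i.val = a then Fin.last s
    else ⟨i.val - 1 + n, by omega⟩

theorem topRen_val {t s n : ℕ} (a b : ℕ) (ht : t = a + 1 + b) (hs : s = a + n + b) (i : Fin t) :
    (topRen a b ht hs i).val =
      if i.val < a then i.val else if i.val = a then s else i.val - 1 + n := by
  rw [topRen]
  split_ifs <;> rfl

theorem midRen_val {n s : ℕ} (a b : ℕ) (hs : s = a + n + b) (j : Fin n) :
    (midRen a b hs j).val = a + j.val := rfl

/-- The simultaneous substitution that `Val.plug` performs. -/
def plugSubst {t s n : ℕ} (a b : ℕ) (W : Val S n) (ht : t = a + 1 + b) (hs : s = a + n + b) :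
    Fin t → Val S s :=
  fun i => if h : i.val < a then .var ⟨i.val, by omega⟩
    else if h' : i.val = a then W.ren (midRen a b hs)
    else .var ⟨i.val - 1 + n, by omega⟩

section

variable {t s n : ℕ} (a b : ℕ) (W : Val S n) (ht : t = a + 1 + b) (hs : s = a + n + b) {i : Fin t}

theorem plugSubst_lt (h : i.val < a) : plugSubst a b W ht hs i = .var ⟨i.val, by omega⟩ :=
  dif_pos h

theorem plugSubst_eq (h : i.val = a) : plugSubst a b W ht hs i = W.ren (midRen a b hs) := by
  rw [plugSubst, dif_neg (by omega), dif_pos h]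

theorem plugSubst_gt (h : a < i.val) :
    plugSubst a b W ht hs i = .var ⟨i.val - 1 + n, by omega⟩ := by
  rw [plugSubst, dif_neg (by omega), dif_neg (by omega)]

theorem single_topRen : single (W.ren (midRen a b hs)) ∘ topRen a b ht hs =
    plugSubst a b W ht hs := by
  have key : ∀ (V : Val S s) (k : ℕ) (hk : k < s), single V ⟨k, by omega⟩ =
      Val.var ⟨k, hk⟩ := fun V k hk => by
    have : (⟨k, by omega⟩ : Fin (s + 1)) = Fin.castSucc ⟨k, hk⟩ := rfl
    rw [this, single, Fin.lastCases_castSucc]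
  funext i
  simp only [Function.comp, topRen, plugSubst]
  split_ifs
  · exact key _ _ _
  · simp [single]
  · exact key _ _ _

theorem Cmp.plug_ret (M : Cmp S t) :
    CmpEq (M.plug a b (.ret W) ht hs) (M.subst (plugSubst a b W ht hs)) := by
  have h := CmpEq.lunit (W.ren (midRen a b hs)) (M.ren (topRen a b ht hs))
  rw [Cmp.ren_subst, single_topRen] at h
  exact h

end

theorem plugSubst_var (a b : ℕ) {t : ℕ} (ht : t = a + 1 + b) :
    plugSubst a b (.var 0) ht ht = (Val.var : Fin t → Val S t) := by
  funext i
  rcases lt_trichotomy i.val a with h | h | h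
  · rw [plugSubst_lt _ _ _ _ _ h]
  · rw [plugSubst_eq _ _ _ _ _ h, Val.ren]
    congr 1
    apply Fin.ext
    simp [midRen_val, h]
  · rw [plugSubst_gt _ _ _ _ _ h]
    congr 1
    apply Fin.ext
    simp; omega

theorem plugSubst_plug (a b c d : ℕ) {t s n k m a' b' : ℕ} (W : Val S n) (U : Val S k)
    (hn : n = c + 1 + d) (hm : m = c + k + d) (ht : t = a + 1 + b) (h1 : s = a + n + b)
    (ha : a' = a + c) (hb : b' = d + b) {p : ℕ} (h2 : s = a' + 1 + b') (h3 : p = a' + k + b')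
    (h4 : p = a + m + b) (i : Fin t) :
    (plugSubst a b W ht h1 i).subst (plugSubst a' b' U h2 h3) =
      plugSubst a b (W.plug c d U hn hm) ht h4 i := by
  rcases lt_trichotomy i.val a with h | h | h
  · rw [plugSubst_lt _ _ _ _ _ h, plugSubst_lt _ _ _ _ _ h, Val.subst,
      plugSubst_lt _ _ _ _ _ (by simp; omega)]
  · rw [plugSubst_eq _ _ _ _ _ h, plugSubst_eq _ _ _ _ _ h, Val.plug, Val.ren_subst,
      Val.subst_ren]
    congr 1
    funext j
    change plugSubst a' b' U h2 h3 (midRen a b h1 j) =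
      (plugSubst c d U hn hm j).ren (midRen a b h4)
    rcases lt_trichotomy j.val c with h' | h' | h'
    · rw [plugSubst_lt _ _ _ _ _ h', plugSubst_lt _ _ _ _ _ (by rw [midRen_val]; omega)]
      rfl
    · rw [plugSubst_eq _ _ _ _ _ h', plugSubst_eq _ _ _ _ _ (by rw [midRen_val]; omega),
        Val.ren_ren]
      congr 1
      funext l
      apply Fin.ext
      simp only [Function.comp, midRen_val]
      omega
    · rw [plugSubst_gt _ _ _ _ _ h', plugSubst_gt _ _ _ _ _ (by rw [midRen_val]; omega), Val.ren]
      congr 1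
      apply Fin.ext
      simp only [midRen_val]
      omega
  · rw [plugSubst_gt _ _ _ _ _ h, plugSubst_gt _ _ _ _ _ h, Val.subst,
      plugSubst_gt _ _ _ _ _ (by simp; omega)]
    congr 1
    apply Fin.ext
    simp only
    omega

theorem plugSubst_ren {a a' b b' n n' : ℕ} (W : Val S n) (r₁ : Ren a a') (r : Ren n n')
    (r₂ : Ren b b') (i : Fin (a + 1 + b)) :
    (plugSubst a b W rfl rfl i).ren ((r₁.add r).add r₂) =
      plugSubst a' b' (W.ren r) rfl rfl (((r₁.add (id : Ren 1 1)).add r₂) i) := by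
  induction i using Fin.addCases with
  | left i =>
    induction i using Fin.addCases with
    | left i =>
      rw [plugSubst_lt _ _ _ _ _ (by simp), plugSubst_lt _ _ _ _ _ (by simp [Ren.add]), Val.ren]
      have e : ∀ h, (⟨(Fin.castAdd b (Fin.castAdd 1 i)).val, h⟩ : Fin (a + n + b)) =
          Fin.castAdd b (Fin.castAdd n i) := fun _ => rfl
      congr 1
      apply Fin.ext
      rw [e]
      simp [Ren.add]
    | right i =>
      obtain rfl : i = 0 := Subsingleton.elim _ _
      rw [plugSubst_eq _ _ _ _ _ (by simp), plugSubst_eq _ _ _ _ _ (by simp [Ren.add]),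
        Val.ren_ren, Val.ren_ren]
      congr 1
      funext j
      apply Fin.ext
      simp [Ren.add_val, midRen_val]
  | right i =>
    rw [plugSubst_gt _ _ _ _ _ (by simp; omega), plugSubst_gt _ _ _ _ _ (by simp [Ren.add]; omega),
      Val.ren]
    congr 1
    apply Fin.ext
    have e : ∀ h, (⟨(Fin.natAdd (a + 1) i).val - 1 + n, h⟩ : Fin (a + n + b)) =
        Fin.natAdd (a + n) i := fun _ => Fin.ext (by simp; omega)
    rw [e]
    simp [Ren.add]
    omega

theorem plugSubst_swap_left (a b : ℕ) {n p q : ℕ} (W : Val S n)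
    (h1 : a + (1 + 1) + b = a + 1 + (1 + b)) (h2 : p = a + n + (1 + b))
    (h3 : a + (1 + 1) + b = a + 1 + 1 + b) (h4 : q = a + 1 + n + b) (hp : p = a + (n + 1) + b)
    (hq : q = a + (1 + n) + b) (i : Fin (a + (1 + 1) + b)) :
    (plugSubst a (1 + b) W h1 h2
      (((Ren.add (id : Ren a a) (Ren.symm 1 1)).add (id : Ren b b)) i)) =
    (plugSubst (a + 1) b W h3 h4 i).ren (Ren.cast hq.symm hp.symm
      ((Ren.add (id : Ren a a) (Ren.symm 1 n)).add (id : Ren b b))) := by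
  have e : (((Ren.add (id : Ren a a) (Ren.symm 1 1)).add (id : Ren b b)) i).val =
      if i.val = a then a + 1 else if i.val = a + 1 then a else i.val := by
    simp only [Ren.add_val, Ren.symm_val, id]
    split_ifs <;> omega
  by_cases c1 : i.val = a + 1
  · rw [plugSubst_eq _ _ _ _ _ (by rw [e]; split_ifs <;> omega), plugSubst_eq _ _ _ _ _ c1,
      Val.ren_ren]
    congr 1
    funext j
    apply Fin.ext
    simp only [Function.comp, Ren.cast_val, Ren.add_val, Ren.symm_val, midRen_val, id]
    split_ifs <;> omega
  · rcases lt_or_gt_of_ne c1 with c2 | c2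
    · rw [plugSubst_lt _ _ _ _ _ c2, Val.ren]
      by_cases c3 : i.val = a
      · rw [plugSubst_gt _ _ _ _ _ (by rw [e]; split_ifs; omega)]
        congr 1
        apply Fin.ext
        simp only [Ren.cast_val, Ren.add_val, Ren.symm_val, id]
        split_ifs <;> omega
      · rw [plugSubst_lt _ _ _ _ _ (by rw [e]; split_ifs; omega)]
        congr 1
        apply Fin.ext
        simp only [Ren.cast_val, Ren.add_val, Ren.symm_val, id]
        split_ifs <;> omega
    · rw [plugSubst_gt _ _ _ _ _ c2, Val.ren,
        plugSubst_gt _ _ _ _ _ (by rw [e]; split_ifs <;> omega)]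
      congr 1
      apply Fin.ext
      simp only [Ren.cast_val, Ren.add_val, Ren.symm_val, id]
      split_ifs <;> omega

theorem plugSubst_swap_right (a b : ℕ) {n p q : ℕ} (W : Val S n)
    (h1 : a + (1 + 1) + b = a + 1 + 1 + b) (h2 : p = a + 1 + n + b)
    (h3 : a + (1 + 1) + b = a + 1 + (1 + b)) (h4 : q = a + n + (1 + b)) (hp : p = a + (1 + n) + b)
    (hq : q = a + (n + 1) + b) (i : Fin (a + (1 + 1) + b)) :
    (plugSubst (a + 1) b W h1 h2
      (((Ren.add (id : Ren a a) (Ren.symm 1 1)).add (id : Ren b b)) i)) =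
    (plugSubst a (1 + b) W h3 h4 i).ren (Ren.cast hq.symm hp.symm
      ((Ren.add (id : Ren a a) (Ren.symm n 1)).add (id : Ren b b))) := by
  have e : (((Ren.add (id : Ren a a) (Ren.symm 1 1)).add (id : Ren b b)) i).val =
      if i.val = a then a + 1 else if i.val = a + 1 then a else i.val := by
    simp only [Ren.add_val, Ren.symm_val, id]
    split_ifs <;> omega
  by_cases c1 : i.val = a
  · rw [plugSubst_eq _ _ _ _ _ (by rw [e]; split_ifs; omega), plugSubst_eq _ _ _ _ _ c1,
      Val.ren_ren]
    congr 1
    funext j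
    apply Fin.ext
    simp only [Function.comp, Ren.cast_val, Ren.add_val, Ren.symm_val, midRen_val, id]
    split_ifs <;> omega
  · rcases lt_or_gt_of_ne c1 with c2 | c2
    · rw [plugSubst_lt _ _ _ _ _ c2, Val.ren,
        plugSubst_lt _ _ _ _ _ (by rw [e]; split_ifs <;> omega)]
      congr 1
      apply Fin.ext
      simp only [Ren.cast_val, Ren.add_val, Ren.symm_val, id]
      split_ifs <;> omega
    · rw [plugSubst_gt _ _ _ _ _ c2, Val.ren]
      by_cases c3 : i.val = a + 1
      · rw [plugSubst_lt _ _ _ _ _ (by rw [e]; split_ifs; omega)]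
        congr 1
        apply Fin.ext
        simp only [Ren.cast_val, Ren.add_val, Ren.symm_val, id]
        split_ifs <;> omega
      · rw [plugSubst_gt _ _ _ _ _ (by rw [e]; split_ifs; omega)]
        congr 1
        apply Fin.ext
        simp only [Ren.cast_val, Ren.add_val, Ren.symm_val, id]
        split_ifs <;> omega

theorem plugSubst_central (a m b : ℕ) {n₁ n₂ s t p q b₁ a₂ a₃ b₃ : ℕ} (W₁ : Val S n₁)
    (W₂ : Val S n₂) (hb₁ : b₁ = m + 1 + b) (ha₂ : a₂ = a + n₁ + m) (ha₃ : a₃ = a + 1 + m)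
    (hb₃ : b₃ = m + n₂ + b) (h1 : p = a + n₁ + b₁) (h2 : t = a + 1 + b₁) (h3 : s = a₂ + n₂ + b)
    (h4 : p = a₂ + 1 + b) (h5 : q = a₃ + n₂ + b) (h6 : t = a₃ + 1 + b) (h7 : s = a + n₁ + b₃)
    (h8 : q = a + 1 + b₃) (i : Fin t) :
    (plugSubst a b₁ W₁ h2 h1 i).subst (plugSubst a₂ b W₂ h4 h3) =
      (plugSubst a₃ b W₂ h6 h5 i).subst (plugSubst a b₃ W₁ h8 h7) := by
  have e₁ : ∀ j, plugSubst a₂ b W₂ h4 h3 (midRen a b₁ h1 j) = .var (midRen a b₃ h7 j) := by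
    intro j
    rw [plugSubst_lt _ _ _ _ _ (by rw [midRen_val]; omega)]; rfl
  have e₂ : ∀ j, plugSubst a b₃ W₁ h8 h7 (midRen a₃ b h5 j) = .var (midRen a₂ b h3 j) := by
    intro j
    rw [plugSubst_gt _ _ _ _ _ (by rw [midRen_val]; omega)]
    congr 1
    apply Fin.ext
    simp only [midRen_val]
    omega
  by_cases c1 : i.val = a
  · rw [plugSubst_eq _ _ _ _ _ c1, plugSubst_lt _ _ _ _ _ (by omega), Val.ren_subst, Val.subst,
      plugSubst_eq _ _ _ _ _ (by simp only; omega), Val.ren_eq_subst]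
    congr 1
    funext j
    exact e₁ j
  by_cases c2 : i.val = a₃
  · rw [plugSubst_eq _ _ _ _ _ c2, plugSubst_gt _ _ _ _ _ (by omega), Val.ren_subst, Val.subst,
      plugSubst_eq _ _ _ _ _ (by simp only; omega), Val.ren_eq_subst]
    congr 1
    funext j
    exact (e₂ j).symm
  rcases lt_or_gt_of_ne c1 with c3 | c3
  · rw [plugSubst_lt _ _ _ _ _ c3, plugSubst_lt _ _ _ _ _ (by omega), Val.subst, Val.subst,
      plugSubst_lt _ _ _ _ _ (by simp only; omega), plugSubst_lt _ _ _ _ _ (by simp only; omega)]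
  rcases lt_or_gt_of_ne c2 with c4 | c4
  · rw [plugSubst_gt _ _ _ _ _ c3, plugSubst_lt _ _ _ _ _ c4, Val.subst, Val.subst,
      plugSubst_lt _ _ _ _ _ (by simp only; omega),
      plugSubst_gt _ _ _ _ _ (by simp only; omega)]
  · rw [plugSubst_gt _ _ _ _ _ c3, plugSubst_gt _ _ _ _ _ c4, Val.subst, Val.subst,
      plugSubst_gt _ _ _ _ _ (by simp only; omega), plugSubst_gt _ _ _ _ _ (by simp only; omega)]
    congr 1
    apply Fin.ext
    simp only
    omega

theorem plugSubst_discard (a b : ℕ) {n : ℕ} (W : Val S n) (i : Fin (a + 0 + b)) :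
    plugSubst a b W rfl rfl (((Ren.add (id : Ren a a) (Ren.discard 1)).add (id : Ren b b)) i) =
      .var (((Ren.add (id : Ren a a) (Ren.discard n)).add (id : Ren b b)) i) := by
  have e : ∀ k, (((Ren.add (id : Ren a a) (Ren.discard k)).add (id : Ren b b)) i).val =
      if i.val < a then i.val else k + i.val := by
    intro k
    simp only [Ren.add_val, id]
    split_ifs <;> omega
  rcases lt_or_ge i.val a with h | h
  · rw [plugSubst_lt _ _ _ _ _ (by rw [e]; split_ifs <;> omega)]
    congr 1
    apply Fin.ext
    simp only [e]
    split_ifs <;> omega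
  · rw [plugSubst_gt _ _ _ _ _ (by rw [e]; split_ifs <;> omega)]
    congr 1
    apply Fin.ext
    simp only [e]
    split_ifs <;> omega

theorem plugSubst_copy (a b : ℕ) {n : ℕ} (W : Val S n) (h1 : a + (1 + 1) + b = a + 1 + (1 + b))
    (h2 : a + n + (1 + b) = a + n + 1 + b) (h3 : a + (n + n) + b = a + n + n + b)
    (i : Fin (a + (1 + 1) + b)) :
    plugSubst a b W rfl rfl (((Ren.add (id : Ren a a) (Ren.copy 1)).add (id : Ren b b)) i) =
      ((plugSubst a (1 + b) W h1 rfl i).subst (plugSubst (a + n) b W h2 h3)).ren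
        ((Ren.add (id : Ren a a) (Ren.copy n)).add (id : Ren b b)) := by
  have e : (((Ren.add (id : Ren a a) (Ren.copy 1)).add (id : Ren b b)) i).val =
      if i.val ≤ a then i.val else i.val - 1 := by
    simp only [Ren.add_val, Ren.copy_val, id]
    split_ifs <;> omega
  by_cases c1 : i.val = a
  · rw [plugSubst_eq _ _ _ _ _ (by rw [e]; split_ifs <;> omega), plugSubst_eq _ _ _ _ _ c1,
      Val.ren_subst, Val.subst_ren, Val.ren_eq_subst]
    congr 1
    funext j
    simp only [Function.comp]
    rw [plugSubst_lt _ _ _ _ _ (by rw [midRen_val]; omega), Val.ren]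
    congr 1
    apply Fin.ext
    simp only [Ren.add_val, Ren.copy_val, id, midRen_val]
    split_ifs <;> omega
  by_cases c2 : i.val = a + 1
  · rw [plugSubst_eq _ _ _ _ _ (by rw [e]; split_ifs <;> omega),
      plugSubst_gt _ _ _ _ _ (by omega), Val.subst, plugSubst_eq _ _ _ _ _ (by simp only; omega),
      Val.ren_ren]
    congr 1
    funext j
    apply Fin.ext
    simp only [Function.comp, Ren.add_val, Ren.copy_val, id, midRen_val]
    split_ifs <;> omega
  rcases lt_or_gt_of_ne c1 with c3 | c3
  · rw [plugSubst_lt _ _ _ _ _ (by rw [e]; split_ifs <;> omega), plugSubst_lt _ _ _ _ _ c3,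
      Val.subst, plugSubst_lt _ _ _ _ _ (by simp only; omega), Val.ren]
    congr 1
    apply Fin.ext
    simp only [Ren.add_val, Ren.copy_val, id]
    split_ifs <;> omega
  · rw [plugSubst_gt _ _ _ _ _ (by rw [e]; split_ifs <;> omega), plugSubst_gt _ _ _ _ _ c3,
      Val.subst, plugSubst_gt _ _ _ _ _ (by simp only; omega), Val.ren]
    congr 1
    apply Fin.ext
    simp only [Ren.add_val, Ren.copy_val, id]
    split_ifs <;> omega

/-- The rules for value substitutions hold in the term model. -/
theorem actsByRules_termVal : ActsByRules (termVal S) (fun _ _ => True) := by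
  intro s t x y h f
  induction f using Quotient.inductionOn with | _ V
  cases h with
  | unit_sub a b =>
    refine congrArg (Quotient.mk _) ?_
    change V.subst (plugSubst a b (.var 0) rfl rfl) = V
    rw [plugSubst_var, Val.subst_var]
  | unit_ren n =>
    refine congrArg (Quotient.mk _) ?_
    change V.ren id = V
    rw [Val.ren_eq_subst]
    exact Val.subst_var V
  | assoc a b c d g h hn =>
    induction g using Quotient.inductionOn with | _ W
    induction h using Quotient.inductionOn with | _ U
    refine congrArg (Quotient.mk _) ?_
    refine (Val.subst_subst _ _ _).trans (congrArg V.subst (funext fun i => ?_))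
    exact plugSubst_plug a b c d W U hn rfl rfl rfl rfl rfl (by omega) (by omega)
      rfl i
  | ren_ren r r' =>
    exact congrArg (Quotient.mk _) (Val.ren_ren V r r')
  | sub_ren g r₁ r r₂ =>
    induction g using Quotient.inductionOn with | _ W
    refine congrArg (Quotient.mk _) ?_
    refine (Val.subst_ren _ _ _).trans (.trans ?_ (Val.ren_subst _ _ _).symm)
    exact congrArg V.subst (funext fun i => plugSubst_ren W r₁ r r₂ i)
  | swap_left a b g =>
    induction g using Quotient.inductionOn with | _ W
    refine congrArg (Quotient.mk _) ?_
    refine (Val.ren_subst _ _ _).trans (.trans ?_ (Val.subst_ren _ _ _).symm)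
    exact congrArg V.subst (funext fun i => plugSubst_swap_left a b W (by omega) (by omega)
      (by omega) (by omega) rfl rfl i)
  | swap_right a b g =>
    induction g using Quotient.inductionOn with | _ W
    refine congrArg (Quotient.mk _) ?_
    refine (Val.ren_subst _ _ _).trans (.trans ?_ (Val.subst_ren _ _ _).symm)
    exact congrArg V.subst (funext fun i => plugSubst_swap_right a b W (by omega) (by omega)
      (by omega) (by omega) rfl rfl i)
  | central a m b g₁ g₂ hP =>
    induction g₁ using Quotient.inductionOn with | _ W₁
    induction g₂ using Quotient.inductionOn with | _ W₂
    refine congrArg (Quotient.mk _) ?_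
    refine (Val.subst_subst _ _ _).trans (.trans ?_ (Val.subst_subst _ _ _).symm)
    exact congrArg V.subst (funext fun i => plugSubst_central a m b W₁ W₂ rfl rfl rfl rfl
      rfl (by omega) rfl (by omega) rfl (by omega) (by omega) (by omega) i)
  | discard a b g hP =>
    induction g using Quotient.inductionOn with | _ W
    refine congrArg (Quotient.mk _) ?_
    refine (Val.ren_subst _ _ _).trans (.trans ?_ (Val.ren_eq_subst _ _).symm)
    exact congrArg V.subst (funext fun i => plugSubst_discard a b W i)
  | copy a b g hP =>
    induction g using Quotient.inductionOn with | _ W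
    refine congrArg (Quotient.mk _) ?_
    refine (Val.ren_subst _ _ _).trans (.trans ?_ (congrArg (fun z => Val.ren z _)
      (Val.subst_subst _ _ _)).symm)
    refine .trans ?_ (Val.subst_ren _ _ _).symm
    exact congrArg V.subst (funext fun i => plugSubst_copy a b W (by omega) (by omega) (by omega) i)

/-! ## Sequencing in the term model -/

theorem Cmp.plug_def {t s n : ℕ} (a b : ℕ) (M : Cmp S t) (N : Cmp S n) (ht : t = a + 1 + b)
    (hs : s = a + n + b) : M.plug a b N ht hs =
      .letIn (N.ren (midRen a b hs)) (M.ren (topRen a b ht hs)) := rfl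

theorem topRen_midRen_val {t s n k : ℕ} (a b a' b' : ℕ) (ht : t = a' + 1 + b')
    (hs : s = a' + n + b') (hk : t = a + k + b) (j : Fin k) :
    (topRen a' b' ht hs (midRen a b hk j)).val = if a + j.val < a' then a + j.val else
      if a + j.val = a' then s else a + j.val - 1 + n := topRen_val _ _ _ _ _

theorem Cmp.plug_plug (a b c d : ℕ) {t s n k m a' b' : ℕ} (M : Cmp S t) (N : Cmp S n) (L : Cmp S k)
    (hn : n = c + 1 + d) (hm : m = c + k + d) (ht : t = a + 1 + b) (h1 : s = a + n + b)
    (ha : a' = a + c) (hb : b' = d + b) {p : ℕ} (h2 : s = a' + 1 + b') (h3 : p = a' + k + b')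
    (h4 : p = a + m + b) :
    CmpEq ((M.plug a b N ht h1).plug a' b' L h2 h3)
      (M.plug a b (N.plug c d L hn hm) ht h4) := by
  simp only [plug_def, Cmp.ren, Cmp.ren_ren]
  refine .symm (.trans (.assoc _ _ _) ?_)
  simp only [Cmp.ren_ren]
  have e1 : midRen a b h4 ∘ midRen c d hm = midRen a' b' h3 := by
    funext i
    apply Fin.ext
    simp only [Function.comp, midRen_val]
    omega
  have e2 : (midRen a b h4).lift ∘ topRen c d hn hm = topRen a' b' h2 h3 ∘ midRen a b h1 := by
    funext i
    apply Fin.ext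
    simp only [Function.comp, Ren.lift_val, midRen_val, topRen_midRen_val]
    simp only [topRen_val]
    split_ifs <;> omega
  have e3 : Ren.lift Fin.castSucc ∘ topRen a b ht h4 =
      (topRen a' b' h2 h3).lift ∘ topRen a b ht h1 := by
    funext i
    apply Fin.ext
    simp only [Function.comp, Ren.lift_val, topRen_val, Fin.val_castSucc]
    split_ifs <;> omega
  rw [e1, e2, e3]
  exact .refl _

theorem Cmp.plug_ren {a a' b b' n n' : ℕ} (M : Cmp S (a + 1 + b)) (N : Cmp S n) (r₁ : Ren a a')
    (r : Ren n n') (r₂ : Ren b b') :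
    (M.plug a b N rfl rfl).ren ((r₁.add r).add r₂) =
      (M.ren ((r₁.add (id : Ren 1 1)).add r₂)).plug a' b' (N.ren r) rfl rfl := by
  simp only [plug_def, Cmp.ren, Cmp.ren_ren]
  congr 2
  · funext i
    have e : midRen a b rfl i = Fin.castAdd b (Fin.natAdd a i) := rfl
    have e' : midRen a' b' rfl (r i) = Fin.castAdd b' (Fin.natAdd a' (r i)) := rfl
    simp only [Function.comp, e, e']
    simp [Ren.add]
  · funext i
    induction i using Fin.addCases with
    | left i =>
      induction i using Fin.addCases with
      | left i =>
        have e : topRen a b (n := n) rfl rfl (Fin.castAdd b (Fin.castAdd 1 i)) =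
          Fin.castSucc (Fin.castAdd b (Fin.castAdd n i)) := by
          apply Fin.ext; rw [topRen_val]; simp
        simp only [Function.comp, e]
        apply Fin.ext
        simp [Ren.add, topRen_val, Ren.lift]
      | right i =>
        obtain rfl : i = 0 := Subsingleton.elim _ _
        have e : topRen a b (n := n) rfl rfl (Fin.castAdd b (Fin.natAdd a (0 : Fin 1))) =
          Fin.last _ := by
          apply Fin.ext; rw [topRen_val]; simp
        simp only [Function.comp, e]
        apply Fin.ext
        simp [Ren.add, topRen_val, Ren.lift]
    | right i =>
      have e : topRen a b (n := n) rfl rfl (Fin.natAdd (a + 1) i) =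
        Fin.castSucc (Fin.natAdd (a + n) i) := by
        apply Fin.ext; rw [topRen_val]; simp; split_ifs <;> omega
      simp only [Function.comp, e]
      apply Fin.ext
      rw [Ren.lift, Fin.lastCases_castSucc, topRen_val]
      simp only [Ren.add, Fin.addCases_right, Fin.val_castSucc, Fin.val_natAdd]
      split_ifs <;> omega

theorem Cmp.plug_swap_left (a b : ℕ) {n p q : ℕ} (M : Cmp S (a + (1 + 1) + b)) (N : Cmp S n)
    (h1 : a + (1 + 1) + b = a + 1 + (1 + b)) (h2 : p = a + n + (1 + b))
    (h3 : a + (1 + 1) + b = a + 1 + 1 + b) (h4 : q = a + 1 + n + b) (hp : p = a + (n + 1) + b)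
    (hq : q = a + (1 + n) + b) :
    (M.ren ((Ren.add (id : Ren a a) (Ren.symm 1 1)).add (id : Ren b b))).plug a (1 + b) N h1 h2 =
    (M.plug (a + 1) b N h3 h4).ren (Ren.cast hq.symm hp.symm
      ((Ren.add (id : Ren a a) (Ren.symm 1 n)).add (id : Ren b b))) := by
  simp only [plug_def, Cmp.ren, Cmp.ren_ren]
  congr 2
  · funext i
    apply Fin.ext
    simp only [Function.comp, Ren.cast_val, Ren.add_val, Ren.symm_val, midRen_val, id]
    split_ifs <;> omega
  · have e : ∀ i, (((Ren.add (id : Ren a a) (Ren.symm 1 1)).add (id : Ren b b)) i).val =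
        if i.val = a then a + 1 else if i.val = a + 1 then a else i.val := by
      intro i
      simp only [Ren.add_val, Ren.symm_val, id]
      split_ifs <;> omega
    have e' : ∀ i, (Ren.cast hq.symm hp.symm
        ((Ren.add (id : Ren a a) (Ren.symm 1 n)).add (id : Ren b b)) i).val =
        if i.val = a then a + n else if a < i.val ∧ i.val ≤ a + n then i.val - 1 else i.val := by
      intro i
      simp only [Ren.cast_val, Ren.add_val, Ren.symm_val, id]
      split_ifs <;> omega
    funext i
    apply Fin.ext
    simp only [Function.comp, Ren.lift_val, topRen_val, e, e']
    split_ifs <;> omega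

theorem Cmp.plug_swap_right (a b : ℕ) {n p q : ℕ} (M : Cmp S (a + (1 + 1) + b)) (N : Cmp S n)
    (h1 : a + (1 + 1) + b = a + 1 + 1 + b) (h2 : p = a + 1 + n + b)
    (h3 : a + (1 + 1) + b = a + 1 + (1 + b)) (h4 : q = a + n + (1 + b)) (hp : p = a + (1 + n) + b)
    (hq : q = a + (n + 1) + b) :
    (M.ren ((Ren.add (id : Ren a a) (Ren.symm 1 1)).add (id : Ren b b))).plug (a + 1) b N h1 h2 =
    (M.plug a (1 + b) N h3 h4).ren (Ren.cast hq.symm hp.symm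
      ((Ren.add (id : Ren a a) (Ren.symm n 1)).add (id : Ren b b))) := by
  simp only [plug_def, Cmp.ren, Cmp.ren_ren]
  congr 2
  · funext i
    apply Fin.ext
    simp only [Function.comp, Ren.cast_val, Ren.add_val, Ren.symm_val, midRen_val, id]
    split_ifs <;> omega
  · have e : ∀ i, (((Ren.add (id : Ren a a) (Ren.symm 1 1)).add (id : Ren b b)) i).val =
        if i.val = a then a + 1 else if i.val = a + 1 then a else i.val := by
      intro i
      simp only [Ren.add_val, Ren.symm_val, id]
      split_ifs <;> omega
    have e' : ∀ i, (Ren.cast hq.symm hp.symm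
        ((Ren.add (id : Ren a a) (Ren.symm n 1)).add (id : Ren b b)) i).val =
        if i.val = a + n then a else if a ≤ i.val ∧ i.val < a + n then i.val + 1 else i.val := by
      intro i
      simp only [Ren.cast_val, Ren.add_val, Ren.symm_val, id]
      split_ifs <;> omega
    funext i
    apply Fin.ext
    simp only [Function.comp, Ren.lift_val, topRen_val, e, e']
    split_ifs <;> omega

theorem Cmp.plug_central_left (a m b : ℕ) {n₁ n₂ s t p q b₁ a₂ a₃ b₃ : ℕ} (M : Cmp S t)
    (W : Val S n₁) (N : Cmp S n₂) (hb₁ : b₁ = m + 1 + b) (ha₂ : a₂ = a + n₁ + m)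
    (ha₃ : a₃ = a + 1 + m) (hb₃ : b₃ = m + n₂ + b) (h1 : p = a + n₁ + b₁) (h2 : t = a + 1 + b₁)
    (h3 : s = a₂ + n₂ + b) (h4 : p = a₂ + 1 + b) (h5 : q = a₃ + n₂ + b) (h6 : t = a₃ + 1 + b)
    (h7 : s = a + n₁ + b₃) (h8 : q = a + 1 + b₃) :
    CmpEq ((M.plug a b₁ (.ret W) h2 h1).plug a₂ b N h4 h3)
      ((M.plug a₃ b N h6 h5).plug a b₃ (.ret W) h8 h7) := by
  refine .trans (.plug _ _ (Cmp.plug_ret a b₁ W h2 h1 M) (.refl N) h4 h3) ?_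
  refine .trans ?_ (.symm (Cmp.plug_ret _ _ _ _ _ _))
  simp only [plug_def, Cmp.subst, Cmp.ren_subst, Cmp.subst_ren]
  have e1 : plugSubst a b₃ W h8 h7 ∘ midRen a₃ b h5 = fun j => .var (midRen a₂ b h3 j) := by
    funext j
    rw [Function.comp, plugSubst_gt _ _ _ _ _ (by rw [midRen_val]; omega)]
    congr 1
    apply Fin.ext
    simp only [midRen_val]
    omega
  have e2 : (fun i => (plugSubst a b₁ W h2 h1 i).ren (topRen a₂ b h4 h3)) =
      liftSubst (plugSubst a b₃ W h8 h7) ∘ topRen a₃ b h6 h5 := by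
    funext i
    have key : ∀ j : Fin q, (topRen a₃ b h6 h5 i).val = j.val →
        liftSubst (plugSubst a b₃ W h8 h7) (topRen a₃ b h6 h5 i) =
          (plugSubst a b₃ W h8 h7 j).ren Fin.castSucc := by
      intro j hj
      have : topRen a₃ b h6 h5 i = j.castSucc := Fin.ext hj
      rw [this, liftSubst, Fin.lastCases_castSucc]
    rw [Function.comp]
    by_cases c1 : i.val = a₃
    · have : topRen a₃ b h6 h5 i = Fin.last q := Fin.ext (by
        rw [topRen_val, Fin.val_last]; split_ifs <;> omega)
      rw [this, liftSubst, Fin.lastCases_last, plugSubst_gt _ _ _ _ _ (by omega), Val.ren]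
      congr 1
      apply Fin.ext
      simp only [topRen_val, Fin.val_last]
      split_ifs <;> omega
    rw [key ⟨if i.val < a₃ then i.val else i.val - 1 + n₂, by split_ifs <;> omega⟩
      (by rw [topRen_val]; dsimp only; split_ifs <;> omega)]
    by_cases c2 : i.val = a
    · rw [plugSubst_eq _ _ _ _ _ c2, plugSubst_eq _ _ _ _ _ (by dsimp only; split_ifs <;> omega),
        Val.ren_ren, Val.ren_ren]
      congr 1
      funext j
      apply Fin.ext
      simp only [Function.comp, topRen_midRen_val, midRen_val, Fin.val_castSucc]
      split_ifs <;> omega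
    rcases lt_or_gt_of_ne c2 with c3 | c3
    · rw [plugSubst_lt _ _ _ _ _ c3, plugSubst_lt _ _ _ _ _ (by dsimp only; split_ifs <;> omega),
        Val.ren, Val.ren]
      congr 1
      apply Fin.ext
      simp only [topRen_val, Fin.val_castSucc]
      split_ifs <;> omega
    · rw [plugSubst_gt _ _ _ _ _ c3, plugSubst_gt _ _ _ _ _ (by dsimp only; split_ifs <;> omega),
        Val.ren, Val.ren]
      congr 1
      apply Fin.ext
      simp only [topRen_val, Fin.val_castSucc]
      split_ifs <;> omega
  rw [e1, e2, ← Cmp.ren_eq_subst]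
  exact .refl _

theorem Cmp.plug_central_right (a m b : ℕ) {n₁ n₂ s t p q b₁ a₂ a₃ b₃ : ℕ} (M : Cmp S t)
    (N : Cmp S n₁) (W : Val S n₂) (hb₁ : b₁ = m + 1 + b) (ha₂ : a₂ = a + n₁ + m)
    (ha₃ : a₃ = a + 1 + m) (hb₃ : b₃ = m + n₂ + b) (h1 : p = a + n₁ + b₁) (h2 : t = a + 1 + b₁)
    (h3 : s = a₂ + n₂ + b) (h4 : p = a₂ + 1 + b) (h5 : q = a₃ + n₂ + b) (h6 : t = a₃ + 1 + b)
    (h7 : s = a + n₁ + b₃) (h8 : q = a + 1 + b₃) :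
    CmpEq ((M.plug a b₁ N h2 h1).plug a₂ b (.ret W) h4 h3)
      ((M.plug a₃ b (.ret W) h6 h5).plug a b₃ N h8 h7) := by
  refine .symm (.trans (.plug _ _ (Cmp.plug_ret _ _ W h6 h5 M) (.refl N) h8 h7) ?_)
  refine .trans ?_ (.symm (Cmp.plug_ret _ _ _ _ _ _))
  simp only [plug_def, Cmp.subst, Cmp.ren_subst, Cmp.subst_ren]
  have e1 : plugSubst a₂ b W h4 h3 ∘ midRen a b₁ h1 = fun j => .var (midRen a b₃ h7 j) := by
    funext j
    rw [Function.comp, plugSubst_lt _ _ _ _ _ (by rw [midRen_val]; omega)]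
    rfl
  have e2 : (fun i => (plugSubst a₃ b W h6 h5 i).ren (topRen a b₃ h8 h7)) =
      liftSubst (plugSubst a₂ b W h4 h3) ∘ topRen a b₁ h2 h1 := by
    funext i
    have key : ∀ j : Fin p, (topRen a b₁ h2 h1 i).val = j.val →
        liftSubst (plugSubst a₂ b W h4 h3) (topRen a b₁ h2 h1 i) =
          (plugSubst a₂ b W h4 h3 j).ren Fin.castSucc := by
      intro j hj
      have : topRen a b₁ h2 h1 i = j.castSucc := Fin.ext hj
      rw [this, liftSubst, Fin.lastCases_castSucc]
    rw [Function.comp]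
    by_cases c1 : i.val = a
    · have : topRen a b₁ h2 h1 i = Fin.last p := Fin.ext (by
        rw [topRen_val, Fin.val_last]; split_ifs <;> omega)
      rw [this, liftSubst, Fin.lastCases_last, plugSubst_lt _ _ _ _ _ (by omega), Val.ren]
      congr 1
      apply Fin.ext
      simp only [topRen_val, Fin.val_last]
      split_ifs <;> omega
    rw [key ⟨if i.val < a then i.val else i.val - 1 + n₁, by split_ifs <;> omega⟩
      (by rw [topRen_val]; dsimp only; split_ifs <;> omega)]
    by_cases c2 : i.val = a₃
    · rw [plugSubst_eq _ _ _ _ _ c2, plugSubst_eq _ _ _ _ _ (by dsimp only; split_ifs <;> omega),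
        Val.ren_ren, Val.ren_ren]
      congr 1
      funext j
      apply Fin.ext
      simp only [Function.comp, topRen_midRen_val, midRen_val, Fin.val_castSucc]
      split_ifs <;> omega
    rcases lt_or_gt_of_ne c2 with c3 | c3
    · rw [plugSubst_lt _ _ _ _ _ c3, plugSubst_lt _ _ _ _ _ (by dsimp only; split_ifs <;> omega),
        Val.ren, Val.ren]
      congr 1
      apply Fin.ext
      simp only [topRen_val, Fin.val_castSucc]
      split_ifs <;> omega
    · rw [plugSubst_gt _ _ _ _ _ c3, plugSubst_gt _ _ _ _ _ (by dsimp only; split_ifs <;> omega),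
        Val.ren, Val.ren]
      congr 1
      apply Fin.ext
      simp only [topRen_val, Fin.val_castSucc]
      split_ifs <;> omega
  rw [e1, e2, ← Cmp.ren_eq_subst]
  exact .refl _

theorem exists_ret_of_isPure {n : ℕ} {g : (termCmp S).Op n} (h : (termModel S).IsPure g) :
    ∃ W : Val S n, g = (⟦.ret W⟧ : Quotient (cmpSetoid S n)) := by
  obtain ⟨f, rfl⟩ := h
  induction f using Quotient.inductionOn with | _ W
  exact ⟨W, rfl⟩

/-- The rules for computation substitutions hold in the term model. -/
theorem actsByRules_termCmp : ActsByRules (termCmp S) (fun _ => (termModel S).IsPure) := by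
  intro s t x y h f
  induction f using Quotient.inductionOn with | _ M
  cases h with
  | unit_sub a b =>
    refine Quotient.sound ((Cmp.plug_ret a b (.var 0) rfl rfl M).trans ?_)
    rw [plugSubst_var, Cmp.subst_var]
    exact .refl _
  | unit_ren n =>
    refine congrArg (Quotient.mk _) ?_
    change M.ren id = M
    rw [Cmp.ren_eq_subst]
    exact Cmp.subst_var M
  | assoc a b c d g h hn =>
    induction g using Quotient.inductionOn with | _ N
    induction h using Quotient.inductionOn with | _ L
    exact Quotient.sound (Cmp.plug_plug a b c d M N L hn rfl rfl rfl rfl rfl (by omega) (by omega)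
      rfl)
  | ren_ren r r' =>
    exact congrArg (Quotient.mk _) (Cmp.ren_ren M r r')
  | sub_ren g r₁ r r₂ =>
    induction g using Quotient.inductionOn with | _ N
    exact congrArg (Quotient.mk _) (Cmp.plug_ren M N r₁ r r₂)
  | swap_left a b g =>
    induction g using Quotient.inductionOn with | _ N
    exact congrArg (Quotient.mk _) (Cmp.plug_swap_left a b M N (by omega) (by omega) (by omega)
      (by omega) rfl rfl)
  | swap_right a b g =>
    induction g using Quotient.inductionOn with | _ N
    exact congrArg (Quotient.mk _) (Cmp.plug_swap_right a b M N (by omega) (by omega) (by omega)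
      (by omega) rfl rfl)
  | central a m b g₁ g₂ hP =>
    rcases hP with hP | hP
    · obtain ⟨W, rfl⟩ := exists_ret_of_isPure hP
      induction g₂ using Quotient.inductionOn with | _ N
      exact Quotient.sound (Cmp.plug_central_left a m b M W N rfl rfl rfl rfl
        rfl (by omega) rfl (by omega) rfl (by omega) (by omega) (by omega))
    · obtain ⟨W, rfl⟩ := exists_ret_of_isPure hP
      induction g₁ using Quotient.inductionOn with | _ N
      exact Quotient.sound (Cmp.plug_central_right a m b M N W rfl rfl rfl rfl
        rfl (by omega) rfl (by omega) rfl (by omega) (by omega) (by omega))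
  | discard a b g hP =>
    obtain ⟨W, rfl⟩ := exists_ret_of_isPure hP
    refine Quotient.sound ((Cmp.plug_ret a b W rfl rfl _).trans ?_)
    beta_reduce
    rw [Cmp.ren_subst, Cmp.ren_eq_subst]
    exact (congrArg (CmpEq · _) (congrArg M.subst
      (funext fun i => plugSubst_discard a b W i))).mpr (.refl _)
  | copy a b g hP =>
    obtain ⟨W, rfl⟩ := exists_ret_of_isPure hP
    refine Quotient.sound ((Cmp.plug_ret a b W rfl rfl _).trans (.symm (.trans (.ren (.trans
      (.plug _ _ (Cmp.plug_ret a (1 + b) W (by omega) rfl M) (.refl _) (by omega) (by omega))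
      (Cmp.plug_ret _ _ _ _ _ _)) _) ?_)))
    rw [Cmp.subst_subst, Cmp.subst_ren, Cmp.ren_subst]
    exact (congrArg (CmpEq · _) (congrArg M.subst
      (funext fun i => (plugSubst_copy a b W (by omega) (by omega) (by omega) i).symm))).mpr
        (.refl _)

/-! ## The Freyd PROP of substitutions -/

namespace FreydOperadData

variable {F : FreydOperadData.{u}}

theorem J_comp {l m n : ℕ} (g : (CSub F).Hom m n) (f : (CSub F).Hom l m) :
    (freydPropOfSubstitutions F).J ((CSub F).comp g f) =
      (Sub F).comp ((freydPropOfSubstitutions F).J g) ((freydPropOfSubstitutions F).J f) := by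
  induction f using Quot.ind with | _ x
  induction g using Quot.ind with | _ y
  exact congrArg (Quot.mk _) (Word.ret_append F y x)

theorem J_whiskerL (k : ℕ) {m n : ℕ} (f : (CSub F).Hom m n) :
    (freydPropOfSubstitutions F).J ((CSub F).whiskerL k f) =
      (Sub F).whiskerL k ((freydPropOfSubstitutions F).J f) := by
  induction f using Subs.ind' with
  | nil => rfl
  | ren r => rfl
  | sub a b g hs ht => rfl
  | comp y x hy hx =>
    refine (congrArg _ (Subs.whiskerL_comp k y x)).trans ((J_comp _ _).trans ?_)
    refine (congrArg₂ (Sub F).comp hy hx).trans ?_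
    exact (Subs.whiskerL_comp k _ _).symm.trans (congrArg _ (J_comp y x).symm)

theorem J_whiskerR {m n : ℕ} (f : (CSub F).Hom m n) (k : ℕ) :
    (freydPropOfSubstitutions F).J ((CSub F).whiskerR f k) =
      (Sub F).whiskerR ((freydPropOfSubstitutions F).J f) k := by
  induction f using Subs.ind' with
  | nil => rfl
  | ren r => rfl
  | sub a b g hs ht => rfl
  | comp y x hy hx =>
    refine (congrArg _ (Subs.whiskerR_comp k y x)).trans ((J_comp _ _).trans ?_)
    refine (congrArg₂ (Sub F).comp hy hx).trans ?_
    exact (Subs.whiskerR_comp k _ _).symm.trans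
      (congrArg (fun z => (Sub F).whiskerR z k) (J_comp y x).symm)

theorem J_central (hC : ∀ {n : ℕ} (g : F.C.Op n), F.C.ren g id = g) {m n : ℕ}
    (f : (CSub F).Hom m n) : (Sub F).IsCentral ((freydPropOfSubstitutions F).J f) := by
  have key : ∀ {m' n' : ℕ} (g : (Sub F).Hom m' n'),
      Subs.Interchange ((freydPropOfSubstitutions F).J f) g ∧
        Subs.Interchange g ((freydPropOfSubstitutions F).J f) := by
    intro m' n' g
    induction f using Subs.ind' with
    | nil => exact ⟨Subs.interchange_nil_left _ _, Subs.interchange_nil_right _ _⟩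
    | ren r => exact ⟨Subs.interchange_ren_left hC r g, Subs.interchange_ren_right hC g r⟩
    | comp y x hy hx =>
      have e := J_comp y x
      change (freydPropOfSubstitutions F).J (Subs.comp y x) = Subs.comp _ _ at e
      rw [e]
      exact ⟨hy.1.comp_left hx.1, hy.2.comp_right hx.2⟩
    | sub a b v hs ht =>
      change Subs.Interchange (Subs.sub a b (F.ret v) hs ht) g ∧
        Subs.Interchange g (Subs.sub a b (F.ret v) hs ht)
      induction g using Subs.ind' with
      | nil => exact ⟨Subs.interchange_nil_right _ _, Subs.interchange_nil_left _ _⟩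
      | ren r => exact ⟨Subs.interchange_ren_right hC _ r, Subs.interchange_ren_left hC r _⟩
      | comp y x hy hx => exact ⟨hy.1.comp_right hx.1, hy.2.comp_left hx.2⟩
      | sub c d k hs' ht' =>
        exact ⟨Subs.interchange_sub_sub _ _ (.inl ⟨v, rfl⟩) _ _ _ _,
          Subs.interchange_sub_sub _ _ (.inr ⟨v, rfl⟩) _ _ _ _⟩
  exact fun {_ _} g => key g

theorem isFreydProp (hV : ∀ {n : ℕ} (g : F.V.Op n), F.V.ren g id = g)
    (hC : ∀ {n : ℕ} (g : F.C.Op n), F.C.ren g id = g) :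
    (freydPropOfSubstitutions F).IsFreydProp where
  V_cartesian := Subs.isCartesianProp hV
  C_preProp := Subs.isPreProp hC
  J_id _ := rfl
  J_comp := J_comp
  J_whiskerL := J_whiskerL
  J_whiskerR := J_whiskerR
  J_symm _ _ := rfl
  J_central := J_central hC

end FreydOperadData

theorem termVal_ren_id {n : ℕ} (g : (termVal S).Op n) : (termVal S).ren g id = g :=
  actsByRules_termVal (.unit_ren n) g

theorem termCmp_ren_id {n : ℕ} (g : (termCmp S).Op n) : (termCmp S).ren g id = g :=
  actsByRules_termCmp (.unit_ren n) g

theorem csub_isCartesianProp : (CSub (termModel S)).IsCartesianProp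
    (fun n => Subs.ren (Ren.copy n)) (fun n => Subs.ren (Ren.discard n)) :=
  Subs.isCartesianProp termVal_ren_id

theorem csub_isPreProp : (CSub (termModel S)).IsPreProp := csub_isCartesianProp.toIsPreProp

theorem sub_isPreProp : (Sub (termModel S)).IsPreProp := Subs.isPreProp termCmp_ren_id

/-- The value that a substitution with codomain `1` represents. -/
def valOf {n : ℕ} (x : (CSub (termModel S)).Hom n 1) : (termModel S).V.Op n :=
  Subs.toOp (O := termVal S) actsByRules_termVal x

/-- The computation that a substitution with codomain `1` represents. -/
def cmpOf {n : ℕ} (x : (Sub (termModel S)).Hom n 1) : (termModel S).C.Op n :=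
  Subs.toOp (O := termCmp S) actsByRules_termCmp x

theorem single_cmpOf {n : ℕ} (x : (Sub (termModel S)).Hom n 1) : Subs.single (cmpOf x) = x :=
  Subs.single_toOp (O := termCmp S) actsByRules_termCmp x

theorem midRen_zero {n : ℕ} (hs : n = 0 + n + 0) : midRen 0 0 hs = (id : Ren n n) :=
  funext fun _ => Fin.ext (Nat.zero_add _)

theorem valOf_single {n : ℕ} (g : (termModel S).V.Op n) : valOf (Subs.single g) = g := by
  induction g using Quotient.inductionOn with | _ V
  refine congrArg (Quotient.mk _) ?_
  change V.ren (midRen 0 0 _) = V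
  rw [midRen_zero, Val.ren_eq_subst]
  exact Val.subst_var V

theorem cmpOf_single {n : ℕ} (g : (termModel S).C.Op n) : cmpOf (Subs.single g) = g := by
  induction g using Quotient.inductionOn with | _ M
  refine Quotient.sound ?_
  change CmpEq (.letIn (M.ren (midRen 0 0 _)) (.ret (.var (Fin.last n)))) M
  rw [midRen_zero, Cmp.ren_eq_subst]
  refine .trans (.runit _) ?_
  change CmpEq (M.subst Val.var) M
  rw [Cmp.subst_var]
  exact .refl _

/-- Abstraction on substitutions with codomain `1`. -/
def termAbs (S : Signature.{u}) (n : ℕ) (x : (Sub (termModel S)).Hom (n + 1) 1) :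
    (CSub (termModel S)).Hom n 1 :=
  Subs.single (termModel.abs (cmpOf x))

theorem isTermAbs_termAbs : IsTermAbs S (termAbs S) := fun _ c =>
  congrArg (fun z => Subs.single (termModel.abs z)) (cmpOf_single c)

theorem IsTermAbs.eq_termAbs {abs : ∀ n : ℕ, (Sub (termModel S)).Hom (n + 1) 1 →
    (CSub (termModel S)).Hom n 1} (h : IsTermAbs S abs) : abs = termAbs S := by
  funext n x
  conv_lhs => rw [← single_cmpOf x]
  exact h n _

theorem liftSubst_plugSubst {t s n : ℕ} (a b : ℕ) (W : Val S n) (ht : t = a + 1 + b)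
    (hs : s = a + n + b) : liftSubst (plugSubst a b W ht hs) =
      plugSubst a (b + 1) W (by omega) (by omega) := by
  funext i
  induction i using Fin.lastCases with
  | last =>
    rw [liftSubst, Fin.lastCases_last, plugSubst_gt _ _ _ _ _ (by simp; omega)]
    congr 1
    apply Fin.ext
    simp
    omega
  | cast i =>
    rw [liftSubst, Fin.lastCases_castSucc]
    rcases lt_trichotomy i.val a with h | h | h
    · rw [plugSubst_lt _ _ _ _ _ h, plugSubst_lt _ _ _ _ _ (by simpa using h), Val.ren]
      rfl
    · rw [plugSubst_eq _ _ _ _ _ h, plugSubst_eq _ _ _ _ _ (by simpa using h), Val.ren_ren]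
      rfl
    · rw [plugSubst_gt _ _ _ _ _ h, plugSubst_gt _ _ _ _ _ (by simpa using h), Val.ren]
      rfl

/-- Precomposition with a substitution of values is a simultaneous substitution. -/
theorem exists_subst {m n : ℕ} (x : (CSub (termModel S)).Hom m n) : ∃ σ : Fin n → Val S m,
    (∀ V : Val S n, (CSub (termModel S)).comp (Subs.single (⟦V⟧ : Quotient (valSetoid S n))) x =
      Subs.single (⟦V.subst σ⟧ : Quotient (valSetoid S m))) ∧
    (∀ M : Cmp S n, (Sub (termModel S)).comp (Subs.single (⟦M⟧ : Quotient (cmpSetoid S n)))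
        ((freydPropOfSubstitutions (termModel S)).J x) =
      Subs.single (⟦M.subst σ⟧ : Quotient (cmpSetoid S m))) ∧
    (∀ M : Cmp S (n + 1), (Sub (termModel S)).comp
        (Subs.single (⟦M⟧ : Quotient (cmpSetoid S (n + 1))))
        ((Sub (termModel S)).whiskerR ((freydPropOfSubstitutions (termModel S)).J x) 1) =
      Subs.single (⟦M.subst (liftSubst σ)⟧ : Quotient (cmpSetoid S (m + 1)))) := by
  induction x using Subs.ind' with
  | nil n =>
    refine ⟨Val.var, fun V => ?_, fun M => ?_, fun M => ?_⟩
    · rw [Val.subst_var]; exact csub_isPreProp.comp_id _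
    · rw [Cmp.subst_var]; exact sub_isPreProp.comp_id _
    · rw [liftSubst_var, Cmp.subst_var]; exact sub_isPreProp.comp_id _
  | ren r =>
    refine ⟨fun i => .var (r i), fun V => ?_, fun M => ?_, fun M => ?_⟩
    · rw [← Val.ren_eq_subst]; exact Subs.single_comp_ren (O := termVal S) _ r
    · rw [← Cmp.ren_eq_subst]; exact Subs.single_comp_ren (O := termCmp S) _ r
    · have e : liftSubst (fun i => (Val.var (r i) : Val S _)) = fun i => .var (r.lift i) := by
        funext i
        induction i using Fin.lastCases with
        | last => simp [liftSubst, Ren.lift]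
        | cast i => simp [liftSubst, Ren.lift, Val.ren]
      rw [e, ← Cmp.ren_eq_subst, Ren.lift_eq_add]
      exact Subs.single_comp_ren (O := termCmp S) _ (r.add id)
  | sub a b g hs ht =>
    induction g using Quotient.inductionOn with | _ W
    refine ⟨plugSubst a b W ht hs, fun V => ?_, fun M => ?_, fun M => ?_⟩
    · exact Subs.single_comp_sub (O := termVal S) _ a b _ hs ht
    · refine (Subs.single_comp_sub (O := termCmp S) _ a b _ hs ht).trans
        (congrArg Subs.single (Quotient.sound ?_))
      exact Cmp.plug_ret a b W ht hs M
    · refine (Subs.single_comp_sub (O := termCmp S) _ a (b + 1) _ (by omega) (by omega)).trans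
        (congrArg Subs.single (Quotient.sound ?_))
      rw [liftSubst_plugSubst]
      exact Cmp.plug_ret a (b + 1) W _ _ M
  | comp y x hy hx =>
    obtain ⟨σ, h1, h2, h3⟩ := hy
    obtain ⟨τ, h1', h2', h3'⟩ := hx
    refine ⟨fun i => (σ i).subst τ, fun V => ?_, fun M => ?_, fun M => ?_⟩
    · rw [← Val.subst_subst, ← h1', ← h1]
      exact (csub_isPreProp.assoc _ _ _).symm
    · rw [← Cmp.subst_subst, ← h2', ← h2]
      exact (congrArg _ (FreydOperadData.J_comp y x)).trans (sub_isPreProp.assoc _ _ _).symm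
    · rw [← liftSubst_subst, ← Cmp.subst_subst, ← h3', ← h3]
      refine (congrArg _ ((congrArg (fun z => (Sub (termModel S)).whiskerR z 1)
        (FreydOperadData.J_comp y x)).trans (sub_isPreProp.whiskerR_comp 1 _ _))).trans
        (sub_isPreProp.assoc _ _ _).symm

theorem termAbs_natural {m n : ℕ} (f : (Sub (termModel S)).Hom (n + 1) 1)
    (v : (CSub (termModel S)).Hom m n) :
    termAbs S m ((Sub (termModel S)).comp f
      ((Sub (termModel S)).whiskerR ((freydPropOfSubstitutions (termModel S)).J v) 1)) =
    (CSub (termModel S)).comp (termAbs S n f) v := by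
  obtain ⟨c, rfl⟩ : ∃ c, Subs.single c = f := ⟨_, single_cmpOf f⟩
  induction c using Quotient.inductionOn with | _ M
  obtain ⟨σ, h1, -, h3⟩ := exists_subst v
  refine (congrArg (termAbs S m) (h3 M)).trans ((isTermAbs_termAbs m _).trans ?_)
  refine .trans ?_ (congrArg (fun z => (CSub (termModel S)).comp z v)
    (isTermAbs_termAbs n _)).symm
  exact (h1 (.lam M)).symm

theorem app_termAbs {n : ℕ} (f : (Sub (termModel S)).Hom (n + 1) 1) :
    (Sub (termModel S)).comp (Subs.single (termModel.app S))
      ((Sub (termModel S)).whiskerR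
        ((freydPropOfSubstitutions (termModel S)).J (termAbs S n f)) 1) = f := by
  obtain ⟨c, rfl⟩ : ∃ c, Subs.single c = f := ⟨_, single_cmpOf f⟩
  rw [isTermAbs_termAbs]
  induction c using Quotient.inductionOn with | _ M
  refine (Subs.single_comp_sub (O := termCmp S) _ 0 1 _ (by omega) (by omega)).trans
    (congrArg Subs.single (Quotient.sound ?_))
  refine .trans (Cmp.plug_ret 0 1 (.lam M) (by omega) (by omega) _) ?_
  rw [Cmp.subst, Val.subst, Val.subst, plugSubst_eq (i := 0) 0 _ _ _ _ rfl,
    plugSubst_gt (i := 1) 0 _ _ _ _ (by simp),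
    Val.ren]
  refine .trans (.beta _ _) ?_
  rw [Cmp.ren_subst]
  have e : ∀ (h : (1 : Fin 2).val - 1 + n < n + 1) h',
      single (Val.var ⟨(1 : Fin 2).val - 1 + n, h⟩) ∘ (midRen 0 1 h').lift =
        (Val.var : Fin (n + 1) → Val S (n + 1)) := by
    intro h h'
    funext i
    induction i using Fin.lastCases with
    | last =>
      simp only [Function.comp, Ren.lift, Fin.lastCases_last, single]
      congr 1
      apply Fin.ext
      simp
    | cast i =>
      simp only [Function.comp, Ren.lift, Fin.lastCases_castSucc, single]
      congr 1
      apply Fin.ext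
      simp [midRen_val]
  rw [e, Cmp.subst_var]
  exact .refl _

/-- The weakly closed Freyd PROP of substitutions on the term model. -/
def substModel (S : Signature.{u}) : Model.{u, u} S where
  toModelData := termModelProp S (termAbs S)
  isFreydProp := FreydOperadData.isFreydProp termVal_ren_id termCmp_ren_id
  abs_natural := termAbs_natural
  app_abs := app_termAbs

/-! ## Initiality -/

/-! ### Terms as morphisms of the Freyd PROP of substitutions -/

/-- The morphism that a value represents. -/
def Val.toHom {n : ℕ} (V : Val S n) : (CSub (termModel S)).Hom n 1 :=
  Subs.single (⟦V⟧ : Quotient (valSetoid S n))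

/-- The morphism that a computation represents. -/
def Cmp.toHom {n : ℕ} (M : Cmp S n) : (Sub (termModel S)).Hom n 1 :=
  Subs.single (⟦M⟧ : Quotient (cmpSetoid S n))

theorem Val.toHom_inj {n : ℕ} {V W : Val S n} (h : V.toHom = W.toHom) : ValEq V W := by
  exact Quotient.exact ((valOf_single _).symm.trans ((congrArg valOf h).trans (valOf_single _)))

theorem Subs.cast_ren_eq {O : PreoperadData.{u}} {P : ∀ n : ℕ, O.Op n → Prop} {m n s t : ℕ}
    (a b : ℕ) (r : Ren n m) (hs : s = a + m + b) (ht : t = a + n + b) :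
    (subsProp O P).wh a b (Subs.ren r) hs ht = Subs.ren (Ren.cast ht.symm hs.symm
      ((Ren.add (id : Ren a a) r).add (id : Ren b b))) := by
  subst hs ht; rfl

theorem csub_proj {n : ℕ} (i : Fin n) :
    (csub_isCartesianProp (S := S)).proj i = Subs.ren (fun _ : Fin 1 => i) := by
  refine (congrArg₂ (Subs.comp) (Subs.cast_ren_eq _ _ _ _ _) (Subs.cast_ren_eq _ _ _ _ _)).trans
    ((Subs.ren_comp _ _).trans (Subs.ren_congr fun j => ?_))
  simp only [Function.comp, Ren.cast_val, Ren.add_val, id]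
  split_ifs <;> omega

theorem csub_ofRen {m n : ℕ} (r : Ren m n) :
    (csub_isCartesianProp (S := S)).ofRen r = Subs.ren r := by
  refine ((csub_isCartesianProp (S := S)).eq_tuple fun i => ?_).symm
  rw [csub_proj, csub_proj]
  exact Subs.ren_comp _ _

theorem Val.toHom_var {n : ℕ} (i : Fin n) :
    (Val.var i : Val S n).toHom = (csub_isCartesianProp (S := S)).proj i := by
  rw [csub_proj]
  refine (Subs.single_comp_ren (O := termVal S) (⟦.var 0⟧ : Quotient (valSetoid S 1))
    (fun _ : Fin 1 => i)).symm.trans ?_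
  exact (congrArg (fun z => Subs.comp z _) (Subs.single_one (O := termVal S))).trans
    (Subs.nil_comp _)

/-- Precomposition with a substitution of values is the simultaneous substitution of its
coordinates. -/
theorem comp_eq_subst {m n : ℕ} (x : (CSub (termModel S)).Hom m n) (σ : Fin n → Val S m)
    (h : ∀ i, (CSub (termModel S)).comp (csub_isCartesianProp.proj i) x = (σ i).toHom) :
    (∀ V : Val S n, (CSub (termModel S)).comp V.toHom x = (V.subst σ).toHom) ∧
    (∀ M : Cmp S n, (Sub (termModel S)).comp M.toHom
        ((freydPropOfSubstitutions (termModel S)).J x) = (M.subst σ).toHom) := by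
  obtain ⟨τ, h1, h2, -⟩ := exists_subst x
  have e : ∀ i, ValEq (τ i) (σ i) := fun i => Val.toHom_inj (by
    rw [← h, ← Val.toHom_var]
    exact (h1 (.var i)).symm)
  exact ⟨fun V => (h1 V).trans (congrArg Subs.single (Quotient.sound (Val.subst_congr V e))),
    fun M => (h2 M).trans (congrArg Subs.single (Quotient.sound (Cmp.subst_congr M e)))⟩

theorem Val.toHom_func {n k : ℕ} (f : S.Func k) (V : Fin k → Val S n) :
    (Val.func f V).toHom = (CSub (termModel S)).comp (Subs.single (termModel.func f))
      (csub_isCartesianProp.tuple fun j => (V j).toHom) :=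
  ((comp_eq_subst _ V fun i => csub_isCartesianProp.proj_tuple _ i).1 (.func f Val.var)).symm

theorem Cmp.toHom_proc {n k : ℕ} (p : S.Proc k) (V : Fin k → Val S n) :
    (Cmp.proc p V).toHom = (Sub (termModel S)).comp (Subs.single (termModel.proc p))
      ((freydPropOfSubstitutions (termModel S)).J
        (csub_isCartesianProp.tuple fun j => (V j).toHom)) :=
  ((comp_eq_subst _ V fun i => csub_isCartesianProp.proj_tuple _ i).2 (.proc p Val.var)).symm

theorem Cmp.toHom_app {n : ℕ} (V W : Val S n) :
    (Cmp.app V W).toHom = (Sub (termModel S)).comp (Subs.single (termModel.app S))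
      ((freydPropOfSubstitutions (termModel S)).J
        (csub_isCartesianProp.pair V.toHom W.toHom)) := by
  have hX := csub_isCartesianProp (S := S)
  refine ((comp_eq_subst _ ![V, W] fun i => ?_).2 (.app (.var 0) (.var 1))).symm
  induction i using Fin.addCases (m := 1) (n := 1) with
  | left i =>
    obtain rfl : i = 0 := Subsingleton.elim _ _
    rw [hX.proj_castAdd, hX.proj_zero, hX.id_comp, hX.fst_pair]; rfl
  | right i =>
    obtain rfl : i = 0 := Subsingleton.elim _ _
    rw [hX.proj_natAdd, hX.proj_zero, hX.id_comp, hX.snd_pair]; rfl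

theorem Cmp.toHom_letIn {n : ℕ} (N : Cmp S n) (M : Cmp S (n + 1)) :
    (Cmp.letIn N M).toHom = (substModel S).bind N.toHom M.toHom := by
  refine .symm ((sub_isPreProp.assoc _ _ _).symm.trans ?_)
  refine (congrArg (fun z => Subs.comp z (Subs.ren (Ren.copy n)))
    (Subs.single_comp_sub (O := termCmp S) _ n 0 _ rfl rfl)).trans ?_
  refine (Subs.single_comp_ren (O := termCmp S) _ (Ren.copy n)).trans ?_
  refine congrArg Subs.single (congrArg (Quotient.mk _) ?_)
  change Cmp.letIn ((N.ren (midRen n 0 rfl)).ren (Ren.copy n))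
    ((M.ren (topRen n 0 rfl rfl)).ren (Ren.copy n).lift) = _
  rw [Cmp.ren_ren, Cmp.ren_ren, Cmp.ren_eq_subst N, Cmp.ren_eq_subst M]
  have e1 : ∀ i : Fin n, (Ren.copy n ∘ midRen n 0 rfl) i = i := fun i => Fin.ext
    ((Ren.copy_val n _).trans (by rw [midRen_val]; split_ifs <;> omega))
  have e2 : ∀ i : Fin (n + 1), ((Ren.copy n).lift ∘ topRen n 0 (n := n) rfl rfl) i = i := fun i =>
    Fin.ext (by
      simp only [Function.comp, Ren.lift_val, Ren.copy_val, topRen_val]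
      split_ifs <;> omega)
  simp only [e1, e2]
  exact congrArg₂ _ N.subst_var M.subst_var

/-! ### Morphisms from the Freyd PROP of substitutions -/

/-- The morphism to a model. -/
def substModelHom (Y : Model.{u, w} S) : (substModel S).Hom Y where
  onV := Y.functorV
  onC := Y.functorC
  map_copy n := (Y.functorV_ren _).trans (Y.cart.copy_eq_ofRen n).symm
  map_discard n := (Y.functorV_ren _).trans (Y.cart.discard_eq_ofRen n).symm
  map_J := Y.functorC_J
  map_abs {n} f := by
    obtain ⟨c, rfl⟩ : ∃ c, Subs.single c = f := ⟨_, single_cmpOf f⟩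
    refine (congrArg _ (isTermAbs_termAbs n c)).trans ((Y.functorV_single _).trans ?_)
    refine .trans ?_ (congrArg (Y.abs n) (Y.functorC_single c)).symm
    induction c using Quotient.inductionOn with | _ M
    exact Model.evalVal.eq_3 Y n M
  map_app := by
    refine (Y.functorC_single _).trans ((Model.evalCmp.eq_4 Y 2 _ _).trans ?_)
    have h0 : Y.cart.proj (0 : Fin 2) = Y.cart.fst 1 1 := by
      refine (Y.cart.proj_castAdd 1 (0 : Fin 1)).trans ?_
      rw [Y.cart.proj_zero, Y.cart.id_comp]
    have h1 : Y.cart.proj (1 : Fin 2) = Y.cart.snd 1 1 := Y.cart.proj_last 1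
    rw [Model.evalVal, Model.evalVal, h0, h1, Y.cart.pair_fst_snd, Y.isFreydProp.J_id,
      Y.preC.comp_id]
  map_func {n} f := by
    refine (Y.functorV_single _).trans ((Model.evalVal.eq_2 Y n n f Val.var).trans ?_)
    simp only [Model.evalVal]
    exact (congrArg _ (Y.cart.ofRen_id n)).trans (Y.cart.comp_id _)
  map_proc {n} p := by
    refine (Y.functorC_single _).trans ((Model.evalCmp.eq_3 Y n n p Val.var).trans ?_)
    simp only [Model.evalVal]
    exact (congrArg (fun z => Y.C.comp (Y.proc p) (Y.J z)) (Y.cart.ofRen_id n)).trans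
      ((congrArg _ (Y.isFreydProp.J_id n)).trans (Y.preC.comp_id _))

theorem Model.Hom.map_bind {X : Model.{u, v} S} {Y : Model.{u, w} S} (F : X.Hom Y) {n : ℕ}
    (f : X.C.Hom n 1) (g : X.C.Hom (n + 1) 1) :
    F.onC.map (X.bind f g) = Y.bind (F.onC.map f) (F.onC.map g) := by
  unfold Model.bind
  rw [F.onC.map_comp, F.onC.map_comp, F.onC.map_whiskerL, F.map_J, F.map_copy]

namespace Model.Hom

variable {Y : Model.{u, w} S} (F : (substModel S).Hom Y)

theorem map_ren {m n : ℕ} (r : Ren m n) : F.onV.map (Subs.ren r) = Y.cart.ofRen r := by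
  rw [← csub_ofRen]
  exact F.onV.map_ofRen (substModel S).cart Y.cart F.map_copy F.map_discard r

mutual

theorem map_toHom_val : ∀ {n : ℕ} (V : Val S n), F.onV.map V.toHom = Y.evalVal V
  | _, .var i => by
      rw [Val.toHom_var, Model.evalVal]
      exact F.onV.map_proj (substModel S).cart Y.cart F.map_discard i
  | _, .func f V => by
      rw [Val.toHom_func, Model.evalVal]
      refine (F.onV.map_comp _ _).trans (congrArg₂ _ (F.map_func f) ?_)
      refine (F.onV.map_tuple (substModel S).cart Y.cart F.map_copy F.map_discard _).trans ?_
      congr 1; funext j; exact map_toHom_val (V j)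
  | n, .lam M => by
      rw [Model.evalVal, ← map_toHom_cmp M]
      exact (congrArg _ (isTermAbs_termAbs n _).symm).trans (F.map_abs M.toHom)

theorem map_toHom_cmp : ∀ {n : ℕ} (M : Cmp S n), F.onC.map M.toHom = Y.evalCmp M
  | _, .ret V => by
      rw [Model.evalCmp, ← map_toHom_val V]
      exact F.map_J V.toHom
  | _, .letIn N M => by
      rw [Cmp.toHom_letIn, Model.evalCmp, ← map_toHom_cmp N, ← map_toHom_cmp M]
      exact F.map_bind _ _
  | _, .proc p V => by
      rw [Cmp.toHom_proc, Model.evalCmp]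
      refine (F.onC.map_comp _ _).trans (congrArg₂ _ (F.map_proc p) ((F.map_J _).trans
        (congrArg Y.J ?_)))
      refine (F.onV.map_tuple (substModel S).cart Y.cart F.map_copy F.map_discard _).trans ?_
      congr 1; funext j; exact map_toHom_val (V j)
  | _, .app V W => by
      rw [Cmp.toHom_app, Model.evalCmp]
      refine (F.onC.map_comp _ _).trans (congrArg₂ _ F.map_app ((F.map_J _).trans
        (congrArg Y.J ?_)))
      refine (F.onV.map_pair (substModel S).cart Y.cart F.map_copy _ _).trans ?_
      rw [map_toHom_val V, map_toHom_val W]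

end

theorem onV_eq : F.onV = Y.functorV :=
  PreFunctor.subs_ext _ _ (fun g => by
    induction g using Quotient.inductionOn with | _ V
    exact (F.map_toHom_val V).trans (Y.functorV_single (Quotient.mk _ V)).symm)
    (fun r => (F.map_ren r).trans (Y.functorV_ren r).symm)

theorem onC_eq : F.onC = Y.functorC :=
  PreFunctor.subs_ext _ _ (fun g => by
    induction g using Quotient.inductionOn with | _ M
    exact (F.map_toHom_cmp M).trans (Y.functorC_single (Quotient.mk _ M)).symm)
    (fun r => ((F.map_J (Subs.ren r)).trans (congrArg Y.J (F.map_ren r))).trans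
      (Y.functorC_ren r).symm)

theorem eq_substModelHom : F = substModelHom Y := by
  have h1 := F.onV_eq
  have h2 := F.onC_eq
  cases F
  cases h1
  cases h2
  rfl

end Model.Hom

end FreydCLC

theorem mainTheorem9 (S : FreydCLC.Signature.{u}) :
    (∃! abs : ∀ n : ℕ, (FreydCLC.Sub (FreydCLC.termModel S)).Hom (n + 1) 1 →
        (FreydCLC.CSub (FreydCLC.termModel S)).Hom n 1,
      FreydCLC.IsTermAbs S abs) ∧
    ∀ abs : ∀ n : ℕ, (FreydCLC.Sub (FreydCLC.termModel S)).Hom (n + 1) 1 →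
        (FreydCLC.CSub (FreydCLC.termModel S)).Hom n 1,
      FreydCLC.IsTermAbs S abs →
        ∃ X : FreydCLC.Model.{u, u} S, X.toModelData = FreydCLC.termModelProp S abs ∧
          ∀ Y : FreydCLC.Model.{u, w} S, Nonempty (Unique (X.Hom Y)) := by
  refine ⟨⟨FreydCLC.termAbs S, FreydCLC.isTermAbs_termAbs, fun _ h => h.eq_termAbs⟩, ?_⟩
  intro abs h
  obtain rfl := h.eq_termAbs
  exact ⟨FreydCLC.substModel S, rfl, fun Y =>
    ⟨⟨⟨FreydCLC.substModelHom Y⟩, fun F => F.eq_substModelHom⟩⟩⟩
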